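/- **Setting.** Let $\Lambda=\{0,\dots,n-1\}$ be an open chain of $n$ qudits, $d_{i,i'}=|i-i'|$. Let $H=\sum_Z h_Z$ be $k$-local ($k\ge1$): each $h_Z\succeq0$ is supported on $Z\subseteq\Lambda$ and $h_Z=0$ if $|Z|>k$. Let $g,\gamma>0$ and let $\bar J:\mathbb N\to[0,\infty)$ be decreasing with $\bar J(0)=1$, $\sum_{Z\ni i,i'}\|h_Z\|\le g\bar J(d_{i,i'})$ for all $i,i'$ (including $i=i'$), and $\sum_{x\ge\ell}x^z\bar J(x)\le\gamma\ell^{z+1}\bar J(\ell)$ for $z\in\{0,1\}$, $\ell\ge1$. For real $x\ge0$ write $\bar J(x):=\bar J(\lfloor x\rfloor)$. Let $\mathfrak g$ be the smallest $c$ with $\sum_{i_0}\bar J(d_{i,i_0})\bar J(d_{i_0,i'})\le c\,\bar J(d_{i,i'})$ for all $i,i'\in\Lambda$ (we assume such a $c$ exists). Put $$\tilde g=g\gamma^2\bar J(1),\qquad C=2\Big(\frac1k+\frac1{\mathfrak g}\Big),\qquad v=\max(2gk,\,2g\mathfrak g).$$ Cut $\Lambda$ into consecutive blocks $B_0,B_1,\dots,B_{q+1}$,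 with $B_0\neq\emptyset$ and $|B_1|=\dots=|B_q|=l_0\ge1$. Let $v_s=\sum_{Z\subseteq B_s}h_Z$, let $h_s$ be the sum of the $h_Z$ with $Z\subseteq B_s\cup B_{s+1}$ meeting both blocks, and let $H_{\rm tc}=\sum_{s=0}^{q+1}v_s+\sum_{s=0}^{q}h_s$ be the truncated Hamiltonian. For $0\le s\le q$ let $H_{\le s}=\sum_{s'\le s}v_{s'}+\sum_{s'<s}h_{s'}$, $H_{>s}=\sum_{s'>s}(v_{s'}+h_{s'})$, $H_\tau=H_{\le s}+H_{>s}+\tau h_s$. Let $i_s$ be the last site of $B_s$, and for an integer $r\ge1$ let $\tilde L=[i_s-r,i_s+r]$ and $H_{\tau,\tilde L}=H_{[i_s-r,i_s]}+H_{(i_s,i_s+r]}+\tau h_s$, where $H_L$ is the sum of the terms of $H_{\rm tc}$ supported in $L$. For $\beta>0$ let $$\Phi_s=\mathcal Te^{\int_0^1\phi_{s,\tau}d\tau},\quad \phi_{s,\tau}=\frac\beta2\int_{\mathbb R}f_\beta(t)\,e^{iH_\tau t}h_se^{-iH_\tau t}dt,\quad f_\beta(t)=\frac2{\pi\beta}\log\frac{e^{\pi|t|/\beta}+1}{e^{\pi|t|/\beta}-1},$$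 where $\mathcal T e^{\int}$ is the time-ordered exponential (later $\tau$ to the left), and let $\tilde\Phi_s$ be defined in the same way with $H_{\tau,\tilde L}$ in place of $H_\tau$. **Proposition.** There are functions $\Theta(\beta)=\theta_0+\theta_1\beta$ and $\Theta'(\beta)=\eta_0+\eta_1\beta$ with positive coefficients, those of $\Theta$ depending only on $g,k,\gamma$ and those of $\Theta'$ only on $g,k,\gamma,\mathfrak g$, such that the following holds for all such systems and all $s$, $r$, $\beta$. (1) If $\mathcal F_0(r/3)\le1$, then $$\|\Phi_s-\tilde\Phi_s\|\le e^{\beta\tilde g/2}\Big\{\beta g\gamma^2r^2\Big(1+\frac{k\tilde g\beta}{2\pi^3}\Big)\bar J(r/3)+\frac{k\tilde g\beta^2}{2\pi^3}\Big[9\tilde g\sqrt{C\mathcal F_0(r/3)}+72\tilde g\Big(\frac{\mathcal F_0(r/3)}C\Big)^{\pi/(4v\beta)}\Big]\Big\},$$ and this right-hand side is at most $e^{\Theta(\beta)}\big[r^2\bar J(r/3)+\mathcal F_0(r/3)^{1/\Theta'(\beta)}\big]$. This holds with $\mathcal F_0(x)=C\bar J(x)$ and, if $\tilde L\cap\Lambda\subseteq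 B_1\cup\dots\cup B_q$, also with $\mathcal F_0(x)=C\min(e^{-x/(2l_0)},\bar J(x))$. (2) If $\tilde L\cap\Lambda\subseteq B_1\cup\dots\cup B_q$ and $r>6l_0$, then with $\mathcal F_0(x)=C\min(e^{-x/(2l_0)},\bar J(x))$ $$\|\Phi_s-\tilde\Phi_s\|\le e^{\beta\tilde g/2}\,\frac{k\tilde g\beta^2}{2\pi^3}\Big[9\tilde g\sqrt{\mathcal F_0(r/3)}+72\tilde g\Big(\frac{\mathcal F_0(r/3)}C\Big)^{\pi/(4v\beta)}\Big]\le e^{\Theta(\beta)}\mathcal F_0(r/3)^{1/\Theta'(\beta)},$$ and $$\|\Phi_s-\tilde\Phi_s\|\le e^{\Theta(\beta)}\min\Big(e^{-r/(l_0\Theta(\beta))},\ \bar J(r/3)^{1/\Theta'(\beta)}\Big).$$ -/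

import Mathlib

open scoped Matrix.Norms.L2Operator ComplexOrder

noncomputable section

namespace QBP

/-- Operators on the Hilbert space of a chain of `n` qudits (sites `0, …, n - 1`), as matrices in
the product basis. The norm on this type is the operator norm on the Hilbert space. -/
abbrev Op (n d : ℕ) : Type := Matrix (Fin n → Fin d) (Fin n → Fin d) ℂ

/-- `A` is supported on `Z`: it is of the form `B ⊗ 1` with `B` acting on the qudits in `Z`. -/
def SupportedOn {n d : ℕ} (A : Op n d) (Z : Finset (Fin n)) : Prop :=
  ∃ B : Matrix (Z → Fin d) (Z → Fin d) ℂ, ∀ x y : Fin n → Fin d,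
    A x y = if ∀ i, i ∉ Z → x i = y i then B (fun i => x i) (fun i => y i) else 0

/-- A `k`-local interaction `Z ↦ h_Z` with positive semidefinite terms. -/
structure Interaction (n d k : ℕ) where
  term : Finset (Fin n) → Op n d
  supported : ∀ Z, SupportedOn (term Z) Z
  posSemidef : ∀ Z, (term Z).PosSemidef
  isLocal : ∀ Z, k < Z.card → term Z = 0

/-- `J` is nonnegative and decreasing, `J 0 = 1`, and
`∑_{x ≥ ℓ} x ^ z * J x ≤ γ * ℓ ^ (z + 1) * J ℓ` for `z ∈ {0, 1}` and all `ℓ ≥ 1`. -/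
structure IsDecay (γ : ℝ) (J : ℕ → ℝ) : Prop where
  nonneg : ∀ x, 0 ≤ J x
  anti : Antitone J
  zero : J 0 = 1
  summable : ∀ z : ℕ, z ≤ 1 → Summable fun x : ℕ => (x : ℝ) ^ z * J x
  tail : ∀ z : ℕ, z ≤ 1 → ∀ l : ℕ, 1 ≤ l →
    ∑' x : ℕ, ((l + x : ℕ) : ℝ) ^ z * J (l + x) ≤ γ * (l : ℝ) ^ (z + 1) * J l

/-- `∑_{Z ∋ i, i'} ‖h_Z‖ ≤ g * J (d (i, i'))` for all sites `i, i'` (also for `i = i'`). -/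
def HasDecay {n d k : ℕ} (h : Interaction n d k) (g : ℝ) (J : ℕ → ℝ) : Prop :=
  ∀ i i' : Fin n, ∑ Z : Finset (Fin n) with i ∈ Z ∧ i' ∈ Z, ‖h.term Z‖ ≤ g * J (Nat.dist i i')

/-- The constants `c` with `∑_{i₀} J (d (i, i₀)) * J (d (i₀, i')) ≤ c * J (d (i, i'))` for all
sites `i, i'` of the chain. -/
def convConsts (n : ℕ) (J : ℕ → ℝ) : Set ℝ :=
  {c | ∀ i i' : Fin n, ∑ i₀ : Fin n, J (Nat.dist i i₀) * J (Nat.dist i₀ i') ≤ c * J (Nat.dist i i')}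

/-- The smallest of these constants. -/
def convConst (n : ℕ) (J : ℕ → ℝ) : ℝ := sInf (convConsts n J)

section Blocks

/-- The consecutive blocks `B_0, B_1, …, B_{q+1}` of the chain: `B_0` consists of the first `a`
sites, `B_1, …, B_q` have `l₀` sites each, and `B_{q+1}` contains all remaining sites. -/
def block (n a l₀ q s : ℕ) : Finset (Fin n) :=
  {i | (s = 0 ∨ a + (s - 1) * l₀ ≤ (i : ℕ)) ∧ (s = q + 1 ∨ (i : ℕ) < a + s * l₀)}

/-- `B_1 ∪ ⋯ ∪ B_q`. -/
def middle (n a l₀ q : ℕ) : Finset (Fin n) := (Finset.Icc 1 q).biUnion (block n a l₀ q)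

/-- The last site `i_s` of the block `B_s`, for `s ≤ q` (with `0 < a`). -/
def lastSite (a l₀ s : ℕ) : ℕ := a + s * l₀ - 1

/-- The sites of the chain in `[b - r, b]`. -/
def leftPart (n b r : ℕ) : Finset (Fin n) := {i | b ≤ (i : ℕ) + r ∧ (i : ℕ) ≤ b}

/-- The sites of the chain in `(b, b + r]`. -/
def rightPart (n b r : ℕ) : Finset (Fin n) := {i | b < (i : ℕ) ∧ (i : ℕ) ≤ b + r}

/-- The sites of the chain in `[b - r, b + r]`. -/
def window (n b r : ℕ) : Finset (Fin n) := leftPart n b r ∪ rightPart n b r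

end Blocks

section Hamiltonians

variable {n d k : ℕ} (h : Interaction n d k) (a l₀ q : ℕ)

/-- `v_s`: the terms of the interaction inside the block `B_s`. -/
def blockHam (s : ℕ) : Op n d :=
  ∑ Z : Finset (Fin n) with Z ⊆ block n a l₀ q s, h.term Z

/-- `h_s`: the terms inside `B_s ∪ B_{s+1}` that meet both blocks. -/
def boundaryHam (s : ℕ) : Op n d :=
  ∑ Z : Finset (Fin n) with Z ⊆ block n a l₀ q s ∪ block n a l₀ q (s + 1) ∧
    (Z ∩ block n a l₀ q s).Nonempty ∧ (Z ∩ block n a l₀ q (s + 1)).Nonempty, h.term Z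

/-- `H_{≤ s} = ∑_{s' ≤ s} v_{s'} + ∑_{s' < s} h_{s'}`. -/
def hamLE (s : ℕ) : Op n d :=
  ∑ s' ∈ Finset.range (s + 1), blockHam h a l₀ q s' + ∑ s' ∈ Finset.range s, boundaryHam h a l₀ q s'

/-- `H_{> s} = ∑_{s' > s} (v_{s'} + h_{s'})`, with `s' ≤ q + 1` for `v` and `s' ≤ q` for `h`. -/
def hamGT (s : ℕ) : Op n d :=
  ∑ s' ∈ Finset.Ioc s (q + 1), blockHam h a l₀ q s' + ∑ s' ∈ Finset.Ioc s q, boundaryHam h a l₀ q s'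

/-- The truncated Hamiltonian restricted to `L`: the terms of `∑ v_s + ∑ h_s` (those contained in
the union of two adjacent blocks) whose support is contained in `L`. -/
def subsetHam (L : Finset (Fin n)) : Op n d :=
  ∑ Z : Finset (Fin n) with Z ⊆ L ∧ ∃ s ≤ q, Z ⊆ block n a l₀ q s ∪ block n a l₀ q (s + 1),
    h.term Z

/-- `H_τ = H_{≤ s} + H_{> s} + τ h_s`. -/
def hamTau (s : ℕ) (τ : ℝ) : Op n d :=
  hamLE h a l₀ q s + hamGT h a l₀ q s + (τ : ℂ) • boundaryHam h a l₀ q s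

/-- `H_{[i_s - r, i_s]} + H_{(i_s, i_s + r]} + τ h_s`. -/
def hamTauLocal (s r : ℕ) (τ : ℝ) : Op n d :=
  subsetHam h a l₀ q (leftPart n (lastSite a l₀ s) r) +
    subsetHam h a l₀ q (rightPart n (lastSite a l₀ s) r) + (τ : ℂ) • boundaryHam h a l₀ q s

end Hamiltonians

section BeliefPropagation

variable {n d k : ℕ}

/-- `O(O', t) = exp(i O' t) O exp(-i O' t)`. -/
def evolve (O O' : Op n d) (t : ℝ) : Op n d :=
  NormedSpace.exp ((Complex.I * t) • O') * O * NormedSpace.exp ((-(Complex.I * t)) • O')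

/-- The function `f_β`, with Fourier transform `ω ↦ tanh (β ω / 2) / (β ω / 2)`. -/
def fBeta (β t : ℝ) : ℝ :=
  2 / (Real.pi * β) *
    Real.log ((Real.exp (Real.pi * |t| / β) + 1) / (Real.exp (Real.pi * |t| / β) - 1))

/-- The `m`-th term of the Dyson series of `φ` at time `τ`:
`∫_{τ ≥ τ₁ ≥ ⋯ ≥ τ_m ≥ 0} φ(τ₁) ⋯ φ(τ_m)`. -/
def dysonTerm (φ : ℝ → Op n d) : ℕ → ℝ → Op n d
  | 0 => fun _ => 1
  | m + 1 => fun τ => ∫ σ in (0 : ℝ)..τ, φ σ * dysonTerm φ m σ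

/-- The time-ordered exponential `𝒯 exp (∫_0^1 φ(τ) dτ)`. -/
def timeOrderedExp (φ : ℝ → Op n d) : Op n d := ∑' m : ℕ, dysonTerm φ m 1

/-- `(β / 2) ∫ f_β(t) O(H, t) dt`. -/
def phi (β : ℝ) (O H : Op n d) : Op n d :=
  ((β / 2 : ℝ) : ℂ) • ∫ t : ℝ, (fBeta β t : ℂ) • evolve O H t

/-- The belief propagation operator `Φ_s`. -/
def Phi (h : Interaction n d k) (a l₀ q : ℕ) (β : ℝ) (s : ℕ) : Op n d :=
  timeOrderedExp fun τ => phi β (boundaryHam h a l₀ q s) (hamTau h a l₀ q s τ)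

/-- The belief propagation operator `Φ̃_s` of the Hamiltonian restricted to `[i_s - r, i_s + r]`. -/
def PhiLocal (h : Interaction n d k) (a l₀ q : ℕ) (β : ℝ) (s r : ℕ) : Op n d :=
  timeOrderedExp fun τ => phi β (boundaryHam h a l₀ q s) (hamTauLocal h a l₀ q s r τ)

end BeliefPropagation

section Constants

/-- `g̃ = g γ² J(1)`. -/
def gTilde (g γ : ℝ) (J : ℕ → ℝ) : ℝ := g * γ ^ 2 * J 1

/-- `C = 2 (1 / k + 1 / 𝔤)`. -/
def lrC (k : ℕ) (𝔤 : ℝ) : ℝ := 2 * (1 / (k : ℝ) + 1 / 𝔤)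

/-- `v = max (2 g k, 2 g 𝔤)`. -/
def lrV (g : ℝ) (k : ℕ) (𝔤 : ℝ) : ℝ := max (2 * g * k) (2 * g * 𝔤)

/-- `F₀(x) = C J(⌊x⌋)`. -/
def lrInfinite (k : ℕ) (𝔤 : ℝ) (J : ℕ → ℝ) (x : ℝ) : ℝ := lrC k 𝔤 * J ⌊x⌋₊

/-- `F₀(x) = C min (exp (-x / (2 l₀)), J(⌊x⌋))`. -/
def lrTruncated (k : ℕ) (𝔤 : ℝ) (J : ℕ → ℝ) (l₀ : ℕ) (x : ℝ) : ℝ :=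
  lrC k 𝔤 * min (Real.exp (-x / (2 * l₀))) (J ⌊x⌋₊)

/-- The general error bound, as a function of `r`, `J̄ = J(⌊r / 3⌋)` and `F = F₀(r / 3)`. -/
def boundGeneral (g γ β : ℝ) (k : ℕ) (𝔤 : ℝ) (J : ℕ → ℝ) (r : ℕ) (F : ℝ) : ℝ :=
  Real.exp (β * gTilde g γ J / 2) *
    (β * g * γ ^ 2 * (r : ℝ) ^ 2 * (1 + k * gTilde g γ J * β / (2 * Real.pi ^ 3)) *
        J ⌊(r : ℝ) / 3⌋₊ +
      k * gTilde g γ J * β ^ 2 / (2 * Real.pi ^ 3) *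
        (9 * gTilde g γ J * √(lrC k 𝔤 * F) +
          72 * gTilde g γ J * (F / lrC k 𝔤) ^ (Real.pi / (4 * lrV g k 𝔤 * β))))

/-- The error bound for `r > 6 l₀`, as a function of `F = F₀(r / 3)`. -/
def boundReduced (g γ β : ℝ) (k : ℕ) (𝔤 : ℝ) (J : ℕ → ℝ) (F : ℝ) : ℝ :=
  Real.exp (β * gTilde g γ J / 2) *
    (k * gTilde g γ J * β ^ 2 / (2 * Real.pi ^ 3)) *
      (9 * gTilde g γ J * √F +
        72 * gTilde g γ J * (F / lrC k 𝔤) ^ (Real.pi / (4 * lrV g k 𝔤 * β)))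

end Constants

end QBP

end

/-! `Φ_s` and `Φ̃_s` are time-ordered exponentials of filtered evolutions of the same operator
`h_s`. Since `f_β ≥ 0` has integral `1`, both integrands have norm at most `βU/2`, where `U =
gγJ(1)` bounds `‖h_s‖`. Comparing the Dyson series term by term (`norm_timeOrderedExp_sub_le`)
reduces the claim to a bound on the difference of the two evolutions of `h_s`, integrated against
`f_β`.

Write `h_s = N + F`, where `N` collects the terms within `r/3` of the cut. The other terms of the
Hamiltonian lie on one side of the cut and split into `K` inside the window, `O` outside of it, and
the terms `V + G` crossing one of its ends, with `V` at distance at least `r/3` from `N`. Both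
evolutions of `N` are compared with the one generated by `K + τN` (`norm_heis_add_sub_le`). The part
`O` commutes with `K` and `N` and drops out. The terms of `F` and `G` stretch over about `r/3`, so
their norms are of order `r² J(r/3)`. By Duhamel's formula, what remains is the commutator of `V`
with the evolved `N`.

That commutator is controlled by a Lieb–Robinson bound (`norm_comm_heis_term_le`), valid for every
weight on the sites that is at least `1` on the target and is reproduced by the interaction up to a
factor `κ`. The weight `∑_{z ∈ Z} J(d(x, z))` has `κ = g𝔤`. An exponential in the position with rate
`1/(2l₀)` has `κ = egk`, because truncated terms inside `B_1 ∪ ⋯ ∪ B_q` have diameter below `2l₀`.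
These give the two entries of the minimum in `F₀`.

The Lieb–Robinson bound grows like `exp(κ|t|)` while `f_β` decays only like `exp(-π|t|/β)`. It is
therefore interpolated with the trivial bound through `min 1 x ≤ x^θ` (`exists_exp_bound`), with `θ
= 1/2` or `θ = π/(4vβ)` depending on `β`; hence the two powers of `F₀`. If the window lies in `B_1 ∪
⋯ ∪ B_q` and `r > 6l₀`, then `F` and `G` are empty, which gives part (2).

Positivity of the terms enters through `HalfBounded`: it improves the commutator bound `2‖a‖‖b‖` to
`‖a‖‖b‖/2`, and the numerical constants rely on this. -/

noncomputable section

namespace QBP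

/-! ### Heisenberg evolution in a C⋆-algebra and differential inequalities for commutators. -/

section Heisenberg

open Complex NormedSpace

variable {A : Type*} [CStarAlgebra A]

/-- The Heisenberg evolution `exp(i P t) O exp(-i P t)` in a C⋆-algebra. -/
def heis (P O : A) (t : ℝ) : A := exp ((I * t) • P) * O * exp ((-(I * t)) • P)

/-- The commutator of two elements. -/
def comm (a b : A) : A := a * b - b * a

theorem exp_I_smul_eq (P : A) (t : ℝ) :
    exp ((I * t) • P) = exp (t • (I • P)) := by
  rw [mul_comm, mul_smul, Complex.coe_smul]

theorem exp_neg_I_smul_eq (P : A) (t : ℝ) : exp ((-(I * t)) • P) = exp ((-t) • (I • P)) := by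
  rw [mul_comm, ← neg_mul, mul_smul, ← Complex.ofReal_neg, Complex.coe_smul]

theorem exp_I_smul_mem_unitary {P : A} (hP : IsSelfAdjoint P) (t : ℝ) :
    exp (t • (I • P)) ∈ unitary A := by
  let +nondep : NormedAlgebra ℚ A := .restrictScalars ℚ ℂ A
  refine exp_mem_unitary_of_mem_skewAdjoint ?_
  rw [skewAdjoint.mem_iff]
  simp [hP.star_eq]

theorem exp_smul_mul_exp_neg_smul (k : A) (t : ℝ) : exp (t • k) * exp ((-t) • k) = 1 := by
  let +nondep : NormedAlgebra ℚ A := .restrictScalars ℚ ℂ A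
  rw [← exp_add_of_commute (((Commute.refl k).smul_left _).smul_right _), ← add_smul]
  simp

theorem exp_neg_smul_mul_exp_smul (k : A) (t : ℝ) : exp ((-t) • k) * exp (t • k) = 1 := by
  simpa using exp_smul_mul_exp_neg_smul k (-t)

theorem heis_eq (P O : A) (t : ℝ) :
    heis P O t = exp (t • (I • P)) * O * exp ((-t) • (I • P)) := by
  rw [heis, exp_I_smul_eq, exp_neg_I_smul_eq]

theorem heis_zero_time (P O : A) : heis P O 0 = O := by simp [heis]

theorem heis_neg_time (P O : A) (t : ℝ) : heis P O (-t) = heis (-P) O t := by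
  simp [heis_eq]

theorem heis_add (P X Y : A) (t : ℝ) : heis P (X + Y) t = heis P X t + heis P Y t := by
  simp only [heis]; noncomm_ring

theorem heis_sub (P X Y : A) (t : ℝ) : heis P (X - Y) t = heis P X t - heis P Y t := by
  simp only [heis]; noncomm_ring

theorem heis_smul (P X : A) (c : ℂ) (t : ℝ) : heis P (c • X) t = c • heis P X t := by
  simp [heis]

theorem heis_sum {ι : Type*} (P : A) (s : Finset ι) (X : ι → A) (t : ℝ) :
    heis P (∑ i ∈ s, X i) t = ∑ i ∈ s, heis P (X i) t := by
  simp [heis, Finset.mul_sum, Finset.sum_mul]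

theorem heis_mul (P X Y : A) (t : ℝ) : heis P (X * Y) t = heis P X t * heis P Y t := by
  have h := exp_neg_smul_mul_exp_smul (I • P) t
  simp only [heis_eq]
  calc _ = exp (t • I • P) * X * 1 * Y * exp (-t • I • P) := by noncomm_ring
    _ = _ := by rw [← h]; noncomm_ring

theorem heis_comm (P X Y : A) (t : ℝ) :
    heis P (comm X Y) t = comm (heis P X t) (heis P Y t) := by
  simp only [comm, heis_sub, heis_mul]

theorem heis_of_commute {P O : A} (h : Commute P O) (t : ℝ) : heis P O t = O := by
  have h1 : Commute (exp (t • (I • P))) O := by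
    let +nondep : NormedAlgebra ℚ A := .restrictScalars ℚ ℂ A
    exact ((h.smul_left I).smul_left t).exp_left
  rw [heis_eq, h1.eq, mul_assoc, exp_smul_mul_exp_neg_smul, mul_one]

theorem heis_self (P : A) (t : ℝ) : heis P P t = P := heis_of_commute (Commute.refl P) t

theorem heis_neg_heis (P O : A) (t : ℝ) : heis (-P) (heis P O t) t = O := by
  have h := exp_neg_smul_mul_exp_smul (I • P) t
  simp only [heis_eq, smul_neg, neg_smul, neg_neg] at h ⊢
  rw [← mul_assoc, ← mul_assoc, h, one_mul, mul_assoc, h, mul_one]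

/-- The exponentials of `P + Q` factor, and the inner conjugation by the exponential of `Q` fixes
`O`. -/
theorem heis_add_of_commute {P Q O : A} (hPQ : Commute P Q) (hQ : Commute Q O) (t : ℝ) :
    heis (P + Q) O t = heis P O t := by
  let +nondep : NormedAlgebra ℚ A := .restrictScalars ℚ ℂ A
  have h1 : ∀ t : ℝ, exp (t • (I • (P + Q))) = exp (t • (I • P)) * exp (t • (I • Q)) := fun t => by
    rw [← exp_add_of_commute, ← smul_add, ← smul_add]
    exact (((hPQ.smul_left I).smul_right I).smul_left t).smul_right t
  have h2 : exp ((-t) • (I • P)) * exp ((-t) • (I • Q))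
      = exp ((-t) • (I • Q)) * exp ((-t) • (I • P)) :=
    ((((hPQ.smul_left I).smul_right I).smul_left _).smul_right _).exp
  have h3 := heis_of_commute hQ t
  rw [heis_eq] at h3
  rw [heis_eq, h1, h1, h2, heis_eq]
  calc _ = exp (t • I • P) * (exp (t • I • Q) * O * exp (-t • I • Q)) * exp (-t • I • P) := by
        simp only [mul_assoc]
    _ = _ := by rw [h3]

theorem norm_heis {P : A} (hP : IsSelfAdjoint P) (O : A) (t : ℝ) : ‖heis P O t‖ = ‖O‖ := by
  rw [heis_eq, CStarRing.norm_mul_mem_unitary _ (exp_I_smul_mem_unitary hP _),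
    CStarRing.norm_mem_unitary_mul _ (exp_I_smul_mem_unitary hP _)]

/-- The observable may depend on `s`, so that compositions of two evolutions (interaction pictures)
can be differentiated. -/
theorem hasDerivAt_heis_comp {O : ℝ → A} {O' : A} {s : ℝ} (hO : HasDerivAt O O' s) (P : A) :
    HasDerivAt (fun s => heis P (O s) s) (heis P (I • comm P (O s) + O') s) s := by
  have h1 := hasDerivAt_exp_smul_const (𝕂 := ℝ) (I • P) s
  have h2 : HasDerivAt (fun u : ℝ => exp ((-u) • (I • P)))
      (-((I • P) * exp ((-s) • (I • P)))) s := by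
    have h := (hasDerivAt_exp_smul_const' (𝕂 := ℝ) (I • P) (-s)).scomp s (hasDerivAt_neg s)
    simpa [Function.comp_def] using h
  have h3 := (h1.mul hO).mul h2
  have h4 : (fun s => heis P (O s) s)
      = fun s : ℝ => NormedSpace.exp (s • (I • P)) * O s
        * NormedSpace.exp ((-s) • (I • P)) := by
    ext s; rw [heis_eq]
  rw [h4]
  refine h3.congr_deriv ?_
  have h5 : I • comm P (O s) = (I • P) * O s - O s * (I • P) := by
    rw [comm, smul_sub, smul_mul_assoc, mul_smul_comm]
  rw [heis_eq, h5, Pi.mul_apply]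
  generalize exp (s • (I • P)) = u
  generalize exp (-s • (I • P)) = v
  generalize I • P = k
  noncomm_ring

theorem hasDerivAt_heis (P O : A) (s : ℝ) :
    HasDerivAt (fun s => heis P O s) (heis P (I • comm P O) s) s := by
  simpa using hasDerivAt_heis_comp (hasDerivAt_const s O) P

theorem continuous_heis (P O : A) : Continuous (fun s => heis P O s) :=
  continuous_iff_continuousAt.2 fun s => (hasDerivAt_heis P O s).continuousAt

theorem continuous_heis_left (O : A) (t : ℝ) : Continuous (fun P : A => heis P O t) := by
  let +nondep : NormedAlgebra ℚ A := .restrictScalars ℚ ℂ A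
  unfold QBP.heis
  fun_prop

/-- The distance from `a` to the scalars is at most half the norm of `a`, as for `0 ≤ a`. -/
def HalfBounded (a : A) : Prop := ∃ c : ℂ, ‖a - algebraMap ℂ A c‖ ≤ ‖a‖ / 2

/-- A commutator does not see scalars, so `a` may be replaced by `a - c`, of half the norm. -/
theorem HalfBounded.norm_comm_le {a : A} (ha : HalfBounded a) (b : A) :
    ‖comm a b‖ ≤ ‖a‖ * ‖b‖ := by
  obtain ⟨c, hc⟩ := ha
  have h : comm a b = comm (a - algebraMap ℂ A c) b := by
    simp only [comm, sub_mul, mul_sub, Algebra.commutes c b]; abel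
  calc ‖comm a b‖ ≤ ‖a - algebraMap ℂ A c‖ * ‖b‖ + ‖b‖ * ‖a - algebraMap ℂ A c‖ := by
        rw [h]
        exact (norm_sub_le _ _).trans (add_le_add (norm_mul_le _ _) (norm_mul_le _ _))
    _ ≤ ‖a‖ * ‖b‖ := by nlinarith [norm_nonneg b]

/-- Shifting the second factor as well gains another `1/2`. -/
theorem HalfBounded.norm_comm_le_half {a b : A} (ha : HalfBounded a) (hb : HalfBounded b) :
    ‖comm a b‖ ≤ ‖a‖ * ‖b‖ / 2 := by
  obtain ⟨c, hc⟩ := hb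
  have h : comm a b = comm a (b - algebraMap ℂ A c) := by
    simp only [comm, sub_mul, mul_sub, Algebra.commutes c a]; abel
  rw [h]
  exact (ha.norm_comm_le _).trans (by nlinarith [norm_nonneg a])

theorem HalfBounded.heis {P a : A} (ha : HalfBounded a) (hP : IsSelfAdjoint P) (t : ℝ) :
    HalfBounded (heis P a t) := by
  obtain ⟨c, hc⟩ := ha
  refine ⟨c, ?_⟩
  rw [norm_heis hP]
  refine le_trans (le_of_eq ?_) hc
  rw [← norm_heis hP (a - _) t, heis_sub,
    heis_of_commute (Algebra.commute_algebraMap_right c P)]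

/-- Both evolutions fix the scalar `c`, so only `a - c` contributes, twice with norm at most
`‖a‖/2`. -/
theorem HalfBounded.norm_heis_sub_heis_le {a P Q : A} (ha : HalfBounded a) (hP : IsSelfAdjoint P)
    (hQ : IsSelfAdjoint Q) (t : ℝ) : ‖QBP.heis P a t - QBP.heis Q a t‖ ≤ ‖a‖ := by
  obtain ⟨c, hc⟩ := ha
  have h : QBP.heis P a t - QBP.heis Q a t
      = QBP.heis P (a - algebraMap ℂ A c) t - QBP.heis Q (a - algebraMap ℂ A c) t := by
    rw [heis_sub, heis_sub, heis_of_commute (Algebra.commute_algebraMap_right c P),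
      heis_of_commute (Algebra.commute_algebraMap_right c Q)]
    abel
  rw [h]
  refine (norm_sub_le _ _).trans ?_
  rw [norm_heis hP, norm_heis hQ]
  linarith

/-- The spectrum lies in `[0, ‖a‖]`; subtract its midpoint. -/
theorem halfBounded_of_nonneg [PartialOrder A] [StarOrderedRing A] {a : A} (ha : 0 ≤ a) :
    HalfBounded a := by
  refine ⟨((‖a‖ / 2 : ℝ) : ℂ), ?_⟩
  have h1 : a - algebraMap ℂ A ((‖a‖ / 2 : ℝ) : ℂ) = cfc (fun x : ℝ => x - ‖a‖ / 2) a := by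
    rw [cfc_sub (fun x : ℝ => x) (fun _ => ‖a‖ / 2) a, cfc_id' ℝ a, cfc_const _ a,
      ← Complex.coe_algebraMap, ← IsScalarTower.algebraMap_apply ℝ ℂ A]
  rw [h1]
  refine norm_cfc_le (by positivity) fun x hx => ?_
  have h2 : 0 ≤ x := spectrum_nonneg_of_nonneg ha hx
  have h3 : ‖x‖ ≤ ‖a‖ := by
    rcases subsingleton_or_nontrivial A with h | h
    · simp at hx
    · exact spectrum.norm_le_norm_of_mem hx
  rw [Real.norm_eq_abs, abs_le] at *
  constructor <;> linarith [h3.2]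

/-- Comparison of two Heisenberg evolutions by Duhamel's formula. -/
theorem norm_heis_sub_heis_le_of_norm_comm_le {P Q O : A} (hP : IsSelfAdjoint P) {b b' : ℝ → ℝ}
    (hb0 : 0 ≤ b 0) (hb : ∀ s, HasDerivAt b (b' s) s) {t : ℝ} (ht : 0 ≤ t)
    (h : ∀ s, 0 ≤ s → ‖comm (P - Q) (heis Q O s)‖ ≤ b' s) :
    ‖heis P O t - heis Q O t‖ ≤ b t := by
  -- Evolving back with `P` after evolving with `Q` leaves a derivative that involves only `P - Q`.
  have hd : ∀ s, HasDerivAt (fun s => heis (-P) (heis Q O s) s - O)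
      (heis (-P) (-(I • comm (P - Q) (heis Q O s))) s) s := fun s => by
    refine ((hasDerivAt_heis_comp (hasDerivAt_heis Q O s) (-P)).sub_const O).congr_deriv ?_
    congr 1
    rw [heis_smul, heis_comm, heis_self, ← smul_add, ← smul_neg]
    simp only [comm]
    congr 1
    noncomm_ring
  have key := image_norm_le_of_norm_deriv_right_le_deriv_boundary' (a := 0) (b := t)
    (fun s _ => (hd s).continuousAt.continuousWithinAt) (fun s _ => (hd s).hasDerivWithinAt)
    (B := b) (B' := b') (by simpa [heis_zero_time] using hb0)
    (fun s _ => (hb s).continuousAt.continuousWithinAt) (fun s _ => (hb s).hasDerivWithinAt)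
    (fun s hs => by
      rw [norm_heis hP.neg, norm_neg, norm_smul, norm_I, one_mul]
      exact h s hs.1) (Set.right_mem_Icc.2 ht)
  have e : heis P O t - heis Q O t = -heis P (heis (-P) (heis Q O t) t - O) t := by
    have := heis_neg_heis (-P) (heis Q O t) t
    rw [neg_neg] at this
    rw [heis_sub, this]; abel
  rw [e, norm_neg, norm_heis hP]
  exact key

/-- The differential inequality behind the Lieb–Robinson bound: only the part `Q` of the generator
`Q + K` that does not commute with `a` contributes. -/
theorem norm_comm_heis_le {Q K a B : A} (hQ : IsSelfAdjoint Q) (hK : IsSelfAdjoint K)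
    (ha : HalfBounded a) (hKa : Commute K a) {b b' : ℝ → ℝ} (hb0 : ‖comm a B‖ ≤ b 0)
    (hb : ∀ s, HasDerivAt b (b' s) s)
    (h : ∀ s, 0 ≤ s → ‖a‖ * ‖comm (heis (Q + K) Q s) B‖ ≤ b' s) {t : ℝ} (ht : 0 ≤ t) :
    ‖comm (heis (Q + K) a t) B‖ ≤ b t := by
  have hP : IsSelfAdjoint (Q + K) := hQ.add hK
  -- Interaction picture: `B` is evolved backwards by `Q + K` and then forwards by `K`. The
  -- derivative contains only `Q`, and the `K`-evolution does not affect the commutator with `a`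
  -- because `K` commutes with `a`.
  set V : ℝ → A := fun s => heis K (heis (-(Q + K)) B s) s with hV
  have hdV : ∀ s, HasDerivAt V (heis K (-(I • comm Q (heis (-(Q + K)) B s))) s) s := fun s => by
    refine (hasDerivAt_heis_comp (hasDerivAt_heis (-(Q + K)) B s) K).congr_deriv ?_
    congr 1
    rw [heis_smul, heis_comm, heis_self, ← smul_add, ← smul_neg]
    simp only [comm]
    congr 1
    noncomm_ring
  have hd : ∀ s, HasDerivAt (fun s => comm a (V s))
      (comm a (heis K (-(I • comm Q (heis (-(Q + K)) B s))) s)) s := fun s => by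
    simp only [comm]
    exact ((hdV s).const_mul a).sub ((hdV s).mul_const a)
  -- Conjugation by the full evolution preserves norms and moves the time dependence from `B` to
  -- `X`.
  have e : ∀ (X : A) s, heis (Q + K) (comm X (heis (-(Q + K)) B s)) s
      = comm (heis (Q + K) X s) B := fun X s => by
    have := heis_neg_heis (-(Q + K)) B s
    rw [neg_neg] at this
    rw [heis_comm, this]
  have key := image_norm_le_of_norm_deriv_right_le_deriv_boundary' (a := 0) (b := t)
    (fun s _ => (hd s).continuousAt.continuousWithinAt) (fun s _ => (hd s).hasDerivWithinAt)
    (B := b) (B' := b') (by simpa [hV, heis_zero_time] using hb0)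
    (fun s _ => (hb s).continuousAt.continuousWithinAt) (fun s _ => (hb s).hasDerivWithinAt)
    (fun s hs => by
      refine (ha.norm_comm_le _).trans ?_
      rw [norm_heis hK, norm_neg, norm_smul, norm_I, one_mul,
        ← norm_heis hP (comm Q _) s, e]
      exact h s hs.1) (Set.right_mem_Icc.2 ht)
  have e2 : comm a (V t) = heis K (comm a (heis (-(Q + K)) B t)) t := by
    rw [heis_comm, heis_of_commute hKa]
  rw [e2, norm_heis hK, ← norm_heis hP _ t, e] at key
  exact key

end Heisenberg

/-! ### The filter `f_β`: normalization and exponential moments. -/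

section Filter

open MeasureTheory Set

theorem integral_exp_neg_mul_abs {c : ℝ} (hc : 0 < c) : ∫ t : ℝ, Real.exp (-c * |t|) = 2 / c := by
  rw [integral_comp_abs (f := fun t => Real.exp (-c * t)), integral_exp_mul_Ioi (by linarith) 0]
  simp; field_simp

theorem integrable_exp_neg_mul_abs {c : ℝ} (hc : 0 < c) :
    Integrable fun t : ℝ => Real.exp (-c * |t|) := by
  -- The integral of a non-integrable function is `0` by convention, so a nonzero value proves
  -- integrability.
  refine Integrable.of_integral_ne_zero ?_
  rw [integral_exp_neg_mul_abs hc]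
  positivity

theorem hasSum_one_div_odd_sq :
    HasSum (fun j : ℕ => 1 / (2 * (j : ℝ) + 1) ^ 2) (Real.pi ^ 2 / 8) := by
  set f : ℕ → ℝ := fun n => 1 / (n : ℝ) ^ 2 with hf
  have h : HasSum f (Real.pi ^ 2 / 6) := hasSum_zeta_two
  have ho : Summable fun j : ℕ => f (2 * j + 1) :=
    h.summable.comp_injective fun a b hab => by simpa using hab
  have he : HasSum (fun j : ℕ => f (2 * j)) (1 / 4 * (Real.pi ^ 2 / 6)) := by
    have e : (fun j : ℕ => f (2 * j)) = fun j => 1 / 4 * f j := by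
      ext j; simp only [hf]; push_cast; ring
    rw [e]
    exact h.mul_left _
  have := (HasSum.even_add_odd he ho.hasSum).unique h
  have e : ∑' j : ℕ, f (2 * j + 1) = Real.pi ^ 2 / 8 := by linarith
  have e2 : (fun j : ℕ => 1 / (2 * (j : ℝ) + 1) ^ 2) = fun j => f (2 * j + 1) := by
    ext j; simp only [hf]; push_cast; ring
  rw [← e, e2]
  exact ho.hasSum

theorem fBeta_nonneg {β : ℝ} (hβ : 0 < β) (t : ℝ) : 0 ≤ fBeta β t := by
  have h0 : 0 ≤ Real.pi * |t| / β := by positivity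
  rcases h0.eq_or_lt with h | h
  -- At `t = 0` the denominator vanishes, and the conventions for division and `log` give `f_β(0) =
  -- 0`.
  · rw [fBeta, ← h]; simp
  · have h1 : 1 < Real.exp (Real.pi * |t| / β) := Real.one_lt_exp_iff.2 h
    refine mul_nonneg (by positivity) (Real.log_nonneg ?_)
    rw [le_div_iff₀ (by linarith)]; linarith

/-- The series of `log(1 + x) - log(1 - x)` at `x = exp(-π|t|/β)`. -/
theorem hasSum_fBeta {β : ℝ} (hβ : 0 < β) {t : ℝ} (ht : t ≠ 0) :
    HasSum (fun j : ℕ => 4 / (Real.pi * β) / (2 * j + 1) *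
      Real.exp (-((2 * j + 1) * Real.pi / β) * |t|)) (fBeta β t) := by
  have h0 : 0 < Real.pi * |t| / β := by positivity
  set z := Real.pi * |t| / β with hz
  have hx1 : Real.exp (-z) < 1 := Real.exp_lt_one_iff.2 (by linarith)
  have hx0 := Real.exp_pos (-z)
  have h := (Real.hasSum_log_sub_log_of_abs_lt_one (x := Real.exp (-z))
    (by rw [abs_of_pos hx0]; exact hx1)).mul_left (2 / (Real.pi * β))
  have e : fBeta β t
      = 2 / (Real.pi * β) * (Real.log (1 + Real.exp (-z)) - Real.log (1 - Real.exp (-z))) := by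
    rw [fBeta, ← hz, ← Real.log_div (by linarith) (by linarith)]
    congr 2
    have h1 : 1 < Real.exp z := Real.one_lt_exp_iff.2 h0
    rw [Real.exp_neg, div_eq_div_iff (by linarith) (by
      have := inv_lt_one_of_one_lt₀ h1
      linarith)]
    field_simp
  rw [e]
  refine h.congr_fun fun j => ?_
  rw [← Real.exp_nat_mul]
  have : -((2 * (j : ℝ) + 1) * Real.pi / β) * |t| = ((2 * j + 1 : ℕ) : ℝ) * -z := by
    rw [hz]; push_cast; ring
  rw [this]; ring

theorem summable_fBeta_moment {a : ℝ} (ha0 : 0 ≤ a) (ha : a < 1) :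
    Summable fun j : ℕ => 1 / ((2 * (j : ℝ) + 1) * (2 * j + 1 - a)) := by
  refine Summable.of_nonneg_of_le (fun j => ?_) (fun j => ?_)
    (hasSum_one_div_odd_sq.summable.mul_left (1 / (1 - a)))
  · have : (0 : ℝ) ≤ j := j.cast_nonneg
    have : 0 < 2 * (j : ℝ) + 1 - a := by linarith
    positivity
  · have hj : (0 : ℝ) ≤ j := j.cast_nonneg
    have h1 : 0 < 1 - a := by linarith
    rw [div_mul_div_comm, one_mul]
    refine one_div_le_one_div_of_le (by positivity) ?_
    nlinarith [mul_nonneg hj ha0]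

/-- Termwise integration: with `a = αβ/π`, the `j`-th term decays at the rate `(2j + 1 - a)π/β`,
which is positive because `a < 1`. -/
theorem integrable_and_integral_fBeta_mul_exp {β α : ℝ} (hβ : 0 < β) (hα : 0 ≤ α)
    (h : α * β / Real.pi < 1) :
    Integrable (fun t => fBeta β t * Real.exp (α * |t|)) ∧
      ∫ t, fBeta β t * Real.exp (α * |t|) = 8 / Real.pi ^ 2 *
        ∑' j : ℕ, 1 / ((2 * (j : ℝ) + 1) * (2 * j + 1 - α * β / Real.pi)) := by
  have hπ := Real.pi_pos
  set a := α * β / Real.pi with ha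
  have ha0 : 0 ≤ a := by positivity
  have hαe : α = a * Real.pi / β := by rw [ha]; field_simp
  have hc : ∀ j : ℕ, 0 < (2 * j + 1 - a) * Real.pi / β := fun j => by
    have : (0 : ℝ) ≤ j := j.cast_nonneg
    have : 0 < 2 * (j : ℝ) + 1 - a := by linarith
    positivity
  set F : ℕ → ℝ → ℝ := fun j t => 4 / (Real.pi * β) / (2 * j + 1) *
    Real.exp (-((2 * j + 1 - a) * Real.pi / β) * |t|) with hF
  have hFi : ∀ j, Integrable (F j) := fun j => (integrable_exp_neg_mul_abs (hc j)).const_mul _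
  have hFint : ∀ j : ℕ, ∫ t, F j t
      = 8 / Real.pi ^ 2 * (1 / ((2 * (j : ℝ) + 1) * (2 * j + 1 - a))) := fun j => by
    rw [hF]
    simp only
    rw [integral_const_mul, integral_exp_neg_mul_abs (hc j)]
    have : (0 : ℝ) ≤ j := j.cast_nonneg
    have : 0 < 2 * (j : ℝ) + 1 - a := by linarith
    field_simp
    norm_num
  have hs := (summable_fBeta_moment ha0 h).mul_left (8 / Real.pi ^ 2)
  have hnorm : ∀ j : ℕ, (fun t => ‖F j t‖) = F j := fun j => by
    ext t
    rw [Real.norm_eq_abs, abs_of_nonneg]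
    simp only [hF]; positivity
  have key := hasSum_integral_of_summable_integral_norm hFi (by
    simp only [hnorm, hFint]; exact hs)
  have hae : (fun t => ∑' j, F j t) =ᵐ[volume] fun t => fBeta β t * Real.exp (α * |t|) := by
    have : ∀ᵐ t : ℝ, t ≠ 0 := by simp [ae_iff]
    filter_upwards [this] with t ht
    rw [← ((hasSum_fBeta hβ ht).mul_right (Real.exp (α * |t|))).tsum_eq]
    refine tsum_congr fun j => ?_
    simp only [hF]
    rw [mul_assoc, ← Real.exp_add, hαe]
    congr 2; ring
  rw [integral_congr_ae hae] at key
  simp only [hFint] at key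
  have hval := key.tsum_eq
  rw [tsum_mul_left] at hval
  refine ⟨Integrable.of_integral_ne_zero ?_, hval.symm⟩
  rw [← hval]
  have h1 : 0 < ∑' j : ℕ, 1 / ((2 * (j : ℝ) + 1) * (2 * j + 1 - a)) :=
    (summable_fBeta_moment ha0 h).tsum_pos (fun j => by
      have : (0 : ℝ) ≤ j := j.cast_nonneg
      have : 0 < 2 * (j : ℝ) + 1 - a := by linarith
      positivity) 0 (by simp; linarith)
  positivity

theorem integrable_fBeta {β : ℝ} (hβ : 0 < β) : Integrable (fBeta β) := by
  simpa using (integrable_and_integral_fBeta_mul_exp hβ le_rfl (by simp)).1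

theorem integral_fBeta {β : ℝ} (hβ : 0 < β) : ∫ t, fBeta β t = 1 := by
  have h := (integrable_and_integral_fBeta_mul_exp hβ le_rfl (by simp)).2
  have e : ∀ j : ℕ, 1 / ((2 * (j : ℝ) + 1) * (2 * j + 1)) = 1 / (2 * (j : ℝ) + 1) ^ 2 :=
    fun j => by rw [sq]
  simp only [zero_mul, zero_div, Real.exp_zero, mul_one, sub_zero, e,
    hasSum_one_div_odd_sq.tsum_eq] at h
  rw [h]
  have := Real.pi_pos
  field_simp

theorem integrable_fBeta_mul_exp_sub_one {β α : ℝ} (hβ : 0 < β) (hα : 0 < α)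
    (h : α * β / Real.pi < 1) :
    Integrable (fun t => fBeta β t * ((Real.exp (α * |t|) - 1) / α)) := by
  have := (((integrable_and_integral_fBeta_mul_exp hβ hα.le h).1.sub (integrable_fBeta hβ)).div_const
    α)
  refine this.congr (ae_of_all _ fun t => ?_)
  simp only [Pi.sub_apply]; ring

/-- With `a = αβ/π` and `m = 2j + 1`, the excess of `1/(m(m - a))` over `1/m²` is `a/(m²(m - a))`.
It is at most `a/(3m²(1 - a))` for `m ≥ 3`, and equals `a/(1 - a)` for `m = 1`, split as `2/3 + 1/3`
to complete the sum of the `1/m²`. Summation gives the constant `16/3 + π²/3 < 8.65`. -/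
theorem integral_fBeta_mul_exp_sub_one_le {β α : ℝ} (hβ : 0 < β) (hα : 0 < α)
    (h : α * β / Real.pi < 1) :
    ∫ t, fBeta β t * ((Real.exp (α * |t|) - 1) / α)
      ≤ 8.65 * β / Real.pi ^ 3 / (1 - α * β / Real.pi) := by
  have hπ := Real.pi_pos
  obtain ⟨hi, hv⟩ := integrable_and_integral_fBeta_mul_exp hβ hα.le h
  set a := α * β / Real.pi with ha
  have ha0 : 0 < a := by positivity
  have hs := summable_fBeta_moment ha0.le h
  have e1 : ∫ t, fBeta β t * ((Real.exp (α * |t|) - 1) / α)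
      = (8 / Real.pi ^ 2 * ∑' j : ℕ, 1 / ((2 * (j : ℝ) + 1) * (2 * j + 1 - a)) - 1) / α := by
    have e0 : ∫ t, (fBeta β t * Real.exp (α * |t|) - fBeta β t)
        = (∫ t, fBeta β t * Real.exp (α * |t|)) - 1 := by
      rw [integral_sub hi (integrable_fBeta hβ), integral_fBeta hβ]
    rw [← hv, ← e0, ← integral_div]
    congr 1; ext t; ring
  have h2 : ∑' j : ℕ, 1 / ((2 * (j : ℝ) + 1) * (2 * j + 1 - a))
      ≤ ∑' j : ℕ, (1 / (2 * (j : ℝ) + 1) ^ 2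
        + a / (1 - a) * (if j = 0 then (2 / 3 : ℝ) else 0)
        + a / (1 - a) * (1 / 3 * (1 / (2 * (j : ℝ) + 1) ^ 2))) := by
    refine hs.tsum_le_tsum (fun j => ?_) ?_
    · have h1 : 0 < 1 - a := by linarith
      rcases Nat.eq_zero_or_pos j with rfl | hj
      · simp only [Nat.cast_zero, if_true]
        have : 1 / ((2 * 0 + 1) * (2 * 0 + 1 - a)) = 1 + a / (1 - a) * (2/3) + a / (1 - a) * (1/3)
          := by
            have e3 : (2 * 0 + 1) * (2 * 0 + 1 - a) = 1 - a := by ring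
            rw [e3]; field_simp; ring
        rw [this]; norm_num
      · rw [if_neg hj.ne']
        have hj1 : (1 : ℝ) ≤ j := by exact_mod_cast hj
        set m := 2 * (j : ℝ) + 1 with hm
        have hm3 : 3 ≤ m := by linarith
        have hma : 0 < m - a := by linarith
        have e : 1 / (m * (m - a)) = 1 / m ^ 2 + a / (m ^ 2 * (m - a)) := by field_simp; ring
        rw [e, mul_zero, add_zero, add_le_add_iff_left]
        have : a / (1 - a) * (1 / 3 * (1 / m ^ 2)) = a / (m ^ 2 * (3 * (1 - a))) := by field_simp
        rw [this]
        gcongr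
        nlinarith
    · exact ((hasSum_one_div_odd_sq.summable).add
        ((hasSum_ite_eq 0 (2 / 3 : ℝ)).summable.mul_left _)).add
        ((hasSum_one_div_odd_sq.summable.mul_left _).mul_left _)
  have h3 : HasSum (fun j : ℕ => 1 / (2 * (j : ℝ) + 1) ^ 2
        + a / (1 - a) * (if j = 0 then (2 / 3 : ℝ) else 0)
        + a / (1 - a) * (1 / 3 * (1 / (2 * (j : ℝ) + 1) ^ 2)))
      (Real.pi ^ 2 / 8 + a / (1 - a) * (2 / 3) + a / (1 - a) * (1 / 3 * (Real.pi ^ 2 / 8))) :=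
    (hasSum_one_div_odd_sq.add ((hasSum_ite_eq 0 (2 / 3 : ℝ)).mul_left _)).add
      ((hasSum_one_div_odd_sq.mul_left _).mul_left _)
  rw [h3.tsum_eq] at h2
  have h1 : 0 < 1 - a := by linarith
  have hpi : Real.pi ^ 2 < 9.95 := by nlinarith [Real.pi_lt_d2, hπ]
  have hαe : α = a * Real.pi / β := by rw [ha]; field_simp
  rw [e1]
  calc _ ≤ (8 / Real.pi ^ 2 * (Real.pi ^ 2 / 8 + a / (1 - a) * (2 / 3)
        + a / (1 - a) * (1 / 3 * (Real.pi ^ 2 / 8))) - 1) / α := by gcongr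
    _ = (16 / 3 + Real.pi ^ 2 / 3) * β / Real.pi ^ 3 / (1 - a) := by
        rw [hαe]; field_simp; ring
    _ ≤ _ := by gcongr; linarith

theorem abs_le_exp_sub_one_div {α : ℝ} (hα : 0 < α) (t : ℝ) :
    |t| ≤ (Real.exp (α * |t|) - 1) / α := by
  rw [le_div_iff₀ hα]
  linarith [Real.add_one_le_exp (α * |t|)]

theorem measurable_fBeta (β : ℝ) : Measurable (fBeta β) := by
  unfold fBeta; fun_prop

theorem integrable_fBeta_mul_abs {β : ℝ} (hβ : 0 < β) : Integrable fun t => fBeta β t * |t| := by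
  have hπ := Real.pi_pos
  have hα : 0 < 0.03 * Real.pi / β := by positivity
  refine (integrable_fBeta_mul_exp_sub_one hβ hα (by field_simp; norm_num)).mono'
    ((measurable_fBeta β).mul measurable_id.abs).aestronglyMeasurable (ae_of_all _ fun t => ?_)
  rw [Real.norm_eq_abs, abs_of_nonneg (mul_nonneg (fBeta_nonneg hβ t) (abs_nonneg t))]
  exact mul_le_mul_of_nonneg_left (abs_le_exp_sub_one_div hα t) (fBeta_nonneg hβ t)

theorem integral_fBeta_mul_abs_le {β : ℝ} (hβ : 0 < β) :
    ∫ t, fBeta β t * |t| ≤ 9 * β / Real.pi ^ 3 := by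
  have hπ := Real.pi_pos
  -- A small rate loses little: `8.65 / (1 - 0.03) < 9`.
  have hα : 0 < 0.03 * Real.pi / β := by positivity
  have ha : 0.03 * Real.pi / β * β / Real.pi = 0.03 := by field_simp
  have h1 : 0.03 * Real.pi / β * β / Real.pi < 1 := by rw [ha]; norm_num
  calc _ ≤ ∫ t, fBeta β t * ((Real.exp (0.03 * Real.pi / β * |t|) - 1) / (0.03 * Real.pi / β)) :=
        integral_mono (integrable_fBeta_mul_abs hβ) (integrable_fBeta_mul_exp_sub_one hβ hα h1)
          fun t => mul_le_mul_of_nonneg_left (abs_le_exp_sub_one_div hα t) (fBeta_nonneg hβ t)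
    _ ≤ _ := integral_fBeta_mul_exp_sub_one_le hβ hα h1
    _ ≤ _ := by
        rw [ha]
        have : 0 < β / Real.pi ^ 3 := by positivity
        rw [show 8.65 * β / Real.pi ^ 3 / (1 - 0.03) = 8.65 / (1 - 0.03) * (β / Real.pi ^ 3) by ring,
          show 9 * β / Real.pi ^ 3 = 9 * (β / Real.pi ^ 3) by ring]
        gcongr; norm_num

end Filter

/-! ### Time-ordered exponentials and their dependence on the integrand. -/

section Dyson

open MeasureTheory

variable {n d : ℕ}

/-- Only an inequality, since the algebra is trivial when there are sites but `d = 0`. -/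
theorem norm_one_op_le : ‖(1 : Op n d)‖ ≤ 1 := by
  rcases subsingleton_or_nontrivial (Op n d) with h | h
  · rw [Subsingleton.elim (1 : Op n d) 0, norm_zero]; exact zero_le_one
  · exact CStarRing.norm_one.le

theorem continuous_dysonTerm {φ : ℝ → Op n d} (hφ : Continuous φ) (m : ℕ) :
    Continuous (dysonTerm φ m) := by
  induction m with
  | zero => exact continuous_const
  | succ m ih =>
    exact intervalIntegral.continuous_primitive
      (fun a b => (hφ.mul ih).intervalIntegrable a b) 0

theorem hasDerivAt_dysonTerm {φ : ℝ → Op n d} (hφ : Continuous φ) (m : ℕ) (τ : ℝ) :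
    HasDerivAt (dysonTerm φ (m + 1)) (φ τ * dysonTerm φ m τ) τ := by
  have hc := hφ.mul (continuous_dysonTerm hφ m)
  exact intervalIntegral.integral_hasDerivAt_right (hc.intervalIntegrable _ _)
    hc.stronglyMeasurable.stronglyMeasurableAtFilter hc.continuousAt

theorem dysonTerm_succ_zero (φ : ℝ → Op n d) (m : ℕ) : dysonTerm φ (m + 1) 0 = 0 := by
  simp [dysonTerm]

theorem norm_dysonTerm_le {φ : ℝ → Op n d} (hφ : Continuous φ) {a : ℝ} (ha : 0 ≤ a)
    (hb : ∀ τ ∈ Set.Icc (0 : ℝ) 1, ‖φ τ‖ ≤ a) (m : ℕ) :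
    ∀ τ ∈ Set.Icc (0 : ℝ) 1, ‖dysonTerm φ m τ‖ ≤ (a * τ) ^ m / m.factorial := by
  induction m with
  | zero => intro τ _; simpa [dysonTerm] using norm_one_op_le
  | succ m ih =>
    have hB : ∀ τ : ℝ, HasDerivAt (fun τ => (a * τ) ^ (m + 1) / (m + 1).factorial)
        (a * ((a * τ) ^ m / m.factorial)) τ := fun τ => by
      have := (((hasDerivAt_id τ).const_mul a).pow (m + 1)).div_const ((m + 1).factorial : ℝ)
      refine this.congr_deriv ?_
      simp only [id, Nat.factorial_succ]
      push_cast
      field_simp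
    exact image_norm_le_of_norm_deriv_right_le_deriv_boundary'
      (continuous_dysonTerm hφ _).continuousOn
      (fun τ _ => (hasDerivAt_dysonTerm hφ m τ).hasDerivWithinAt)
      (by simp [dysonTerm_succ_zero])
      (fun τ _ => (hB τ).continuousAt.continuousWithinAt)
      (fun τ _ => (hB τ).hasDerivWithinAt)
      (fun τ hτ => (norm_mul_le _ _).trans (mul_le_mul (hb τ ⟨hτ.1, hτ.2.le⟩)
        (ih τ ⟨hτ.1, hτ.2.le⟩) (norm_nonneg _) ha))

/-- The bound is a product of the integral of `b₀ + b₁τ` and the bound for the `m`-th term. Its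
derivative matches the two contributions `(φ - ψ) D_φ` and `ψ (D_φ - D_ψ)` of the product rule. An
affine bound in `τ` is kept because the Duhamel error below is affine in `τ`. -/
theorem norm_dysonTerm_sub_le {φ ψ : ℝ → Op n d} (hφ : Continuous φ) (hψ : Continuous ψ) {a : ℝ}
    (ha : 0 ≤ a) (hbφ : ∀ τ ∈ Set.Icc (0 : ℝ) 1, ‖φ τ‖ ≤ a)
    (hbψ : ∀ τ ∈ Set.Icc (0 : ℝ) 1, ‖ψ τ‖ ≤ a) {b₀ b₁ : ℝ}
    (hb : ∀ τ ∈ Set.Icc (0 : ℝ) 1, ‖φ τ - ψ τ‖ ≤ b₀ + b₁ * τ) (m : ℕ) :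
    ∀ τ ∈ Set.Icc (0 : ℝ) 1, ‖dysonTerm φ (m + 1) τ - dysonTerm ψ (m + 1) τ‖
      ≤ (b₀ * τ + b₁ * τ ^ 2 / 2) * ((a * τ) ^ m / m.factorial) := by
  have hl : ∀ τ : ℝ, HasDerivAt (fun τ => b₀ * τ + b₁ * τ ^ 2 / 2) (b₀ + b₁ * τ) τ := fun τ => by
    refine (((hasDerivAt_id τ).const_mul b₀).add
      ((((hasDerivAt_id τ).pow 2).const_mul b₁).div_const 2)).congr_deriv ?_
    simp; ring
  have hd : ∀ m τ, HasDerivAt (fun τ => dysonTerm φ (m + 1) τ - dysonTerm ψ (m + 1) τ)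
      ((φ τ - ψ τ) * dysonTerm φ m τ + ψ τ * (dysonTerm φ m τ - dysonTerm ψ m τ)) τ := fun m τ => by
    refine ((hasDerivAt_dysonTerm hφ m τ).sub (hasDerivAt_dysonTerm hψ m τ)).congr_deriv ?_
    noncomm_ring
  induction m with
  | zero =>
    intro τ hτ
    simp only [pow_zero, Nat.factorial_zero, Nat.cast_one, div_one, mul_one]
    exact image_norm_le_of_norm_deriv_right_le_deriv_boundary'
      (fun τ _ => (hd 0 τ).continuousAt.continuousWithinAt)
      (fun τ _ => (hd 0 τ).hasDerivWithinAt)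
      (by simp [dysonTerm_succ_zero])
      (fun τ _ => (hl τ).continuousAt.continuousWithinAt)
      (fun τ _ => (hl τ).hasDerivWithinAt)
      (fun τ hτ => by
        simpa [dysonTerm] using
          (norm_mul_le_of_le (hb τ ⟨hτ.1, hτ.2.le⟩) (norm_one_op_le (n := n) (d := d)))) hτ
  | succ m ih =>
    have hp : ∀ τ : ℝ, HasDerivAt (fun τ => (a * τ) ^ (m + 1) / (m + 1).factorial)
        (a * ((a * τ) ^ m / m.factorial)) τ := fun τ => by
      have := (((hasDerivAt_id τ).const_mul a).pow (m + 1)).div_const ((m + 1).factorial : ℝ)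
      refine this.congr_deriv ?_
      simp only [id, Nat.factorial_succ]
      push_cast
      field_simp
    exact image_norm_le_of_norm_deriv_right_le_deriv_boundary'
      (fun τ _ => (hd _ τ).continuousAt.continuousWithinAt)
      (fun τ _ => (hd _ τ).hasDerivWithinAt)
      (by simp [dysonTerm_succ_zero])
      (fun τ _ => ((hl τ).mul (hp τ)).continuousAt.continuousWithinAt)
      (fun τ _ => ((hl τ).mul (hp τ)).hasDerivWithinAt)
      (fun τ hτ => by
        have hτ' : τ ∈ Set.Icc (0 : ℝ) 1 := ⟨hτ.1, hτ.2.le⟩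
        refine (norm_add_le _ _).trans (add_le_add
          (norm_mul_le_of_le (hb τ hτ') (norm_dysonTerm_le hφ ha hbφ (m + 1) τ hτ')) ?_)
        refine (norm_mul_le_of_le (hbψ τ hτ') (ih τ hτ')).trans (le_of_eq ?_)
        ring)

theorem norm_timeOrderedExp_sub_le {φ ψ : ℝ → Op n d} (hφ : Continuous φ) (hψ : Continuous ψ)
    {a : ℝ} (ha : 0 ≤ a) (hbφ : ∀ τ ∈ Set.Icc (0 : ℝ) 1, ‖φ τ‖ ≤ a)
    (hbψ : ∀ τ ∈ Set.Icc (0 : ℝ) 1, ‖ψ τ‖ ≤ a) {b₀ b₁ : ℝ}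
    (hb : ∀ τ ∈ Set.Icc (0 : ℝ) 1, ‖φ τ - ψ τ‖ ≤ b₀ + b₁ * τ) :
    ‖timeOrderedExp φ - timeOrderedExp ψ‖ ≤ Real.exp a * (b₀ + b₁ / 2) := by
  have h1 : (1 : ℝ) ∈ Set.Icc (0 : ℝ) 1 := by simp
  have hs : HasSum (fun m : ℕ => a ^ m / m.factorial) (Real.exp a) := by
    have := NormedSpace.expSeries_div_hasSum_exp a
    rwa [← Real.exp_eq_exp_ℝ] at this
  have hsφ : Summable fun m => dysonTerm φ m 1 := .of_norm_bounded hs.summable fun m => by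
    simpa using norm_dysonTerm_le hφ ha hbφ m 1 h1
  have hsψ : Summable fun m => dysonTerm ψ m 1 := .of_norm_bounded hs.summable fun m => by
    simpa using norm_dysonTerm_le hψ ha hbψ m 1 h1
  have hs' := hs.mul_left (b₀ + b₁ / 2)
  rw [timeOrderedExp, timeOrderedExp, ← hsφ.tsum_sub hsψ, (hsφ.sub hsψ).tsum_eq_zero_add,
    mul_comm, ← hs'.tsum_eq]
  have h0 : dysonTerm φ 0 1 - dysonTerm ψ 0 1 = 0 := by simp [dysonTerm]
  rw [h0, zero_add]
  exact tsum_of_norm_bounded hs'.summable.hasSum fun m => by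
    simpa using norm_dysonTerm_sub_le hφ hψ ha hbφ hbψ hb m 1 h1

theorem integrable_fBeta_smul_heis {β : ℝ} (hβ : 0 < β) (O : Op n d) {H : Op n d}
    (hH : IsSelfAdjoint H) : Integrable fun t : ℝ => (fBeta β t : ℂ) • evolve O H t := by
  refine ((integrable_fBeta hβ).mul_const ‖O‖).mono' ?_ (ae_of_all _ fun t => ?_)
  -- Here `evolve O H t` is `heis H O t` by definition.
  · exact (Complex.measurable_ofReal.comp (measurable_fBeta β)).aestronglyMeasurable.smul
      (continuous_heis H O).aestronglyMeasurable
  · rw [norm_smul, Complex.norm_real, Real.norm_eq_abs, abs_of_nonneg (fBeta_nonneg hβ t)]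
    exact mul_le_mul_of_nonneg_left (norm_heis hH O t).le (fBeta_nonneg hβ t)

theorem norm_phi_le {β : ℝ} (hβ : 0 < β) (O : Op n d) {H : Op n d} (hH : IsSelfAdjoint H) :
    ‖phi β O H‖ ≤ β / 2 * ‖O‖ := by
  have h : ‖∫ t : ℝ, (fBeta β t : ℂ) • evolve O H t‖ ≤ ∫ t, fBeta β t * ‖O‖ :=
    norm_integral_le_of_norm_le ((integrable_fBeta hβ).mul_const ‖O‖) (ae_of_all _ fun t => by
      rw [norm_smul, Complex.norm_real, Real.norm_eq_abs, abs_of_nonneg (fBeta_nonneg hβ t)]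
      exact mul_le_mul_of_nonneg_left (norm_heis hH O t).le (fBeta_nonneg hβ t))
  rw [integral_mul_const, integral_fBeta hβ, one_mul] at h
  rw [phi, norm_smul, Complex.norm_real, Real.norm_eq_abs, abs_of_pos (by positivity)]
  gcongr

theorem norm_phi_sub_phi_le {β : ℝ} (hβ : 0 < β) {O P Q : Op n d} (hP : IsSelfAdjoint P)
    (hQ : IsSelfAdjoint Q) {D : ℝ → ℝ} (hi : Integrable fun t => fBeta β t * D t)
    (hD : ∀ t, ‖heis P O t - heis Q O t‖ ≤ D t) :
    ‖phi β O P - phi β O Q‖ ≤ β / 2 * ∫ t, fBeta β t * D t := by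
  rw [phi, phi, ← smul_sub, ← integral_sub (integrable_fBeta_smul_heis hβ O hP)
    (integrable_fBeta_smul_heis hβ O hQ), norm_smul, Complex.norm_real, Real.norm_eq_abs,
    abs_of_pos (by positivity)]
  refine mul_le_mul_of_nonneg_left ?_ (by positivity)
  refine norm_integral_le_of_norm_le hi (ae_of_all _ fun t => ?_)
  rw [← smul_sub, norm_smul, Complex.norm_real, Real.norm_eq_abs,
    abs_of_nonneg (fBeta_nonneg hβ t)]
  exact mul_le_mul_of_nonneg_left (hD t) (fBeta_nonneg hβ t)

theorem continuous_phi {β : ℝ} (hβ : 0 < β) (O : Op n d) {H : ℝ → Op n d} (hc : Continuous H)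
    (hH : ∀ τ, IsSelfAdjoint (H τ)) : Continuous fun τ => phi β O (H τ) := by
  suffices key : Continuous fun τ => ∫ t : ℝ, (fBeta β t : ℂ) • evolve O (H τ) t from
    key.const_smul ((β / 2 : ℝ) : ℂ)
  refine continuous_of_dominated (bound := fun t => fBeta β t * ‖O‖)
    (fun τ => (integrable_fBeta_smul_heis hβ O (hH τ)).aestronglyMeasurable)
    (fun τ => ae_of_all _ fun t => ?_) ((integrable_fBeta hβ).mul_const _)
    (ae_of_all _ fun t => ?_)
  · rw [norm_smul, Complex.norm_real, Real.norm_eq_abs, abs_of_nonneg (fBeta_nonneg hβ t)]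
    exact mul_le_mul_of_nonneg_left (norm_heis (hH τ) O t).le (fBeta_nonneg hβ t)
  · exact ((continuous_heis_left O t).comp hc).const_smul (fBeta β t : ℂ)

end Dyson

/-! ### Locality and the Lieb–Robinson bound. -/

section LiebRobinson

variable {n d k : ℕ}

open scoped MatrixOrder in
theorem halfBounded_of_posSemidef {A : Op n d} (hA : A.PosSemidef) : HalfBounded A :=
  halfBounded_of_nonneg (Matrix.nonneg_iff_posSemidef.2 hA)

theorem Interaction.isSelfAdjoint (h : Interaction n d k) (Z : Finset (Fin n)) :
    IsSelfAdjoint (h.term Z) := (h.posSemidef Z).isHermitian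

theorem Interaction.halfBounded (h : Interaction n d k) (Z : Finset (Fin n)) :
    HalfBounded (h.term Z) := halfBounded_of_posSemidef (h.posSemidef Z)

theorem Interaction.halfBounded_sum (h : Interaction n d k) (s : Finset (Finset (Fin n))) :
    HalfBounded (∑ Z ∈ s, h.term Z) :=
  halfBounded_of_posSemidef (Matrix.posSemidef_sum s fun Z _ => h.posSemidef Z)

theorem SupportedOn.mul_apply {A B : Op n d} {X Y : Finset (Fin n)} (hXY : Disjoint X Y)
    {A' : Matrix (X → Fin d) (X → Fin d) ℂ} {B' : Matrix (Y → Fin d) (Y → Fin d) ℂ}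
    (hA : ∀ x y : Fin n → Fin d,
      A x y = if ∀ i, i ∉ X → x i = y i then A' (fun i => x i) (fun i => y i) else 0)
    (hB : ∀ x y : Fin n → Fin d,
      B x y = if ∀ i, i ∉ Y → x i = y i then B' (fun i => x i) (fun i => y i) else 0)
    (x y : Fin n → Fin d) :
    (A * B) x y = if ∀ i, i ∉ X → i ∉ Y → x i = y i then
      A' (fun i => x i) (fun i => y i) * B' (fun i => x i) (fun i => y i) else 0 := by
  classical
  rw [Matrix.mul_apply]
  -- The only intermediate configuration that contributes: `A x u ≠ 0` forces `u = x` off `X`, and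
  -- `B u y ≠ 0` forces `u = y` off `Y`, in particular on `X`.
  set u : Fin n → Fin d := fun i => if i ∈ X then y i else x i with hu
  rw [Finset.sum_eq_single u]
  · have h1 : ∀ i, i ∉ X → x i = u i := fun i hi => by simp [hu, hi]
    have h2 : (fun i : X => u i) = fun i : X => y i := by ext i; simp [hu]
    have h3 : (fun i : Y => u i) = fun i : Y => x i := by
      ext i
      simp [hu, Finset.disjoint_right.1 hXY i.2]
    have h4 : (∀ i, i ∉ Y → u i = y i) ↔ ∀ i, i ∉ X → i ∉ Y → x i = y i := by
      refine forall_congr' fun i => ?_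
      by_cases hi : i ∈ X <;> simp [hu, hi]
    rw [hA, hB, if_pos h1, h2, h3]
    simp only [h4, mul_ite, mul_zero]
  · intro v _ hv
    rw [hA, hB]
    by_contra hne
    apply hv
    have h1 : ∀ i, i ∉ X → x i = v i := by
      by_contra h; rw [if_neg h, zero_mul] at hne; exact hne rfl
    have h2 : ∀ i, i ∉ Y → v i = y i := by
      by_contra h; rw [if_neg h, mul_zero] at hne; exact hne rfl
    ext i
    by_cases hi : i ∈ X
    · simp [hu, hi, h2 i (Finset.disjoint_left.1 hXY hi)]
    · simp [hu, hi, h1 i hi]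
  · simp

theorem SupportedOn.commute {A B : Op n d} {X Y : Finset (Fin n)} (hA : SupportedOn A X)
    (hB : SupportedOn B Y) (hXY : Disjoint X Y) : Commute A B := by
  obtain ⟨A', hA⟩ := hA
  obtain ⟨B', hB⟩ := hB
  ext x y
  rw [SupportedOn.mul_apply hXY hA hB, SupportedOn.mul_apply hXY.symm hB hA]
  have : (∀ i, i ∉ X → i ∉ Y → x i = y i) ↔ ∀ i, i ∉ Y → i ∉ X → x i = y i :=
    forall_congr' fun i => ⟨fun h a b => h b a, fun h a b => h b a⟩
  simp only [this, mul_comm]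

theorem Interaction.commute (h : Interaction n d k) {X Y : Finset (Fin n)} (hXY : Disjoint X Y) :
    Commute (h.term X) (h.term Y) := (h.supported X).commute (h.supported Y) hXY

/-- The Hamiltonian `∑ c_Y h_Y`. -/
def weightedHam (h : Interaction n d k) (c : Finset (Fin n) → ℝ) : Op n d :=
  ∑ Y, (c Y : ℂ) • h.term Y

theorem isSelfAdjoint_smul_term (h : Interaction n d k) (c : ℝ) (Y : Finset (Fin n)) :
    IsSelfAdjoint ((c : ℂ) • h.term Y) :=
  IsSelfAdjoint.smul (Complex.conj_ofReal c) (h.isSelfAdjoint Y)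

theorem isSelfAdjoint_sum_smul_term (h : Interaction n d k) (c : Finset (Fin n) → ℝ)
    (s : Finset (Finset (Fin n))) : IsSelfAdjoint (∑ Y ∈ s, (c Y : ℂ) • h.term Y) :=
  isSelfAdjoint_sum s fun Y _ => isSelfAdjoint_smul_term h (c Y) Y

theorem isSelfAdjoint_weightedHam (h : Interaction n d k) (c : Finset (Fin n) → ℝ) :
    IsSelfAdjoint (weightedHam h c) := isSelfAdjoint_sum_smul_term h c _

/-- One round of the Lieb–Robinson iteration: bounds `f` for all terms are turned into a bound for
`h_X`, and only the terms meeting `X` enter. -/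
theorem norm_comm_heis_le_of_forall (h : Interaction n d k) (c : Finset (Fin n) → ℝ)
    (X : Finset (Fin n)) (B : Op n d) {f : Finset (Fin n) → ℝ → ℝ}
    (hf : ∀ Y s, 0 ≤ s → ‖comm (heis (weightedHam h c) (h.term Y) s) B‖ ≤ f Y s) {b b' : ℝ → ℝ}
    (hb0 : ‖comm (h.term X) B‖ ≤ b 0) (hb : ∀ s, HasDerivAt b (b' s) s)
    (hbb : ∀ s, 0 ≤ s → ‖h.term X‖ * ∑ Y with ¬Disjoint Y X, |c Y| * f Y s ≤ b' s) {t : ℝ}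
    (ht : 0 ≤ t) : ‖comm (heis (weightedHam h c) (h.term X) t) B‖ ≤ b t := by
  have e : weightedHam h c = ∑ Y with ¬Disjoint Y X, (c Y : ℂ) • h.term Y
      + ∑ Y with Disjoint Y X, (c Y : ℂ) • h.term Y := by
    rw [weightedHam, add_comm, Finset.sum_filter_add_sum_filter_not]
  have hcomm : Commute (∑ Y with Disjoint Y X, (c Y : ℂ) • h.term Y) (h.term X) :=
    Commute.sum_left _ _ _ fun Y hY => (h.commute (Finset.mem_filter.1 hY).2).smul_left _
  rw [e] at hf ⊢
  refine norm_comm_heis_le (isSelfAdjoint_sum_smul_term h c _) (isSelfAdjoint_sum_smul_term h c _)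
    (h.halfBounded X) hcomm hb0 hb (fun s hs => ?_) ht
  refine le_trans (mul_le_mul_of_nonneg_left ?_ (norm_nonneg _)) (hbb s hs)
  rw [heis_sum]
  have e2 : ∀ (T : Finset (Finset (Fin n))) (a : Finset (Fin n) → Op n d),
      comm (∑ Y ∈ T, a Y) B = ∑ Y ∈ T, comm (a Y) B := fun T a => by
    simp [comm, Finset.sum_mul, Finset.mul_sum]
  rw [e2]
  refine (norm_sum_le _ _).trans (Finset.sum_le_sum fun Y _ => ?_)
  have e3 : ∀ a : Op n d, comm ((c Y : ℂ) • a) B = (c Y : ℂ) • comm a B := fun a => by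
    simp [comm, smul_sub]
  rw [heis_smul, e3, norm_smul, Complex.norm_real, Real.norm_eq_abs]
  exact mul_le_mul_of_nonneg_left (hf Y s hs) (abs_nonneg _)

/-- A union bound: every `Y ∈ s` occurs at least once on the right. -/
theorem sum_le_sum_sum_filter {ι α : Type*} [Fintype α] {F : α → ℝ} (hF : ∀ Y, 0 ≤ F Y)
    (s : Finset α) (T : Finset ι) (r : ι → α → Prop) [∀ x, DecidablePred (r x)]
    (hs : ∀ Y ∈ s, ∃ x ∈ T, r x Y) : ∑ Y ∈ s, F Y ≤ ∑ x ∈ T, ∑ Y with r x Y, F Y := by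
  simp only [Finset.sum_filter]
  rw [Finset.sum_comm]
  calc ∑ Y ∈ s, F Y ≤ ∑ Y ∈ s, ∑ x ∈ T, if r x Y then F Y else 0 := by
        refine Finset.sum_le_sum fun Y hY => ?_
        obtain ⟨x, hx, hr⟩ := hs Y hY
        calc F Y = if r x Y then F Y else 0 := by rw [if_pos hr]
          _ ≤ _ := Finset.single_le_sum (f := fun x => if r x Y then F Y else 0)
            (fun x _ => by split_ifs <;> simp [hF]) hx
    _ ≤ _ := Finset.sum_le_sum_of_subset_of_nonneg (Finset.subset_univ s) fun Y _ _ =>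
        Finset.sum_nonneg fun x _ => by split_ifs <;> simp [hF]

theorem sum_not_disjoint_le {c F : Finset (Fin n) → ℝ} (hF : ∀ Y, 0 ≤ F Y) (X : Finset (Fin n)) :
    ∑ Y with ¬Disjoint Y X, |c Y| * F Y ≤ ∑ x ∈ X, ∑ Y with x ∈ Y, |c Y| * F Y := by
  refine sum_le_sum_sum_filter (fun Y => mul_nonneg (abs_nonneg _) (hF Y)) _ X _ fun Y hY => ?_
  obtain ⟨x, hxY, hxX⟩ := Finset.not_disjoint_iff.1 (Finset.mem_filter.1 hY).2
  exact ⟨x, hxX, hxY⟩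

/-- The Lieb–Robinson bound in terms of a weight on the sites which is at least `1` on `Z` and is
multiplied at most by `κ` under one application of the interaction. -/
theorem norm_comm_heis_term_le (h : Interaction n d k) {c : Finset (Fin n) → ℝ}
    {Z : Finset (Fin n)} {w : Fin n → ℝ} {κ : ℝ} (hw : ∀ x, 0 ≤ w x) (hwZ : ∀ z ∈ Z, 1 ≤ w z)
    (hκ : ∀ x, ∑ Y with x ∈ Y, |c Y| * (‖h.term Y‖ * ∑ y ∈ Y, w y) ≤ κ * w x)
    {X : Finset (Fin n)} (hXZ : Disjoint X Z) {t : ℝ} (ht : 0 ≤ t) :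
    ‖comm (heis (weightedHam h c) (h.term X) t) (h.term Z)‖
      ≤ ‖h.term X‖ * ‖h.term Z‖ / 2 * (∑ x ∈ X, w x) * (Real.exp (κ * t) - 1) := by
  set B := h.term Z with hB
  set G := ∑ Y, |c Y| * ‖h.term Y‖ with hG
  have hG0 : 0 ≤ G := Finset.sum_nonneg fun Y _ => by positivity
  have hW : ∀ X : Finset (Fin n), 0 ≤ ∑ x ∈ X, w x := fun X => Finset.sum_nonneg fun x _ => hw x
  have hstep : ∀ X : Finset (Fin n),
      ∑ Y with ¬Disjoint Y X, |c Y| * (‖h.term Y‖ * ∑ y ∈ Y, w y) ≤ κ * ∑ x ∈ X, w x := fun X => by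
    refine (sum_not_disjoint_le (fun Y => mul_nonneg (norm_nonneg _) (hW Y)) X).trans ?_
    rw [Finset.mul_sum]
    exact Finset.sum_le_sum fun x _ => hκ x
  have hsum : ∀ X : Finset (Fin n), ∑ Y with ¬Disjoint Y X, |c Y| * ‖h.term Y‖ ≤ G := fun X =>
    Finset.sum_le_sum_of_subset_of_nonneg (Finset.filter_subset _ _) fun Y _ _ => by positivity
  have h0 : ∀ X : Finset (Fin n), ‖comm (h.term X) B‖ ≤ ‖h.term X‖ * ‖B‖ / 2 * ∑ x ∈ X, w x :=
      fun X => by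
    by_cases hd : Disjoint X Z
    · rw [comm, (h.commute hd).eq, sub_self, norm_zero]
      exact mul_nonneg (by positivity) (hW X)
    · obtain ⟨x, hxX, hxZ⟩ := Finset.not_disjoint_iff.1 hd
      have h1 : 1 ≤ ∑ x ∈ X, w x :=
        (hwZ x hxZ).trans (Finset.single_le_sum (fun x _ => hw x) hxX)
      refine ((h.halfBounded X).norm_comm_le_half (h.halfBounded Z)).trans ?_
      exact le_mul_of_one_le_right (by positivity) h1
  have hexp : ∀ s : ℝ, HasDerivAt (fun s => Real.exp (κ * s)) (κ * Real.exp (κ * s)) s :=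
      fun s => by
    refine ((hasDerivAt_id s).const_mul κ).exp.congr_deriv ?_
    simp [mul_comm]
  -- Start from the trivial bound, whose surplus `1` becomes `(Gs)^m / m!` after `m` rounds.
  have happrox : ∀ m : ℕ, ∀ (X : Finset (Fin n)) (s : ℝ), 0 ≤ s →
      ‖comm (heis (weightedHam h c) (h.term X) s) B‖ ≤ ‖h.term X‖ * ‖B‖ / 2 *
        ((∑ x ∈ X, w x) * Real.exp (κ * s) + (G * s) ^ m / m.factorial) := by
    intro m
    induction m with
    | zero =>
      intro X s _
      refine (((h.halfBounded X).heis (isSelfAdjoint_weightedHam h c) s).norm_comm_le_half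
        (h.halfBounded Z)).trans ?_
      rw [norm_heis (isSelfAdjoint_weightedHam h c)]
      refine le_mul_of_one_le_right (by positivity) ?_
      simpa using mul_nonneg (hW X) (Real.exp_pos _).le
    | succ m ih =>
      intro X s hs
      refine norm_comm_heis_le_of_forall h c X B ih
        (b := fun s => ‖h.term X‖ * ‖B‖ / 2 *
          ((∑ x ∈ X, w x) * Real.exp (κ * s) + (G * s) ^ (m + 1) / (m + 1).factorial))
        (b' := fun s => ‖h.term X‖ * ‖B‖ / 2 *
          ((∑ x ∈ X, w x) * (κ * Real.exp (κ * s)) + G * ((G * s) ^ m / m.factorial)))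
        (by simpa using h0 X) (fun s => ?_) (fun s hs => ?_) hs
      · have hp : HasDerivAt (fun s => (G * s) ^ (m + 1) / (m + 1).factorial)
            (G * ((G * s) ^ m / m.factorial)) s := by
          have := (((hasDerivAt_id s).const_mul G).pow (m + 1)).div_const ((m + 1).factorial : ℝ)
          refine this.congr_deriv ?_
          simp only [id, Nat.factorial_succ]
          push_cast
          field_simp
        exact (((hexp s).const_mul _).add hp).const_mul _
      · have e : ∑ Y with ¬Disjoint Y X, |c Y| * (‖h.term Y‖ * ‖B‖ / 2 *
            ((∑ x ∈ Y, w x) * Real.exp (κ * s) + (G * s) ^ m / m.factorial))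
            = ‖B‖ / 2 * (Real.exp (κ * s) *
              ∑ Y with ¬Disjoint Y X, |c Y| * (‖h.term Y‖ * ∑ y ∈ Y, w y)
              + (G * s) ^ m / m.factorial * ∑ Y with ¬Disjoint Y X, |c Y| * ‖h.term Y‖) := by
          simp only [Finset.mul_sum, ← Finset.sum_add_distrib]
          exact Finset.sum_congr rfl fun Y _ => by simp only [← Finset.mul_sum]; ring
        rw [e]
        calc _ ≤ ‖h.term X‖ * (‖B‖ / 2 * (Real.exp (κ * s) * (κ * ∑ x ∈ X, w x)
              + (G * s) ^ m / m.factorial * G)) := by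
              gcongr
              · exact hstep X
              · exact hsum X
          _ = _ := by ring
  -- Let `m → ∞`. The resulting bound holds for all `X`, also those meeting `Z`.
  have hlim : ∀ (X : Finset (Fin n)) (s : ℝ), 0 ≤ s →
      ‖comm (heis (weightedHam h c) (h.term X) s) B‖
        ≤ ‖h.term X‖ * ‖B‖ / 2 * ((∑ x ∈ X, w x) * Real.exp (κ * s)) := fun X s hs => by
    have ht := ((FloorSemiring.tendsto_pow_div_factorial_atTop (G * s)).const_add
      ((∑ x ∈ X, w x) * Real.exp (κ * s))).const_mul (‖h.term X‖ * ‖B‖ / 2)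
    rw [add_zero] at ht
    exact ge_of_tendsto' ht fun m => happrox m X s hs
  -- A last round for `X` disjoint from `Z`: the commutator vanishes at time `0`, which improves
  -- `exp(κt)` to `exp(κt) - 1`.
  have := norm_comm_heis_le_of_forall h c X B hlim
    (b := fun s => ‖h.term X‖ * ‖B‖ / 2 * (∑ x ∈ X, w x) * (Real.exp (κ * s) - 1))
    (b' := fun s => ‖h.term X‖ * ‖B‖ / 2 * (∑ x ∈ X, w x) * (κ * Real.exp (κ * s)))
    (by simp [comm, (h.commute hXZ).eq, hB]) (fun s => ((hexp s).sub_const 1).const_mul _)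
    (fun s hs => ?_) ht
  · exact this
  · have e : ∑ Y with ¬Disjoint Y X, |c Y| * (‖h.term Y‖ * ‖B‖ / 2 *
        ((∑ x ∈ Y, w x) * Real.exp (κ * s)))
        = ‖B‖ / 2 * (Real.exp (κ * s) *
          ∑ Y with ¬Disjoint Y X, |c Y| * (‖h.term Y‖ * ∑ y ∈ Y, w y)) := by
      simp only [Finset.mul_sum]
      exact Finset.sum_congr rfl fun Y _ => by simp only [← Finset.mul_sum]; ring
    rw [e]
    calc _ ≤ ‖h.term X‖ * (‖B‖ / 2 * (Real.exp (κ * s) * (κ * ∑ x ∈ X, w x))) := by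
          gcongr
          exact hstep X
      _ = _ := by ring

end LiebRobinson

/-! ### Sums over interaction terms from the decay of `J`. -/

section Sums

variable {n d k : ℕ} {γ g : ℝ} {J : ℕ → ℝ}

theorem IsDecay.le_one (hJ : IsDecay γ J) (x : ℕ) : J x ≤ 1 :=
  (hJ.anti (Nat.zero_le x)).trans hJ.zero.le

theorem IsDecay.one_le (hJ : IsDecay γ J) (h1 : 0 < J 1) : 1 ≤ γ := by
  have hs : Summable fun x : ℕ => ((1 + x : ℕ) : ℝ) ^ 0 * J (1 + x) :=
    (hJ.summable 0 (by norm_num)).comp_injective (add_right_injective 1)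
  have h := hJ.tail 0 (by norm_num) 1 le_rfl
  have h2 := hs.le_tsum 0 fun x _ => by simpa using hJ.nonneg _
  simp only [pow_zero, one_mul, add_zero, zero_add, pow_one, Nat.cast_one, mul_one] at h h2
  nlinarith

/-- The first moment of the tail is what counts pairs across a cut. -/
theorem IsDecay.sum_Ico_le (hJ : IsDecay γ J) {l : ℕ} (hl : 1 ≤ l) (m : ℕ) :
    ∑ x ∈ Finset.Ico l (l + m), (x : ℝ) * J x ≤ γ * (l : ℝ) ^ 2 * J l := by
  have hs : Summable fun x : ℕ => ((l + x : ℕ) : ℝ) ^ 1 * J (l + x) :=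
    (hJ.summable 1 le_rfl).comp_injective (add_right_injective l)
  refine le_trans ?_ (hJ.tail 1 le_rfl l hl)
  rw [Finset.sum_Ico_eq_sum_range, Nat.add_sub_cancel_left]
  simp only [pow_one] at hs ⊢
  exact hs.sum_le_tsum _ fun x _ => mul_nonneg (Nat.cast_nonneg _) (hJ.nonneg _)

/-- A pair is determined by its distance `x` and by the offset `p - i` of its left site. Since the
right site lies beyond `p`, the offset is less than `x`, so at most `x` pairs have distance `x`. -/
theorem IsDecay.sum_pairs_le (hJ : IsDecay γ J) {l : ℕ} (hl : 1 ≤ l) (p : ℕ)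
    (T : Finset (Fin n × Fin n)) (hT : ∀ x ∈ T, (x.1 : ℕ) ≤ p ∧ p + l ≤ (x.2 : ℕ)) :
    ∑ x ∈ T, J (Nat.dist x.1 x.2) ≤ γ * (l : ℝ) ^ 2 * J l := by
  refine le_trans ?_ (hJ.sum_Ico_le hl n)
  have e : ∑ x ∈ Finset.Ico l (l + n), (x : ℝ) * J x
      = ∑ y ∈ (Finset.Ico l (l + n)).sigma fun x => Finset.range x, J y.1 := by
    rw [Finset.sum_sigma]; simp
  rw [e]
  have hdist : ∀ x ∈ T, Nat.dist x.1 x.2 = (x.2 : ℕ) - x.1 := fun x hx => by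
    have := hT x hx
    rw [Nat.dist_eq_sub_of_le (by omega)]
  have hinj : Set.InjOn (fun x : Fin n × Fin n => (⟨x.2 - x.1, p - x.1⟩ : Σ _ : ℕ, ℕ)) T := by
    intro x hx y hy hxy
    have h1 := hT x hx
    have h2 := hT y hy
    simp only [Sigma.mk.injEq, heq_eq_eq] at hxy
    ext <;> omega
  calc ∑ x ∈ T, J (Nat.dist x.1 x.2)
      = ∑ y ∈ T.image (fun x : Fin n × Fin n => (⟨x.2 - x.1, p - x.1⟩ : Σ _ : ℕ, ℕ)), J y.1 := by
        rw [Finset.sum_image hinj]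
        exact Finset.sum_congr rfl fun x hx => by rw [hdist x hx]
    _ ≤ _ := by
        refine Finset.sum_le_sum_of_subset_of_nonneg ?_ fun _ _ _ => hJ.nonneg _
        intro y hy
        obtain ⟨x, hx, rfl⟩ := Finset.mem_image.1 hy
        have h1 := hT x hx
        have h2 := x.2.2
        simp only [Finset.mem_sigma, Finset.mem_Ico, Finset.mem_range]
        omega

/-- The pairs of sites `(i, j)` with `i ≤ p` and `p + l ≤ j`. -/
def gapPairs (n p l : ℕ) : Finset (Fin n × Fin n) := {x | (x.1 : ℕ) ≤ p ∧ p + l ≤ (x.2 : ℕ)}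

/-- The set `Z` contains sites `i ≤ p` and `j ≥ p + l`. -/
def Spans (p l : ℕ) (Z : Finset (Fin n)) : Prop :=
  (∃ i ∈ Z, (i : ℕ) ≤ p) ∧ ∃ j ∈ Z, p + l ≤ (j : ℕ)

theorem HasDecay.sum_norm_le_of_spans {h : Interaction n d k} (hh : HasDecay h g J)
    (hJ : IsDecay γ J) (hg : 0 ≤ g) {l : ℕ} (hl : 1 ≤ l) (p : ℕ) (S : Finset (Finset (Fin n)))
    (hS : ∀ Z ∈ S, Spans p l Z) : ∑ Z ∈ S, ‖h.term Z‖ ≤ g * (γ * (l : ℝ) ^ 2 * J l) := by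
  have h1 : ∀ Z ∈ S, ∃ x ∈ gapPairs n p l, x.1 ∈ Z ∧ x.2 ∈ Z := fun Z hZ => by
    obtain ⟨⟨i, hi, hip⟩, j, hj, hjp⟩ := hS Z hZ
    refine ⟨(i, j), ?_, hi, hj⟩
    simp only [gapPairs, Finset.mem_filter, Finset.mem_univ, true_and]
    exact ⟨hip, hjp⟩
  have h2 : ∑ x ∈ gapPairs n p l, J (Nat.dist x.1 x.2) ≤ γ * (l : ℝ) ^ 2 * J l :=
    hJ.sum_pairs_le hl p _ fun x hx => by
      simpa only [gapPairs, Finset.mem_filter, Finset.mem_univ, true_and] using hx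
  refine (sum_le_sum_sum_filter (F := fun Z => ‖h.term Z‖) (fun Z => norm_nonneg _) S _
    (fun (x : Fin n × Fin n) Z => x.1 ∈ Z ∧ x.2 ∈ Z) h1).trans ?_
  refine (Finset.sum_le_sum fun x _ => hh x.1 x.2).trans ?_
  rw [← Finset.mul_sum]
  exact mul_le_mul_of_nonneg_left h2 hg

/-- The cardinality of `Z` costs no factor `k`. Fixing `i, j ∈ Z` on the two sides of the cut and
pairing every site of `Z` with the one opposite to it is at most two-to-one, so `|Z|` is at most
twice the number of pairs in `Z` across the cut. -/
theorem HasDecay.sum_norm_mul_card_le_of_spans {h : Interaction n d k} (hh : HasDecay h g J)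
    (hJ : IsDecay γ J) (hg : 0 ≤ g) (p : ℕ) (S : Finset (Finset (Fin n)))
    (hS : ∀ Z ∈ S, Spans p 1 Z) : ∑ Z ∈ S, ‖h.term Z‖ * Z.card ≤ 2 * (g * (γ * J 1)) := by
  set T := gapPairs n p 1 with hT
  have hcard : ∀ Z ∈ S, (Z.card : ℝ)
      ≤ ∑ x ∈ T, if x.1 ∈ Z ∧ x.2 ∈ Z then (2 : ℝ) else 0 := fun Z hZ => by
    obtain ⟨⟨i, hi, hip⟩, j, hj, hjp⟩ := hS Z hZ
    set f : Fin n → Fin n × Fin n := fun x => if (x : ℕ) ≤ p then (x, j) else (i, x) with hf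
    have hmaps : ∀ x ∈ Z, f x ∈ T.filter fun x => x.1 ∈ Z ∧ x.2 ∈ Z := fun x hx => by
      simp only [hf, hT, gapPairs, Finset.mem_filter, Finset.mem_univ, true_and]
      split_ifs with hxp
      · exact ⟨⟨hxp, hjp⟩, hx, hj⟩
      · exact ⟨⟨hip, by simp only; omega⟩, hi, hx⟩
    have hfib : ∀ y ∈ T.filter fun x => x.1 ∈ Z ∧ x.2 ∈ Z, (Z.filter fun x => f x = y).card ≤ 2 :=
        fun y _ => by
      refine (Finset.card_le_card (t := {y.1, y.2}) fun x hx => ?_).trans Finset.card_le_two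
      obtain ⟨_, rfl⟩ := Finset.mem_filter.1 hx
      simp only [hf, Finset.mem_insert, Finset.mem_singleton]
      split_ifs <;> simp
    have := Finset.card_le_mul_card_image_of_maps_to hmaps 2 hfib
    rw [← Finset.sum_filter, Finset.sum_const, nsmul_eq_mul, mul_comm]
    exact_mod_cast this
  calc ∑ Z ∈ S, ‖h.term Z‖ * Z.card
      ≤ ∑ Z ∈ S, ‖h.term Z‖ * ∑ x ∈ T, (if x.1 ∈ Z ∧ x.2 ∈ Z then (2 : ℝ) else 0) :=
        Finset.sum_le_sum fun Z hZ => mul_le_mul_of_nonneg_left (hcard Z hZ) (norm_nonneg _)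
    _ ≤ ∑ Z, ‖h.term Z‖ * ∑ x ∈ T, (if x.1 ∈ Z ∧ x.2 ∈ Z then (2 : ℝ) else 0) :=
        Finset.sum_le_sum_of_subset_of_nonneg (Finset.subset_univ _) fun Z _ _ =>
          mul_nonneg (norm_nonneg _) (Finset.sum_nonneg fun x _ => by split_ifs <;> norm_num)
    _ = 2 * ∑ x ∈ T, ∑ Z with x.1 ∈ Z ∧ x.2 ∈ Z, ‖h.term Z‖ := by
        simp only [Finset.mul_sum, Finset.sum_filter]
        rw [Finset.sum_comm]
        refine Finset.sum_congr rfl fun x _ => Finset.sum_congr rfl fun Z _ => ?_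
        split_ifs <;> ring
    _ ≤ 2 * ∑ x ∈ T, g * J (Nat.dist x.1 x.2) := by
        gcongr with x _
        exact hh x.1 x.2
    _ ≤ _ := by
        rw [← Finset.mul_sum]
        refine mul_le_mul_of_nonneg_left (mul_le_mul_of_nonneg_left ?_ hg) (by norm_num)
        refine (hJ.sum_pairs_le le_rfl p T fun x hx => ?_).trans (le_of_eq (by simp))
        simpa [hT, gapPairs] using hx

theorem one_le_of_mem_convConsts (hJ : IsDecay γ J) (hn : 0 < n) {c : ℝ}
    (hc : c ∈ convConsts n J) : 1 ≤ c := by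
  have h := hc ⟨0, hn⟩ ⟨0, hn⟩
  rw [Nat.dist_self, hJ.zero, mul_one] at h
  refine le_trans ?_ h
  have := Finset.single_le_sum (f := fun i₀ : Fin n => J (Nat.dist 0 i₀) * J (Nat.dist i₀ 0))
    (fun i _ => mul_nonneg (hJ.nonneg _) (hJ.nonneg _)) (Finset.mem_univ ⟨0, hn⟩)
  simpa [hJ.zero] using this

/-- The set is closed and bounded below by `1`, so its infimum is attained. -/
theorem convConst_mem (hJ : IsDecay γ J) (hn : 0 < n) (hne : (convConsts n J).Nonempty) :
    convConst n J ∈ convConsts n J := by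
  refine IsClosed.csInf_mem ?_ hne ⟨1, fun c hc => one_le_of_mem_convConsts hJ hn hc⟩
  simp only [convConsts, Set.ofPred_forall]
  refine isClosed_iInter fun i => isClosed_iInter fun i' => ?_
  exact isClosed_le continuous_const (continuous_id.mul continuous_const)

/-- The weight `x ↦ ∑_{z ∈ Z} J (d (x, z))` is propagated with velocity `g * 𝔤`. -/
theorem HasDecay.sum_weight_le {h : Interaction n d k} (hh : HasDecay h g J) (hJ : IsDecay γ J)
    (hg : 0 ≤ g) {𝔤 : ℝ} (h𝔤 : 𝔤 ∈ convConsts n J) {c : Finset (Fin n) → ℝ}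
    (hc : ∀ Y, |c Y| ≤ 1) (Z : Finset (Fin n)) (x : Fin n) :
    ∑ Y with x ∈ Y, |c Y| * (‖h.term Y‖ * ∑ y ∈ Y, ∑ z ∈ Z, J (Nat.dist y z))
      ≤ g * 𝔤 * ∑ z ∈ Z, J (Nat.dist x z) := by
  set w : Fin n → ℝ := fun y => ∑ z ∈ Z, J (Nat.dist y z) with hw
  have hw0 : ∀ y, 0 ≤ w y := fun y => Finset.sum_nonneg fun z _ => hJ.nonneg _
  calc _ ≤ ∑ Y with x ∈ Y, ‖h.term Y‖ * ∑ y ∈ Y, w y := by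
        refine Finset.sum_le_sum fun Y _ => mul_le_of_le_one_left ?_ (hc Y)
        exact mul_nonneg (norm_nonneg _) (Finset.sum_nonneg fun y _ => hw0 y)
    _ = ∑ y, w y * ∑ Y with x ∈ Y ∧ y ∈ Y, ‖h.term Y‖ := by
        simp only [Finset.mul_sum, Finset.sum_filter]
        rw [Finset.sum_comm]
        refine Finset.sum_congr rfl fun Y _ => ?_
        by_cases hx : x ∈ Y
        · rw [if_pos hx, ← Finset.sum_filter_add_sum_filter_not Finset.univ (fun y => y ∈ Y)]
          rw [Finset.sum_eq_zero (s := Finset.univ.filter fun y => ¬y ∈ Y), add_zero]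
          · refine Finset.sum_congr (by ext; simp) fun y hy => ?_
            rw [if_pos ⟨hx, by simpa using hy⟩]; exact mul_comm _ _
          · intro y hy
            rw [if_neg (fun h => (Finset.mem_filter.1 hy).2 h.2), mul_zero]
        · simp [hx]
    _ ≤ ∑ y, w y * (g * J (Nat.dist x y)) :=
        Finset.sum_le_sum fun y _ => mul_le_mul_of_nonneg_left (hh x y) (hw0 y)
    _ = g * ∑ z ∈ Z, ∑ y : Fin n, J (Nat.dist x y) * J (Nat.dist y z) := by
        simp only [hw, Finset.mul_sum, Finset.sum_mul]
        rw [Finset.sum_comm]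
        exact Finset.sum_congr rfl fun z _ => Finset.sum_congr rfl fun y _ => by ring
    _ ≤ g * ∑ z ∈ Z, 𝔤 * J (Nat.dist x z) := by
        gcongr with z _
        exact h𝔤 x z
    _ = _ := by rw [← Finset.mul_sum, mul_assoc]

theorem HasDecay.sum_norm_le {h : Interaction n d k} (hh : HasDecay h g J) (hJ : IsDecay γ J)
    (x : Fin n) : ∑ Y with x ∈ Y, ‖h.term Y‖ ≤ g := by
  have := hh x x
  simpa [hJ.zero] using this

/-- If the terms with nonzero coefficients change `w` at most by a factor `e`, then `w` is
propagated with velocity `e * g * k`. -/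
theorem HasDecay.sum_weight_exp_le {h : Interaction n d k} (hh : HasDecay h g J)
    (hJ : IsDecay γ J) {c : Finset (Fin n) → ℝ} (hc : ∀ Y, |c Y| ≤ 1) {w : Fin n → ℝ}
    (hw : ∀ x, 0 ≤ w x) {e : ℝ} (he : 0 ≤ e)
    (hstep : ∀ Y, c Y ≠ 0 → ∀ x ∈ Y, ∀ y ∈ Y, w y ≤ e * w x) (x : Fin n) :
    ∑ Y with x ∈ Y, |c Y| * (‖h.term Y‖ * ∑ y ∈ Y, w y) ≤ e * g * k * w x := by
  calc _ ≤ ∑ Y with x ∈ Y, ‖h.term Y‖ * (k * (e * w x)) := by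
        refine Finset.sum_le_sum fun Y hY => ?_
        have hx := (Finset.mem_filter.1 hY).2
        have h0 : 0 ≤ k * (e * w x) := mul_nonneg (Nat.cast_nonneg _) (mul_nonneg he (hw x))
        by_cases hcY : c Y = 0
        · rw [hcY, abs_zero, zero_mul]
          exact mul_nonneg (norm_nonneg _) h0
        by_cases hk : k < Y.card
        · simp [h.isLocal Y hk]
        · refine (mul_le_of_le_one_left (mul_nonneg (norm_nonneg _)
            (Finset.sum_nonneg fun y _ => hw y)) (hc Y)).trans ?_
          refine mul_le_mul_of_nonneg_left ?_ (norm_nonneg _)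
          calc ∑ y ∈ Y, w y ≤ ∑ y ∈ Y, e * w x :=
                Finset.sum_le_sum fun y hy => hstep Y hcY x hx y hy
            _ = Y.card * (e * w x) := by rw [Finset.sum_const, nsmul_eq_mul]
            _ ≤ k * (e * w x) := by
                gcongr
                · exact mul_nonneg he (hw x)
                · omega
    _ = (∑ Y with x ∈ Y, ‖h.term Y‖) * (k * (e * w x)) := by rw [Finset.sum_mul]
    _ ≤ g * (k * (e * w x)) := mul_le_mul_of_nonneg_right (hh.sum_norm_le hJ x)
        (mul_nonneg (Nat.cast_nonneg _) (mul_nonneg he (hw x)))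
    _ = _ := by ring

end Sums

/-! ### Comparison of the full and the local evolution. -/

section Comparison

variable {A : Type*} [CStarAlgebra A]

theorem comm_add_left (a b c : A) : comm (a + b) c = comm a c + comm b c := by
  simp only [comm]; noncomm_ring

theorem comm_neg_left (a c : A) : comm (-a) c = -comm a c := by
  simp only [comm]; noncomm_ring

theorem comm_smul_left (z : ℂ) (a c : A) : comm (z • a) c = z • comm a c := by
  simp [comm, smul_sub]

theorem comm_algebraMap_left (z : ℂ) (c : A) : comm (algebraMap ℂ A z) c = 0 := by
  rw [comm, Algebra.commutes, sub_self]

theorem comm_sum_left {ι : Type*} (s : Finset ι) (a : ι → A) (c : A) :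
    comm (∑ i ∈ s, a i) c = ∑ i ∈ s, comm (a i) c := by
  simp [comm, Finset.sum_mul, Finset.mul_sum]

theorem comm_sum_right {ι : Type*} (s : Finset ι) (a : ι → A) (c : A) :
    comm c (∑ i ∈ s, a i) = ∑ i ∈ s, comm c (a i) := by
  simp [comm, Finset.sum_mul, Finset.mul_sum]

theorem norm_comm_symm (a b : A) : ‖comm a b‖ = ‖comm b a‖ := by
  rw [comm, comm, norm_sub_rev]

/-- Both evolutions of `N` are compared with the one generated by `K` alone: `O` drops out by
commutation, and Duhamel's formula is applied to `W` and `W'`. Nothing is gained from locality for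
`F`, which costs `‖F‖`. -/
theorem norm_heis_add_sub_le_of_nonneg {K O W W' N F : A} (hK : IsSelfAdjoint K)
    (hO : IsSelfAdjoint O) (hW : IsSelfAdjoint W) (hW' : IsSelfAdjoint W') (hF : HalfBounded F)
    (hOK : Commute K O) (hON : Commute O N) {C₁ C₂ A₀ α : ℝ} (hα : α ≠ 0)
    (h₁ : ∀ s, 0 ≤ s → ‖comm W (heis K N s)‖ ≤ C₁ + A₀ * Real.exp (α * s))
    (h₂ : ∀ s, 0 ≤ s → ‖comm W' (heis K N s)‖ ≤ C₂) {t : ℝ} (ht : 0 ≤ t) :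
    ‖heis (K + O + W) (N + F) t - heis (K + W') (N + F) t‖
      ≤ ‖F‖ + (C₁ + C₂) * t + A₀ * ((Real.exp (α * t) - 1) / α) := by
  have hexp : ∀ s : ℝ, HasDerivAt (fun s => (Real.exp (α * s) - 1) / α) (Real.exp (α * s)) s :=
      fun s => by
    refine ((((hasDerivAt_id s).const_mul α).exp.sub_const 1).div_const α).congr_deriv ?_
    simp only [id, mul_one]
    field_simp
  have e1 : ‖heis (K + O + W) N t - heis (K + O) N t‖
      ≤ C₁ * t + A₀ * ((Real.exp (α * t) - 1) / α) := by
    refine norm_heis_sub_heis_le_of_norm_comm_le ((hK.add hO).add hW)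
      (b := fun t => C₁ * t + A₀ * ((Real.exp (α * t) - 1) / α))
      (b' := fun s => C₁ + A₀ * Real.exp (α * s)) (by simp)
      (fun s => ?_) ht fun s hs => ?_
    · refine (((hasDerivAt_id s).const_mul C₁).add ((hexp s).const_mul A₀)).congr_deriv ?_
      simp
    · rw [add_sub_cancel_left, heis_add_of_commute hOK hON]
      exact h₁ s hs
  have e2 : ‖heis (K + W') N t - heis K N t‖ ≤ C₂ * t := by
    refine norm_heis_sub_heis_le_of_norm_comm_le (hK.add hW')
      (b := fun t => C₂ * t) (b' := fun s => C₂) (by simp)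
      (fun s => ?_) ht fun s hs => ?_
    · refine ((hasDerivAt_id s).const_mul C₂).congr_deriv ?_
      simp
    · rw [add_sub_cancel_left]
      exact h₂ s hs
  have e3 := hF.norm_heis_sub_heis_le ((hK.add hO).add hW) (hK.add hW') t
  rw [heis_add_of_commute hOK hON] at e1
  have e : heis (K + O + W) (N + F) t - heis (K + W') (N + F) t
      = (heis (K + O + W) N t - heis K N t) - (heis (K + W') N t - heis K N t)
        + (heis (K + O + W) F t - heis (K + W') F t) := by
    rw [heis_add, heis_add]; abel
  rw [e]
  refine (norm_add_le _ _).trans ((add_le_add (norm_sub_le _ _) le_rfl).trans ?_)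
  linarith

/-- Negative times amount to changing the sign of the generators, hence the hypotheses for both `K`
and `-K`. -/
theorem norm_heis_add_sub_le {K O W W' N F : A} (hK : IsSelfAdjoint K)
    (hO : IsSelfAdjoint O) (hW : IsSelfAdjoint W) (hW' : IsSelfAdjoint W') (hF : HalfBounded F)
    (hOK : Commute K O) (hON : Commute O N) {C₁ C₂ A₀ α : ℝ} (hα : α ≠ 0)
    (h₁ : ∀ P, P = K ∨ P = -K → ∀ s, 0 ≤ s →
      ‖comm W (heis P N s)‖ ≤ C₁ + A₀ * Real.exp (α * s))
    (h₂ : ∀ P, P = K ∨ P = -K → ∀ s, 0 ≤ s → ‖comm W' (heis P N s)‖ ≤ C₂) (t : ℝ) :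
    ‖heis (K + O + W) (N + F) t - heis (K + W') (N + F) t‖
      ≤ ‖F‖ + (C₁ + C₂) * |t| + A₀ * ((Real.exp (α * |t|) - 1) / α) := by
  rcases le_total 0 t with ht | ht
  · rw [abs_of_nonneg ht]
    exact norm_heis_add_sub_le_of_nonneg hK hO hW hW' hF hOK hON hα (h₁ K (.inl rfl))
      (h₂ K (.inl rfl)) ht
  · obtain ⟨u, rfl⟩ : ∃ u, t = -u := ⟨-t, (neg_neg t).symm⟩
    have hu : 0 ≤ u := by linarith
    rw [abs_neg, abs_of_nonneg hu]
    have := norm_heis_add_sub_le_of_nonneg hK.neg hO.neg hW.neg hW'.neg hF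
      hOK.neg_left.neg_right hON.neg_left hα
      (fun s hs => by rw [comm_neg_left, norm_neg]; exact h₁ (-K) (.inr rfl) s hs)
      (fun s hs => by rw [comm_neg_left, norm_neg]; exact h₂ (-K) (.inr rfl) s hs) hu
    simpa only [heis_neg_time, neg_add] using this

end Comparison

/-! ### Interpolation between the trivial and the Lieb–Robinson bound. -/

section Interpolation

/-- The minimum of `1` and `4 M (exp(κ s) - 1)` is bounded by a multiple of a slowly growing
exponential. -/
theorem exists_exp_bound {β v κ M : ℝ} (hβ : 0 < β) (hv : 0 < v) (hκ : 0 < κ)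
    (hκv : κ ≤ Real.exp 1 / 2 * v) (hM : 0 ≤ M) :
    ∃ α A₀ : ℝ, 0 < α ∧ α * β / Real.pi ≤ 0.34 ∧ 0 ≤ A₀ ∧
      A₀ ≤ √M + 4 * M ^ (Real.pi / (4 * v * β)) ∧
      ∀ s : ℝ, 0 ≤ s → min 1 (4 * M * (Real.exp (κ * s) - 1)) ≤ A₀ * Real.exp (α * s) := by
  have hπ := Real.pi_pos
  have he : Real.exp 1 < 2.72 := Real.exp_one_lt_d9.trans (by norm_num)
  have hnn : ∀ s : ℝ, 0 ≤ s → 0 ≤ 4 * M * (Real.exp (κ * s) - 1) := fun s hs => by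
    have := Real.one_le_exp (mul_nonneg hκ.le hs)
    exact mul_nonneg (by positivity) (by linarith)
  have hmin : ∀ (x θ : ℝ), 0 ≤ x → 0 ≤ θ → θ ≤ 1 → min 1 x ≤ x ^ θ := fun x θ hx h0 h1 => by
    rcases le_total x 1 with h | h
    · rw [min_eq_right h]
      rcases hx.eq_or_lt with rfl | hx
      · exact Real.rpow_nonneg le_rfl _
      · simpa using Real.rpow_le_rpow_of_exponent_ge hx h h1
    · rw [min_eq_left h]
      exact Real.one_le_rpow h h0
  rcases le_total (4 * v * β) Real.pi with hw | hw
  · refine ⟨κ, √M, hκ, ?_, Real.sqrt_nonneg _,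
      le_add_of_nonneg_right (by positivity), fun s hs => ?_⟩
    · rw [div_le_iff₀ hπ]
      calc κ * β ≤ Real.exp 1 / 2 * v * β := by gcongr
        _ = Real.exp 1 / 8 * (4 * v * β) := by ring
        _ ≤ Real.exp 1 / 8 * Real.pi := by gcongr
        _ ≤ 0.34 * Real.pi := by gcongr; linarith
    · refine (hmin _ (1 / 2) (hnn s hs) (by norm_num) (by norm_num)).trans ?_
      rw [← Real.sqrt_eq_rpow, ← Real.sqrt_sq (Real.exp_pos (κ * s)).le, ← Real.sqrt_mul hM]
      rw [Real.sqrt_sq (Real.exp_pos (κ * s)).le]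
      refine Real.sqrt_le_sqrt ?_
      nlinarith [mul_nonneg hM (sq_nonneg (Real.exp (κ * s) - 2))]
  -- For larger `β`, the power `θ` slows the growth to the rate `θκ ≤ (e/8)π/β`.
  · set θ := Real.pi / (4 * v * β) with hθ
    have hθ0 : 0 < θ := by positivity
    have hθ1 : θ ≤ 1 := by rw [hθ, div_le_one (by positivity)]; exact hw
    refine ⟨θ * κ, 4 * M ^ θ, by positivity, ?_, by positivity,
      le_add_of_nonneg_left (Real.sqrt_nonneg _), fun s hs => ?_⟩
    · rw [div_le_iff₀ hπ]
      calc θ * κ * β ≤ θ * (Real.exp 1 / 2 * v) * β := by gcongr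
        _ = Real.exp 1 / 8 * Real.pi := by rw [hθ]; field_simp; norm_num
        _ ≤ 0.34 * Real.pi := by gcongr; linarith
    · refine (hmin _ θ (hnn s hs) hθ0.le hθ1).trans ?_
      calc (4 * M * (Real.exp (κ * s) - 1)) ^ θ ≤ (4 * M * Real.exp (κ * s)) ^ θ := by
            refine Real.rpow_le_rpow (hnn s hs) ?_ hθ0.le
            nlinarith
        _ = 4 ^ θ * M ^ θ * Real.exp (θ * κ * s) := by
            rw [Real.mul_rpow (by positivity) (Real.exp_pos _).le,
              Real.mul_rpow (by norm_num) hM, ← Real.exp_mul]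
            congr 2; ring
        _ ≤ 4 * M ^ θ * Real.exp (θ * κ * s) := by
            gcongr
            calc (4 : ℝ) ^ θ ≤ 4 ^ (1 : ℝ) :=
                  Real.rpow_le_rpow_of_exponent_le (by norm_num) hθ1
              _ = 4 := Real.rpow_one 4

end Interpolation

/-! ### Summing the Lieb–Robinson bound over pairs of terms. -/

section Perturbation

variable {n d k : ℕ}

/-- The commutator of the distant terms `𝒱` with the evolution of the near terms `𝒩`. -/
theorem norm_comm_sum_heis_sum_le (h : Interaction n d k) {c : Finset (Fin n) → ℝ} {κ M U : ℝ}
    {𝒱 𝒩 : Finset (Finset (Fin n))} (hM : 0 ≤ M) (hκ : 0 ≤ κ)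
    (hV : ∑ Z ∈ 𝒱, ‖h.term Z‖ ≤ 2 * U) (hN : ∑ X ∈ 𝒩, ‖h.term X‖ ≤ U)
    (hV' : ∑ Z ∈ 𝒱, ‖h.term Z‖ * Z.card ≤ 4 * U) (hN' : ∑ X ∈ 𝒩, ‖h.term X‖ * X.card ≤ 2 * U)
    (hdisj : ∀ Z ∈ 𝒱, ∀ X ∈ 𝒩, Disjoint X Z)
    (hw : ∀ Z ∈ 𝒱, ∃ w : Fin n → ℝ, (∀ x, 0 ≤ w x) ∧ (∀ z ∈ Z, 1 ≤ w z) ∧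
      (∀ x, ∑ Y with x ∈ Y, |c Y| * (‖h.term Y‖ * ∑ y ∈ Y, w y) ≤ κ * w x) ∧
      ∀ X ∈ 𝒩, ∀ x ∈ X, w x ≤ M * Z.card) {s : ℝ} (hs : 0 ≤ s) :
    ‖comm (∑ Z ∈ 𝒱, h.term Z) (heis (weightedHam h c) (∑ X ∈ 𝒩, h.term X) s)‖
      ≤ U ^ 2 * min 1 (4 * M * (Real.exp (κ * s) - 1)) := by
  have hE : 0 ≤ Real.exp (κ * s) - 1 := by
    have := Real.one_le_exp (mul_nonneg hκ hs)
    linarith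
  have hU : 0 ≤ U := (Finset.sum_nonneg fun X _ => norm_nonneg _).trans hN
  rw [mul_min_of_nonneg _ _ (sq_nonneg U), mul_one]
  refine le_min ?_ ?_
  -- The trivial bound: both sums are positive, so the commutator is at most `(2U)U/2`.
  · refine ((h.halfBounded_sum 𝒱).norm_comm_le_half
      ((h.halfBounded_sum 𝒩).heis (isSelfAdjoint_weightedHam h c) s)).trans ?_
    rw [norm_heis (isSelfAdjoint_weightedHam h c)]
    have h1 := (norm_sum_le 𝒱 fun Z => h.term Z).trans hV
    have h2 := (norm_sum_le 𝒩 fun Z => h.term Z).trans hN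
    calc _ ≤ (2 * U) * U / 2 := by gcongr
      _ = U ^ 2 := by ring
  -- Pair by pair, the weight of `X` is at most `|X| · M|Z|`; the total is `(4U)(2U)M/2 = 4MU²`.
  · rw [heis_sum, comm_sum_left]
    calc _ ≤ ∑ Z ∈ 𝒱, ∑ X ∈ 𝒩, (‖h.term Z‖ * Z.card) * (‖h.term X‖ * X.card) *
          (M / 2 * (Real.exp (κ * s) - 1)) := by
          refine (norm_sum_le _ _).trans (Finset.sum_le_sum fun Z hZ => ?_)
          rw [comm_sum_right]
          refine (norm_sum_le _ _).trans (Finset.sum_le_sum fun X hX => ?_)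
          obtain ⟨w, hw0, hwZ, hwκ, hwM⟩ := hw Z hZ
          rw [norm_comm_symm]
          refine (norm_comm_heis_term_le h hw0 hwZ hwκ (hdisj Z hZ X hX) hs).trans ?_
          have h3 : ∑ x ∈ X, w x ≤ X.card * (M * Z.card) := by
            rw [← nsmul_eq_mul]
            exact Finset.sum_le_card_nsmul _ _ _ (hwM X hX)
          calc _ ≤ ‖h.term X‖ * ‖h.term Z‖ / 2 * (X.card * (M * Z.card))
                * (Real.exp (κ * s) - 1) := by gcongr
            _ = _ := by ring
      _ = (∑ Z ∈ 𝒱, ‖h.term Z‖ * Z.card) * (∑ X ∈ 𝒩, ‖h.term X‖ * X.card) *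
          (M / 2 * (Real.exp (κ * s) - 1)) := by
          rw [Finset.sum_mul_sum, Finset.sum_mul]
          simp only [Finset.sum_mul]
      _ ≤ (4 * U) * (2 * U) * (M / 2 * (Real.exp (κ * s) - 1)) := by gcongr
      _ = _ := by ring

end Perturbation

/-! ### Block structure and the supports occurring in the truncated Hamiltonian. -/

section Decomposition

variable {n d k : ℕ} {a l₀ q : ℕ}

/-- The index of the block containing the site `i`. -/
def blockIndex (a l₀ q i : ℕ) : ℕ := if i < a then 0 else min (q + 1) ((i - a) / l₀ + 1)

theorem blockIndex_le (i : ℕ) : blockIndex a l₀ q i ≤ q + 1 := by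
  unfold blockIndex; split_ifs <;> omega

theorem mem_block_iff (hl : 0 < l₀) {s : ℕ} (hs : s ≤ q + 1) (i : Fin n) :
    i ∈ block n a l₀ q s ↔ blockIndex a l₀ q i = s := by
  simp only [block, Finset.mem_filter, Finset.mem_univ, true_and, blockIndex]
  rcases s with _ | s
  · split_ifs with h <;> simp <;> omega
  · have h1 : s ≤ ((i : ℕ) - a) / l₀ ↔ s * l₀ ≤ i - a := Nat.le_div_iff_mul_le hl
    have h2 : ((i : ℕ) - a) / l₀ < s + 1 ↔ (i : ℕ) - a < (s + 1) * l₀ := Nat.div_lt_iff_lt_mul hl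
    have h3 : (s + 1) * l₀ = s * l₀ + l₀ := by ring
    rw [Nat.add_sub_cancel]
    have h0 : s + 1 ≠ 0 := Nat.succ_ne_zero s
    have h5 : s + 1 = q + 1 ↔ s = q := by omega
    simp only [h0, h5, false_or]
    split_ifs with h
    · have : ¬(a + s * l₀ ≤ i) := by omega
      simp only [this, false_and]
    · rcases hs.eq_or_lt with h6 | h6
      · have h7 : s = q := by omega
        simp only [h7, true_or, and_true] at *
        omega
      · have h7 : s ≠ q := by omega
        simp only [h7, false_or]
        omega

/-- As `0 < a`, the subtraction in `lastSite` is not truncated. -/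
theorem le_lastSite_iff (hl : 0 < l₀) (ha : 0 < a) {s : ℕ} (hs : s ≤ q) (i : ℕ) :
    i ≤ lastSite a l₀ s ↔ blockIndex a l₀ q i ≤ s := by
  have h2 : (i - a) / l₀ < s ↔ i - a < s * l₀ := Nat.div_lt_iff_lt_mul hl
  simp only [lastSite, blockIndex]
  split_ifs with h <;> omega

/-- `Z` is contained in the union of two adjacent blocks. -/
def InAdjacentBlocks (a l₀ q : ℕ) (Z : Finset (Fin n)) : Prop :=
  ∃ s ≤ q, Z ⊆ block n a l₀ q s ∪ block n a l₀ q (s + 1)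

theorem inAdjacentBlocks_iff (hl : 0 < l₀) (Z : Finset (Fin n)) : InAdjacentBlocks a l₀ q Z ↔
    ∃ s ≤ q, ∀ i ∈ Z, blockIndex a l₀ q i = s ∨ blockIndex a l₀ q i = s + 1 := by
  refine exists_congr fun s => and_congr_right fun hs => forall₂_congr fun i _ => ?_
  rw [Finset.mem_union, mem_block_iff hl (by omega), mem_block_iff hl (by omega)]

/-- The supports of the terms of `h_s`. -/
def boundarySets (n a l₀ q s : ℕ) : Finset (Finset (Fin n)) :=
  {Z | Z ⊆ block n a l₀ q s ∪ block n a l₀ q (s + 1) ∧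
    (Z ∩ block n a l₀ q s).Nonempty ∧ (Z ∩ block n a l₀ q (s + 1)).Nonempty}

theorem mem_boundarySets_iff (hl : 0 < l₀) {s : ℕ} (hs : s ≤ q) (Z : Finset (Fin n)) :
    Z ∈ boundarySets n a l₀ q s ↔
      (∀ i ∈ Z, blockIndex a l₀ q i = s ∨ blockIndex a l₀ q i = s + 1) ∧
      (∃ i ∈ Z, blockIndex a l₀ q i = s) ∧ ∃ i ∈ Z, blockIndex a l₀ q i = s + 1 := by
  simp only [boundarySets, Finset.mem_filter, Finset.mem_univ, true_and]
  refine and_congr (forall₂_congr fun i _ => ?_) (and_congr ?_ ?_)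
  · rw [Finset.mem_union, mem_block_iff hl (by omega), mem_block_iff hl (by omega)]
  · simp only [Finset.Nonempty, Finset.mem_inter, mem_block_iff hl (show s ≤ q + 1 by omega)]
  · simp only [Finset.Nonempty, Finset.mem_inter, mem_block_iff hl (show s + 1 ≤ q + 1 by omega)]

open Classical in
/-- The supports of the terms of the truncated Hamiltonian contained in `B_lo ∪ ⋯ ∪ B_hi`. -/
def segmentSets (n a l₀ q lo hi : ℕ) : Finset (Finset (Fin n)) :=
  {Z | Z.Nonempty ∧ InAdjacentBlocks a l₀ q Z ∧
    ∀ i ∈ Z, lo ≤ blockIndex a l₀ q i ∧ blockIndex a l₀ q i ≤ hi}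

theorem Interaction.exists_term_empty (h : Interaction n d k) :
    ∃ c : ℂ, h.term ∅ = algebraMap ℂ (Op n d) c := by
  obtain ⟨B, hB⟩ := h.supported ∅
  refine ⟨B (fun i => absurd i.2 (Finset.notMem_empty _))
    (fun i => absurd i.2 (Finset.notMem_empty _)), ?_⟩
  ext x y
  rw [hB, Matrix.algebraMap_matrix_apply]
  have e : (∀ i, i ∉ (∅ : Finset (Fin n)) → x i = y i) ↔ x = y := by
    simp [funext_iff]
  simp only [e]
  split_ifs with hxy
  · simp only [Algebra.algebraMap_self, RingHom.id_apply]
    congr 1 <;> (ext i; exact absurd i.2 (Finset.notMem_empty _))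
  · rfl

/-- Every nonempty support within two adjacent blocks belongs to exactly one block or one boundary
sum. Only the scalar `h_∅` is repeated, once per block; it does not affect evolutions. -/
theorem exists_segment_sum (h : Interaction n d k) (hl : 0 < l₀) {lo hi : ℕ} (hhi : hi ≤ q + 1) :
    ∃ c : ℂ, ∑ s ∈ Finset.Icc lo hi, blockHam h a l₀ q s
      + ∑ s ∈ Finset.Ico lo hi, boundaryHam h a l₀ q s
      = algebraMap ℂ (Op n d) c + ∑ Z ∈ segmentSets n a l₀ q lo hi, h.term Z := by
  classical
  obtain ⟨c, hc⟩ := h.exists_term_empty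
  refine ⟨((Finset.Icc lo hi).card : ℂ) * c, ?_⟩
  set P : ℕ → Finset (Finset (Fin n)) := fun s =>
    {Z | Z.Nonempty ∧ ∀ i ∈ Z, blockIndex a l₀ q i = s} with hP
  have hblock : ∀ s ∈ Finset.Icc lo hi, blockHam h a l₀ q s
      = algebraMap ℂ (Op n d) c + ∑ Z ∈ P s, h.term Z := fun s hs => by
    have hs' := Finset.mem_Icc.1 hs
    have e : (Finset.univ.filter fun Z : Finset (Fin n) => Z ⊆ block n a l₀ q s)
        = insert ∅ (P s) := by
      ext Z
      simp only [hP, Finset.mem_filter, Finset.mem_univ, true_and, Finset.mem_insert,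
        Finset.subset_iff, mem_block_iff hl (show s ≤ q + 1 by omega)]
      rcases Z.eq_empty_or_nonempty with rfl | hZ
      · simp
      · simp [hZ, hZ.ne_empty]
    rw [blockHam, e, Finset.sum_insert (by simp [hP]), hc]
  have hbdry : ∀ s ∈ Finset.Ico lo hi, boundaryHam h a l₀ q s
      = ∑ Z ∈ boundarySets n a l₀ q s, h.term Z := fun s _ => rfl
  rw [Finset.sum_congr rfl hblock, Finset.sum_congr rfl hbdry, Finset.sum_add_distrib,
    Finset.sum_const, nsmul_eq_mul, add_assoc, map_mul, map_natCast]
  congr 1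
  rw [← Finset.sum_biUnion, ← Finset.sum_biUnion, ← Finset.sum_union]
  · refine Finset.sum_congr ?_ fun _ _ => rfl
    ext Z
    simp only [segmentSets, Finset.mem_union, Finset.mem_biUnion, Finset.mem_Icc, Finset.mem_Ico,
      Finset.mem_filter, Finset.mem_univ, true_and, inAdjacentBlocks_iff hl, hP]
    constructor
    · rintro (⟨s, hs, hne, hZ⟩ | ⟨s, hs, hZ⟩)
      · refine ⟨hne, ?_, fun i hi => by rw [hZ i hi]; exact hs⟩
        rcases Nat.lt_or_ge q s with hq | hq
        · exact ⟨q, le_rfl, fun i hi => .inr (by rw [hZ i hi]; omega)⟩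
        · exact ⟨s, hq, fun i hi => .inl (hZ i hi)⟩
      · rw [mem_boundarySets_iff hl (by omega)] at hZ
        obtain ⟨hZ, ⟨i, hi, -⟩, -⟩ := hZ
        exact ⟨⟨i, hi⟩, ⟨s, by omega, hZ⟩, fun j hj => by have := hZ j hj; omega⟩
    · rintro ⟨hne, ⟨s, hs, hZ⟩, hb⟩
      by_cases h0 : ∃ i ∈ Z, blockIndex a l₀ q i = s
      · obtain ⟨i, hi, his⟩ := h0
        have hbi := hb i hi
        by_cases h1 : ∃ j ∈ Z, blockIndex a l₀ q j = s + 1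
        · obtain ⟨j, hj, hjs⟩ := h1
          have hbj := hb j hj
          exact .inr ⟨s, by omega, (mem_boundarySets_iff hl hs Z).2 ⟨hZ, ⟨i, hi, his⟩, j, hj, hjs⟩⟩
        · push Not at h1
          exact .inl ⟨s, by omega, hne, fun j hj => (hZ j hj).resolve_right (h1 j hj)⟩
      · push Not at h0
        obtain ⟨i, hi⟩ := hne
        have hbi := hb i hi
        have his := (hZ i hi).resolve_left (h0 i hi)
        exact .inl ⟨s + 1, by omega, ⟨i, hi⟩, fun j hj => (hZ j hj).resolve_left (h0 j hj)⟩
  · rw [Finset.disjoint_left]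
    intro Z h1 h2
    simp only [Finset.mem_biUnion, Finset.mem_Icc, Finset.mem_Ico, Finset.mem_filter,
      Finset.mem_univ, true_and, hP] at h1 h2
    obtain ⟨s, hs, -, hZ⟩ := h1
    obtain ⟨s', hs', hZ'⟩ := h2
    obtain ⟨-, ⟨i, hi, his⟩, j, hj, hjs⟩ := (mem_boundarySets_iff hl (by omega) Z).1 hZ'
    have h3 := hZ i hi
    have h4 := hZ j hj
    omega
  · intro s hs s' hs' hne
    rw [Function.onFun, Finset.disjoint_left]
    intro Z h1 h2
    have hs1 := Finset.mem_Ico.1 hs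
    have hs2 := Finset.mem_Ico.1 hs'
    obtain ⟨hZ, ⟨i, hi, his⟩, j, hj, hjs⟩ := (mem_boundarySets_iff hl (by omega) Z).1 h1
    obtain ⟨hZ', ⟨i', hi', his'⟩, j', hj', hjs'⟩ := (mem_boundarySets_iff hl (by omega) Z).1 h2
    have h3 := hZ' i hi
    have h4 := hZ' j hj
    omega
  · intro s hs s' hs' hne
    rw [Function.onFun, Finset.disjoint_left]
    intro Z h1 h2
    simp only [Finset.mem_filter, Finset.mem_univ, true_and, hP] at h1 h2
    obtain ⟨i, hi⟩ := h1.1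
    exact hne ((h1.2 i hi).symm.trans (h2.2 i hi))

open Classical in
/-- The supports of the terms of the truncated Hamiltonian on either side of the cut after the
site `b`. -/
def halfSets (n a l₀ q b : ℕ) : Finset (Finset (Fin n)) :=
  {Z | Z.Nonempty ∧ InAdjacentBlocks a l₀ q Z ∧
    ((∀ i ∈ Z, (i : ℕ) ≤ b) ∨ ∀ i ∈ Z, b < (i : ℕ))}

theorem exists_hamLE_add_hamGT (h : Interaction n d k) (hl : 0 < l₀) (ha : 0 < a) {s : ℕ}
    (hs : s ≤ q) : ∃ c : ℂ, hamLE h a l₀ q s + hamGT h a l₀ q s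
      = algebraMap ℂ (Op n d) c + ∑ Z ∈ halfSets n a l₀ q (lastSite a l₀ s), h.term Z := by
  classical
  obtain ⟨c₁, h₁⟩ := exists_segment_sum (a := a) (lo := 0) h hl (show s ≤ q + 1 by omega)
  obtain ⟨c₂, h₂⟩ := exists_segment_sum (a := a) (lo := s + 1) h hl (le_refl (q + 1))
  have e1 : hamLE h a l₀ q s
      = algebraMap ℂ (Op n d) c₁ + ∑ Z ∈ segmentSets n a l₀ q 0 s, h.term Z := by
    rw [← h₁, hamLE]
    congr 2 <;> ext i <;> simp
  have e2 : hamGT h a l₀ q s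
      = algebraMap ℂ (Op n d) c₂ + ∑ Z ∈ segmentSets n a l₀ q (s + 1) (q + 1), h.term Z := by
    rw [← h₂, hamGT]
    congr 2 <;> ext i <;> simp
  refine ⟨c₁ + c₂, ?_⟩
  have e3 : halfSets n a l₀ q (lastSite a l₀ s)
      = segmentSets n a l₀ q 0 s ∪ segmentSets n a l₀ q (s + 1) (q + 1) := by
    ext Z
    simp only [halfSets, segmentSets, Finset.mem_union, Finset.mem_filter, Finset.mem_univ,
      true_and, ← not_le, le_lastSite_iff hl ha hs, ← and_or_left]
    refine and_congr_right fun _ => and_congr_right fun _ => or_congr ?_ ?_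
    · exact forall₂_congr fun i _ => by simp
    · refine forall₂_congr fun i _ => ?_
      have := blockIndex_le (a := a) (l₀ := l₀) (q := q) i
      omega
  rw [e1, e2, e3, Finset.sum_union, map_add]
  · abel
  · rw [Finset.disjoint_left]
    intro Z h1 h2
    simp only [segmentSets, Finset.mem_filter, Finset.mem_univ, true_and] at h1 h2
    obtain ⟨i, hi⟩ := h1.1
    have h3 := h1.2.2 i hi
    have h4 := h2.2.2 i hi
    omega

open Classical in
theorem exists_subsetHam_add_subsetHam (h : Interaction n d k) (b r : ℕ) :
    ∃ c : ℂ, subsetHam h a l₀ q (leftPart n b r) + subsetHam h a l₀ q (rightPart n b r)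
      = algebraMap ℂ (Op n d) c
        + ∑ Z ∈ halfSets n a l₀ q b with Z ⊆ window n b r, h.term Z := by
  obtain ⟨c, hc⟩ := h.exists_term_empty
  have e : ∀ L : Finset (Fin n), subsetHam h a l₀ q L = algebraMap ℂ (Op n d) c
      + ∑ Z with Z.Nonempty ∧ InAdjacentBlocks a l₀ q Z ∧ Z ⊆ L, h.term Z := fun L => by
    rw [← hc, ← Finset.sum_insert (by simp), subsetHam]
    refine Finset.sum_congr ?_ fun _ _ => rfl
    ext Z
    simp only [Finset.mem_filter, Finset.mem_univ, true_and, Finset.mem_insert]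
    rcases Z.eq_empty_or_nonempty with rfl | hZ
    · simp only [Finset.empty_subset, true_and, true_or, iff_true]
      exact ⟨0, Nat.zero_le _, trivial⟩
    · simp only [hZ, hZ.ne_empty, false_or, true_and]
      exact and_comm
  refine ⟨c + c, ?_⟩
  have e2 : (halfSets n a l₀ q b).filter (fun Z => Z ⊆ window n b r)
      = (Finset.univ.filter fun Z => Z.Nonempty ∧ InAdjacentBlocks a l₀ q Z ∧ Z ⊆ leftPart n b r)
        ∪ Finset.univ.filter fun Z =>
          Z.Nonempty ∧ InAdjacentBlocks a l₀ q Z ∧ Z ⊆ rightPart n b r := by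
    ext Z
    simp only [halfSets, window, Finset.mem_union, Finset.mem_filter, Finset.mem_univ,
      true_and, Finset.subset_iff, leftPart, rightPart, and_assoc, ← and_or_left]
    refine and_congr_right fun _ => and_congr_right fun _ => ?_
    constructor
    · rintro ⟨h1 | h1, h2⟩
      · left; intro i hi; have := h1 i hi; have := h2 hi; omega
      · right; intro i hi; have := h1 i hi; have := h2 hi; omega
    · rintro (h1 | h1)
      · exact ⟨.inl fun i hi => (h1 hi).2, fun i hi => .inl (h1 hi)⟩
      · exact ⟨.inr fun i hi => (h1 hi).1, fun i hi => .inr (h1 hi)⟩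
  rw [e, e, e2, Finset.sum_union, map_add]
  · abel
  · rw [Finset.disjoint_left]
    intro Z h1 h2
    simp only [Finset.mem_filter, Finset.mem_univ, true_and, Finset.subset_iff, leftPart,
      rightPart] at h1 h2
    obtain ⟨i, hi⟩ := h1.1
    have h3 := h1.2.2 hi
    have h4 := h2.2.2 hi
    omega

theorem boundaryHam_eq (h : Interaction n d k) (s : ℕ) :
    boundaryHam h a l₀ q s = ∑ Z ∈ boundarySets n a l₀ q s, h.term Z := rfl

theorem exists_sides_of_mem_boundarySets (hl : 0 < l₀) (ha : 0 < a) {s : ℕ} (hs : s ≤ q)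
    {Z : Finset (Fin n)} (hZ : Z ∈ boundarySets n a l₀ q s) :
    (∃ i ∈ Z, (i : ℕ) ≤ lastSite a l₀ s) ∧ ∃ i ∈ Z, lastSite a l₀ s < (i : ℕ) := by
  obtain ⟨-, ⟨i, hi, his⟩, j, hj, hjs⟩ := (mem_boundarySets_iff hl hs Z).1 hZ
  refine ⟨⟨i, hi, (le_lastSite_iff hl ha hs i).2 his.le⟩, j, hj, ?_⟩
  rw [← not_le, le_lastSite_iff hl ha hs]
  omega

theorem spans_of_mem_boundarySets (hl : 0 < l₀) (ha : 0 < a) {s : ℕ} (hs : s ≤ q)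
    {Z : Finset (Fin n)} (hZ : Z ∈ boundarySets n a l₀ q s) : Spans (lastSite a l₀ s) 1 Z :=
  exists_sides_of_mem_boundarySets hl ha hs hZ

theorem mem_middle_iff (hl : 0 < l₀) (i : Fin n) :
    i ∈ middle n a l₀ q ↔ 1 ≤ blockIndex a l₀ q i ∧ blockIndex a l₀ q i ≤ q := by
  simp only [middle, Finset.mem_biUnion, Finset.mem_Icc]
  constructor
  · rintro ⟨s, hs, hi⟩
    rw [mem_block_iff hl (by omega)] at hi
    omega
  · intro hi
    exact ⟨_, hi, (mem_block_iff hl (by omega) i).2 rfl⟩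

/-- The positions of a site of `B_1 ∪ ⋯ ∪ B_q` in terms of the index of its block. -/
theorem blockIndex_bounds (hl : 0 < l₀) {i s : ℕ} (hi : blockIndex a l₀ q i = s) (h1 : 1 ≤ s)
    (hq : s ≤ q) : a + (s - 1) * l₀ ≤ i ∧ i < a + s * l₀ := by
  obtain ⟨s, rfl⟩ : ∃ m, s = m + 1 := ⟨s - 1, by omega⟩
  have h1 : s ≤ (i - a) / l₀ ↔ s * l₀ ≤ i - a := Nat.le_div_iff_mul_le hl
  have h2 : (i - a) / l₀ < s + 1 ↔ i - a < (s + 1) * l₀ := Nat.div_lt_iff_lt_mul hl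
  simp only [blockIndex, Nat.add_sub_cancel] at *
  split_ifs at hi with h
  omega

theorem lt_add_of_inAdjacentBlocks (hl : 0 < l₀) {Z : Finset (Fin n)}
    (hZ : InAdjacentBlocks a l₀ q Z) {i j : Fin n} (hi : i ∈ Z) (hj : j ∈ Z)
    (him : i ∈ middle n a l₀ q) (hjm : j ∈ middle n a l₀ q) : (j : ℕ) < i + 2 * l₀ := by
  obtain ⟨s, hs, hZ⟩ := (inAdjacentBlocks_iff hl Z).1 hZ
  rw [mem_middle_iff hl] at him hjm
  have h1 := blockIndex_bounds hl rfl him.1 him.2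
  have h2 := blockIndex_bounds hl rfl hjm.1 hjm.2
  have h3 := hZ i hi
  have h4 := hZ j hj
  have h5 : blockIndex a l₀ q j ≤ blockIndex a l₀ q i - 1 + 2 := by omega
  have h6 := Nat.mul_le_mul_right l₀ h5
  rw [add_mul] at h6
  omega

end Decomposition

/-! ### Near, far, inside, outside and crossing terms, and the two site weights. -/

section Regions

open Classical

variable {n d k : ℕ} {a l₀ q s b r : ℕ}

/-- The terms of `h_s` supported within distance `r / 3` of the cut. -/
def nearSets (n a l₀ q s r : ℕ) : Finset (Finset (Fin n)) :=
  {X ∈ boundarySets n a l₀ q s | ∀ i ∈ X,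
    lastSite a l₀ s ≤ (i : ℕ) + r / 3 ∧ (i : ℕ) ≤ lastSite a l₀ s + r / 3}

/-- The other terms of `h_s`. -/
def farSets (n a l₀ q s r : ℕ) : Finset (Finset (Fin n)) :=
  {X ∈ boundarySets n a l₀ q s | ¬∀ i ∈ X,
    lastSite a l₀ s ≤ (i : ℕ) + r / 3 ∧ (i : ℕ) ≤ lastSite a l₀ s + r / 3}

/-- The one-sided terms supported in the window. -/
def insideSets (n a l₀ q b r : ℕ) : Finset (Finset (Fin n)) :=
  {Z ∈ halfSets n a l₀ q b | Z ⊆ window n b r}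

/-- The one-sided terms supported outside of the window. -/
def outsideSets (n a l₀ q b r : ℕ) : Finset (Finset (Fin n)) :=
  {Z ∈ halfSets n a l₀ q b | ¬Z ⊆ window n b r ∧ Disjoint Z (window n b r)}

/-- `Z` has distance at least `r / 3` from the sites within distance `⌊r / 3⌋` of `b`. -/
def Distant (b r : ℕ) (Z : Finset (Fin n)) : Prop :=
  (∀ z ∈ Z, 3 * ((z : ℕ) + r / 3) + r ≤ 3 * b) ∨ ∀ z ∈ Z, 3 * (b + r / 3) + r ≤ 3 * (z : ℕ)

/-- The one-sided terms that meet the window and its complement. -/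
def crossingSets (n a l₀ q b r : ℕ) : Finset (Finset (Fin n)) :=
  {Z ∈ halfSets n a l₀ q b | ¬Z ⊆ window n b r ∧ ¬Disjoint Z (window n b r)}

theorem sum_halfSets_eq (h : Interaction n d k) :
    ∑ Z ∈ halfSets n a l₀ q b, h.term Z = ∑ Z ∈ insideSets n a l₀ q b r, h.term Z
      + ∑ Z ∈ outsideSets n a l₀ q b r, h.term Z
      + (∑ Z ∈ crossingSets n a l₀ q b r with Distant b r Z, h.term Z
        + ∑ Z ∈ crossingSets n a l₀ q b r with ¬Distant b r Z, h.term Z) := by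
  rw [Finset.sum_filter_add_sum_filter_not, insideSets, outsideSets, crossingSets,
    ← Finset.sum_filter_add_sum_filter_not _ (fun Z => Z ⊆ window n b r), add_assoc]
  congr 1
  rw [← Finset.sum_filter_add_sum_filter_not _ (fun Z => Disjoint Z (window n b r)),
    Finset.filter_filter, Finset.filter_filter]

theorem sum_boundarySets_eq (h : Interaction n d k) :
    ∑ Z ∈ boundarySets n a l₀ q s, h.term Z = ∑ Z ∈ nearSets n a l₀ q s r, h.term Z
      + ∑ Z ∈ farSets n a l₀ q s r, h.term Z := by
  rw [nearSets, farSets, Finset.sum_filter_add_sum_filter_not]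

theorem mem_window_iff (i : Fin n) :
    i ∈ window n b r ↔ b ≤ (i : ℕ) + r ∧ (i : ℕ) ≤ b + r := by
  simp only [window, leftPart, rightPart, Finset.mem_union, Finset.mem_filter, Finset.mem_univ,
    true_and]
  omega

theorem mem_halfSets_iff {Z : Finset (Fin n)} : Z ∈ halfSets n a l₀ q b ↔
    Z.Nonempty ∧ InAdjacentBlocks a l₀ q Z ∧
      ((∀ i ∈ Z, (i : ℕ) ≤ b) ∨ ∀ i ∈ Z, b < (i : ℕ)) := by
  simp only [halfSets, Finset.mem_filter, Finset.mem_univ, true_and]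

/-- A crossing term contains sites on both sides of one of the ends of the window. -/
theorem exists_of_mem_crossingSets {Z : Finset (Fin n)} (hZ : Z ∈ crossingSets n a l₀ q b r) :
    ((∀ i ∈ Z, (i : ℕ) ≤ b) ∧ (∃ i ∈ Z, (i : ℕ) + r < b) ∧ ∃ i ∈ Z, b ≤ (i : ℕ) + r) ∨
    ((∀ i ∈ Z, b < (i : ℕ)) ∧ (∃ i ∈ Z, b + r < (i : ℕ)) ∧ ∃ i ∈ Z, (i : ℕ) ≤ b + r) := by
  simp only [crossingSets, Finset.mem_filter, mem_halfSets_iff] at hZ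
  obtain ⟨⟨-, -, hside⟩, hsub, hdis⟩ := hZ
  obtain ⟨i, hi, hiw⟩ := Finset.not_subset.1 hsub
  obtain ⟨j, hj, hjw⟩ := Finset.not_disjoint_iff.1 hdis
  rw [mem_window_iff] at hiw hjw
  rcases hside with h | h
  · have := h i hi
    exact .inl ⟨h, ⟨i, hi, by omega⟩, j, hj, hjw.1⟩
  · have := h i hi
    exact .inr ⟨h, ⟨i, hi, by omega⟩, j, hj, hjw.2⟩

/-- In the left case the site with `i + r < b` ensures that `b - r - 1` is not truncated. -/
theorem spans_of_mem_crossingSets {Z : Finset (Fin n)} (hZ : Z ∈ crossingSets n a l₀ q b r) :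
    Spans (b - r - 1) 1 Z ∨ Spans (b + r) 1 Z := by
  rcases exists_of_mem_crossingSets hZ with ⟨-, ⟨i, hi, hi'⟩, j, hj, hj'⟩ | ⟨-, ⟨i, hi, hi'⟩, j, hj, hj'⟩
  · exact .inl ⟨⟨i, hi, by omega⟩, j, hj, by omega⟩
  · exact .inr ⟨⟨j, hj, hj'⟩, i, hi, by omega⟩

/-- Such a term has a site beyond the end of the window, at distance `r` from the cut, and another
one within about `2r/3` of the cut. -/
theorem spans_of_not_distant {Z : Finset (Fin n)} (hZ : Z ∈ crossingSets n a l₀ q b r)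
    (hd : ¬Distant b r Z) :
    Spans (b - r - 1) (r / 3) Z ∨ Spans (b + r + 1 - r / 3) (r / 3) Z := by
  simp only [Distant, not_or, not_forall, not_le] at hd
  obtain ⟨⟨z, hz, hz'⟩, w, hw, hw'⟩ := hd
  rcases exists_of_mem_crossingSets hZ with ⟨-, ⟨i, hi, hi'⟩, -⟩ | ⟨-, ⟨i, hi, hi'⟩, -⟩
  · exact .inl ⟨⟨i, hi, by omega⟩, z, hz, by omega⟩
  · exact .inr ⟨⟨w, hw, by omega⟩, i, hi, by omega⟩

theorem spans_of_mem_farSets (hl : 0 < l₀) (ha : 0 < a) (hs : s ≤ q) {Z : Finset (Fin n)}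
    (hZ : Z ∈ farSets n a l₀ q s r) :
    Spans (lastSite a l₀ s - r / 3 - 1) (r / 3) Z ∨ Spans (lastSite a l₀ s) (r / 3) Z := by
  simp only [farSets, Finset.mem_filter, not_forall] at hZ
  obtain ⟨hZ, i, hi, hi'⟩ := hZ
  obtain ⟨⟨x, hx, hx'⟩, y, hy, hy'⟩ := exists_sides_of_mem_boundarySets hl ha hs hZ
  rcases lt_or_ge ((i : ℕ) + r / 3) (lastSite a l₀ s) with h | h
  · exact .inl ⟨⟨i, hi, by omega⟩, y, hy, by omega⟩
  · exact .inr ⟨⟨x, hx, hx'⟩, i, hi, by omega⟩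

theorem sum_le_of_forall_or {ι : Type*} {f : ι → ℝ} {B : ℝ} (S : Finset ι) {P Q : ι → Prop}
    (hPQ : ∀ Z ∈ S, P Z ∨ Q Z) (hP : ∀ T : Finset ι, (∀ Z ∈ T, P Z) → ∑ Z ∈ T, f Z ≤ B)
    (hQ : ∀ T : Finset ι, (∀ Z ∈ T, Q Z) → ∑ Z ∈ T, f Z ≤ B) : ∑ Z ∈ S, f Z ≤ 2 * B := by
  rw [← Finset.sum_filter_add_sum_filter_not S P, two_mul]
  refine add_le_add (hP _ fun Z hZ => (Finset.mem_filter.1 hZ).2) (hQ _ fun Z hZ => ?_)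
  obtain ⟨hZ, hn⟩ := Finset.mem_filter.1 hZ
  exact (hPQ Z hZ).resolve_left hn

variable {γ g : ℝ} {J : ℕ → ℝ} {h : Interaction n d k}

theorem HasDecay.sum_norm_le_of_spans_or (hh : HasDecay h g J) (hJ : IsDecay γ J) (hg : 0 ≤ g)
    {l : ℕ} (hl : 1 ≤ l) {p p' : ℕ} (S : Finset (Finset (Fin n)))
    (hS : ∀ Z ∈ S, Spans p l Z ∨ Spans p' l Z) :
    ∑ Z ∈ S, ‖h.term Z‖ ≤ 2 * (g * (γ * (l : ℝ) ^ 2 * J l)) :=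
  sum_le_of_forall_or S hS (hh.sum_norm_le_of_spans hJ hg hl p)
    (hh.sum_norm_le_of_spans hJ hg hl p')

theorem HasDecay.sum_norm_boundarySets_le (hh : HasDecay h g J) (hJ : IsDecay γ J) (hg : 0 ≤ g)
    (hl : 0 < l₀) (ha : 0 < a) (hs : s ≤ q) :
    ∑ Z ∈ boundarySets n a l₀ q s, ‖h.term Z‖ ≤ g * γ * J 1 := by
  refine (hh.sum_norm_le_of_spans hJ hg le_rfl _ _
    fun Z hZ => spans_of_mem_boundarySets hl ha hs hZ).trans (le_of_eq ?_)
  simp only [Nat.cast_one]; ring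

theorem HasDecay.norm_boundaryHam_le (hh : HasDecay h g J) (hJ : IsDecay γ J) (hg : 0 ≤ g)
    (hl : 0 < l₀) (ha : 0 < a) (hs : s ≤ q) : ‖boundaryHam h a l₀ q s‖ ≤ g * γ * J 1 :=
  (norm_sum_le _ _).trans (hh.sum_norm_boundarySets_le hJ hg hl ha hs)

/-- The site weights of the Lieb–Robinson bound for the evolution in the window: `M` is the decay
over the distance `r / 3` and `κ` the velocity. -/
def HasWeights (h : Interaction n d k) (a l₀ q s r : ℕ) (κ M : ℝ) : Prop :=
  ∀ c : Finset (Fin n) → ℝ, (∀ Y, |c Y| ≤ 1) →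
    (∀ Y, c Y ≠ 0 → Y ⊆ window n (lastSite a l₀ s) r ∧ InAdjacentBlocks a l₀ q Y) →
    ∀ Z : Finset (Fin n), Z.Nonempty → Distant (lastSite a l₀ s) r Z →
    ∃ w : Fin n → ℝ, (∀ x, 0 ≤ w x) ∧ (∀ z ∈ Z, 1 ≤ w z) ∧
      (∀ x, ∑ Y with x ∈ Y, |c Y| * (‖h.term Y‖ * ∑ y ∈ Y, w y) ≤ κ * w x) ∧
      ∀ X ∈ nearSets n a l₀ q s r, ∀ x ∈ X, w x ≤ M * Z.card

/-- Sites of near terms have distance at least `⌊r/3⌋` from every `z ∈ Z`, so each summand of the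
weight is at most `J(⌊r/3⌋)`. -/
theorem hasWeights_decay (hh : HasDecay h g J) (hJ : IsDecay γ J) (hg : 0 ≤ g) {𝔤 : ℝ}
    (h𝔤 : 𝔤 ∈ convConsts n J) : HasWeights h a l₀ q s r (g * 𝔤) (J (r / 3)) := by
  intro c hc _ Z _ hZ
  refine ⟨fun x => ∑ z ∈ Z, J (Nat.dist x z), fun x => Finset.sum_nonneg fun z _ => hJ.nonneg _,
    fun z hz => ?_, hh.sum_weight_le hJ hg h𝔤 hc Z, fun X hX x hx => ?_⟩
  · have := Finset.single_le_sum (f := fun y : Fin n => J (Nat.dist z y))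
      (fun y _ => hJ.nonneg _) hz
    simpa [hJ.zero] using this
  · rw [mul_comm, ← nsmul_eq_mul]
    refine Finset.sum_le_card_nsmul _ _ _ fun z hz => hJ.anti ?_
    have h1 := (Finset.mem_filter.1 hX).2 x hx
    rw [Nat.dist]
    rcases hZ with hZ | hZ <;> have := hZ z hz <;> omega

/-- The weight is `exp(-δ/(2l₀))` with `δ` 1-Lipschitz, nonpositive on `Z` and at least `r/3` on the
near terms. The terms in the window join sites less than `2l₀` apart, so they change it by at most a
factor `e`. -/
theorem hasWeights_exp (hh : HasDecay h g J) (hJ : IsDecay γ J) (hl : 0 < l₀)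
    (hmid : window n (lastSite a l₀ s) r ⊆ middle n a l₀ q) :
    HasWeights h a l₀ q s r (Real.exp 1 * g * k) (Real.exp (-((r : ℝ) / 3) / (2 * l₀))) := by
  intro c hc hsupp Z hZne hZ
  have hl' : (0 : ℝ) < l₀ := by exact_mod_cast hl
  have hcard : (1 : ℝ) ≤ Z.card := by exact_mod_cast hZne.card_pos
  set b := lastSite a l₀ s with hb
  have key : ∀ δ : Fin n → ℝ, (∀ x y : Fin n, δ x - δ y ≤ |(x : ℝ) - y|) → (∀ z ∈ Z, δ z ≤ 0) →
      (∀ X ∈ nearSets n a l₀ q s r, ∀ x ∈ X, (r : ℝ) / 3 ≤ δ x) →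
      ∃ w : Fin n → ℝ, (∀ x, 0 ≤ w x) ∧ (∀ z ∈ Z, 1 ≤ w z) ∧
        (∀ x, ∑ Y with x ∈ Y, |c Y| * (‖h.term Y‖ * ∑ y ∈ Y, w y)
          ≤ Real.exp 1 * g * k * w x) ∧
        ∀ X ∈ nearSets n a l₀ q s r, ∀ x ∈ X,
          w x ≤ Real.exp (-((r : ℝ) / 3) / (2 * l₀)) * Z.card := by
    intro δ hlip hδZ hδX
    refine ⟨fun x => Real.exp (-δ x / (2 * l₀)), fun x => (Real.exp_pos _).le, fun z hz => ?_,
      hh.sum_weight_exp_le hJ hc (fun x => (Real.exp_pos _).le) (Real.exp_pos 1).le ?_,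
      fun X hX x hx => ?_⟩
    · rw [Real.one_le_exp_iff]
      have := hδZ z hz
      exact div_nonneg (by linarith) (by positivity)
    · intro Y hY x hx y hy
      obtain ⟨hw, hadj⟩ := hsupp Y hY
      have h1 := lt_add_of_inAdjacentBlocks hl hadj hx hy (hmid (hw hx)) (hmid (hw hy))
      have h2 := lt_add_of_inAdjacentBlocks hl hadj hy hx (hmid (hw hy)) (hmid (hw hx))
      have h3 : |(x : ℝ) - y| ≤ 2 * l₀ := by
        rw [abs_le]
        have h1' : ((y : ℕ) : ℝ) < x + 2 * l₀ := by exact_mod_cast h1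
        have h2' : ((x : ℕ) : ℝ) < y + 2 * l₀ := by exact_mod_cast h2
        constructor <;> linarith
      rw [← Real.exp_add]
      refine Real.exp_le_exp.2 ?_
      rw [div_le_iff₀ (by positivity), add_mul, div_mul_cancel₀ _ (by positivity)]
      have := hlip x y
      linarith
    · refine le_trans (Real.exp_le_exp.2 ?_) (le_mul_of_one_le_right (Real.exp_pos _).le hcard)
      have := hδX X hX x hx
      gcongr
  have hR : 3 * (r / 3) ≤ r := by omega
  rcases hZ with hZ | hZ
  -- As `Z` lies on one side of the cut, `δ` can be the signed distance to the point `b - ⌊r/3⌋ -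
  -- r/3`, and likewise on the right.
  · refine key (fun x => (x : ℝ) - (b - (r / 3 : ℕ) - (r : ℝ) / 3)) (fun x y => ?_)
      (fun z hz => ?_) fun X hX x hx => ?_
    · have := le_abs_self ((x : ℝ) - y); linarith
    · have h1 : ((3 * ((z : ℕ) + r / 3) + r : ℕ) : ℝ) ≤ ((3 * b : ℕ) : ℝ) := by
        exact_mod_cast hZ z hz
      push_cast at h1
      linarith
    · have h1 : ((b : ℕ) : ℝ) ≤ ((x + r / 3 : ℕ) : ℝ) := by
        exact_mod_cast ((Finset.mem_filter.1 hX).2 x hx).1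
      push_cast at h1
      linarith
  · refine key (fun x => (b + (r / 3 : ℕ) + (r : ℝ) / 3) - (x : ℝ)) (fun x y => ?_)
      (fun z hz => ?_) fun X hX x hx => ?_
    · have := neg_abs_le ((x : ℝ) - y); linarith
    · have h1 : ((3 * (b + r / 3) + r : ℕ) : ℝ) ≤ ((3 * (z : ℕ) : ℕ) : ℝ) := by
        exact_mod_cast hZ z hz
      push_cast at h1
      linarith
    · have h1 : ((x : ℕ) : ℝ) ≤ ((b + r / 3 : ℕ) : ℝ) := by
        exact_mod_cast ((Finset.mem_filter.1 hX).2 x hx).2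
      push_cast at h1
      linarith

end Regions

/-! ### Localization error of the evolution and of the belief propagation operators. -/

section LocalEvolution

open Classical MeasureTheory

variable {n d k : ℕ} {a l₀ q s r : ℕ} {γ g : ℝ} {J : ℕ → ℝ} {h : Interaction n d k}

theorem isSelfAdjoint_algebraMap_of_eq {A : Type*} [CStarAlgebra A] {X Y : A} {c : ℂ}
    (hX : IsSelfAdjoint X) (hY : IsSelfAdjoint Y) (e : X = algebraMap ℂ A c + Y) :
    IsSelfAdjoint (algebraMap ℂ A c) := by
  have : algebraMap ℂ A c = X - Y := by rw [e]; abel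
  rw [this]
  exact hX.sub hY

theorem Interaction.isSelfAdjoint_sum (h : Interaction n d k) (S : Finset (Finset (Fin n))) :
    IsSelfAdjoint (∑ Z ∈ S, h.term Z) := _root_.isSelfAdjoint_sum S fun Z _ => h.isSelfAdjoint Z

theorem isSelfAdjoint_blockHam (h : Interaction n d k) (s : ℕ) :
    IsSelfAdjoint (blockHam h a l₀ q s) := h.isSelfAdjoint_sum _

theorem isSelfAdjoint_boundaryHam (h : Interaction n d k) (s : ℕ) :
    IsSelfAdjoint (boundaryHam h a l₀ q s) := h.isSelfAdjoint_sum _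

theorem isSelfAdjoint_hamLE_add_hamGT (h : Interaction n d k) (s : ℕ) :
    IsSelfAdjoint (hamLE h a l₀ q s + hamGT h a l₀ q s) :=
  ((_root_.isSelfAdjoint_sum _ fun _ _ => isSelfAdjoint_blockHam h _).add
    (_root_.isSelfAdjoint_sum _ fun _ _ => isSelfAdjoint_boundaryHam h _)).add
  ((_root_.isSelfAdjoint_sum _ fun _ _ => isSelfAdjoint_blockHam h _).add
    (_root_.isSelfAdjoint_sum _ fun _ _ => isSelfAdjoint_boundaryHam h _))

theorem isSelfAdjoint_ofReal_smul {A : Type*} [CStarAlgebra A] {X : A} (hX : IsSelfAdjoint X)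
    (τ : ℝ) : IsSelfAdjoint ((τ : ℂ) • X) := IsSelfAdjoint.smul (Complex.conj_ofReal τ) hX

theorem isSelfAdjoint_hamTau (h : Interaction n d k) (s : ℕ) (τ : ℝ) :
    IsSelfAdjoint (hamTau h a l₀ q s τ) :=
  (isSelfAdjoint_hamLE_add_hamGT h s).add
    (isSelfAdjoint_ofReal_smul (isSelfAdjoint_boundaryHam h s) τ)

theorem isSelfAdjoint_subsetHam (h : Interaction n d k) (L : Finset (Fin n)) :
    IsSelfAdjoint (subsetHam h a l₀ q L) := h.isSelfAdjoint_sum _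

theorem isSelfAdjoint_hamTauLocal (h : Interaction n d k) (s r : ℕ) (τ : ℝ) :
    IsSelfAdjoint (hamTauLocal h a l₀ q s r τ) :=
  ((isSelfAdjoint_subsetHam h _).add (isSelfAdjoint_subsetHam h _)).add
    (isSelfAdjoint_ofReal_smul (isSelfAdjoint_boundaryHam h s) τ)

theorem halfBounded_boundaryHam (h : Interaction n d k) (s : ℕ) :
    HalfBounded (boundaryHam h a l₀ q s) := h.halfBounded_sum _

/-- The terms of the crossing sets which are not close to the near sets. -/
theorem mem_window_of_mem_nearSets {X : Finset (Fin n)} (hX : X ∈ nearSets n a l₀ q s r) :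
    X ⊆ window n (lastSite a l₀ s) r := fun i hi => by
  have := (Finset.mem_filter.1 hX).2 i hi
  rw [mem_window_iff]
  omega

theorem disjoint_of_mem_nearSets (hr : 0 < r) {X Z : Finset (Fin n)}
    (hX : X ∈ nearSets n a l₀ q s r) (hZ : Distant (lastSite a l₀ s) r Z) : Disjoint X Z := by
  rw [Finset.disjoint_left]
  intro i hi hiZ
  have := (Finset.mem_filter.1 hX).2 i hi
  rcases hZ with hZ | hZ <;> have := hZ i hiZ <;> omega

theorem not_mem_insideSets_of_mem_nearSets (hl : 0 < l₀) (ha : 0 < a) (hs : s ≤ q)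
    {X : Finset (Fin n)} (hX : X ∈ nearSets n a l₀ q s r) :
    X ∉ insideSets n a l₀ q (lastSite a l₀ s) r := fun hX' => by
  obtain ⟨⟨i, hi, hi'⟩, j, hj, hj'⟩ :=
    exists_sides_of_mem_boundarySets hl ha hs (Finset.mem_filter.1 hX).1
  rcases (mem_halfSets_iff.1 (Finset.mem_filter.1 hX').1).2.2 with h1 | h1
  · have := h1 j hj; omega
  · have := h1 i hi; omega

/-- The coefficients of the Hamiltonian which generates the evolution inside the window. -/
def localCoeff (n a l₀ q s r : ℕ) (ε τ : ℝ) (Y : Finset (Fin n)) : ℝ :=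
  ε * ((if Y ∈ insideSets n a l₀ q (lastSite a l₀ s) r then 1 else 0)
    + τ * if Y ∈ nearSets n a l₀ q s r then 1 else 0)

theorem weightedHam_localCoeff (h : Interaction n d k) (ε τ : ℝ) :
    weightedHam h (localCoeff n a l₀ q s r ε τ)
      = (ε : ℂ) • (∑ Z ∈ insideSets n a l₀ q (lastSite a l₀ s) r, h.term Z
        + (τ : ℂ) • ∑ Z ∈ nearSets n a l₀ q s r, h.term Z) := by
  have e : ∀ S : Finset (Finset (Fin n)), ∑ Z ∈ S, h.term Z
      = ∑ Z, (if Z ∈ S then (1 : ℂ) else 0) • h.term Z := fun S => by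
    simp only [ite_smul, one_smul, zero_smul]
    rw [Finset.sum_ite_mem, Finset.univ_inter]
  rw [e, e, weightedHam, Finset.smul_sum, ← Finset.sum_add_distrib, Finset.smul_sum]
  refine Finset.sum_congr rfl fun Z _ => ?_
  rw [smul_smul, ← add_smul, smul_smul, localCoeff]
  congr 1
  push_cast
  split_ifs <;> simp

/-- Near terms straddle the cut once, which gives `U` and `2U`; crossing terms straddle one of two
window ends, which doubles both. Inside and near supports are disjoint families, so the coefficients
are at most `1` in absolute value. -/
theorem norm_comm_crossing_le (hh : HasDecay h g J) (hJ : IsDecay γ J) (hg : 0 ≤ g)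
    (hl : 0 < l₀) (ha : 0 < a) (hs : s ≤ q) (hr : 0 < r) {κ M : ℝ} (hκ : 0 ≤ κ) (hM : 0 ≤ M)
    (hw : HasWeights h a l₀ q s r κ M) {ε τ : ℝ} (hε : |ε| = 1) (hτ : τ ∈ Set.Icc (0 : ℝ) 1)
    {t : ℝ} (ht : 0 ≤ t) :
    ‖comm (∑ Z ∈ crossingSets n a l₀ q (lastSite a l₀ s) r with Distant (lastSite a l₀ s) r Z,
        h.term Z) (heis (weightedHam h (localCoeff n a l₀ q s r ε τ))
          (∑ X ∈ nearSets n a l₀ q s r, h.term X) t)‖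
      ≤ (g * γ * J 1) ^ 2 * min 1 (4 * M * (Real.exp (κ * t) - 1)) := by
  have e1 : g * γ * J 1 = g * (γ * ((1 : ℕ) : ℝ) ^ 2 * J 1) := by simp only [Nat.cast_one]; ring
  have e2 : g * γ * J 1 = g * (γ * J 1) := by ring
  have hsub : nearSets n a l₀ q s r ⊆ boundarySets n a l₀ q s := Finset.filter_subset _ _
  refine norm_comm_sum_heis_sum_le h hM hκ ?_ ?_ ?_ ?_ (fun Z hZ X hX => ?_) (fun Z hZ => ?_) ht
  · rw [e1]
    exact hh.sum_norm_le_of_spans_or hJ hg le_rfl _ fun Z hZ =>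
      spans_of_mem_crossingSets (Finset.mem_filter.1 hZ).1
  · exact (Finset.sum_le_sum_of_subset_of_nonneg hsub fun _ _ _ => norm_nonneg _).trans
      (hh.sum_norm_boundarySets_le hJ hg hl ha hs)
  · refine (sum_le_of_forall_or _ (fun Z hZ => spans_of_mem_crossingSets (Finset.mem_filter.1 hZ).1)
      (fun T hT => hh.sum_norm_mul_card_le_of_spans hJ hg _ T hT)
      (fun T hT => hh.sum_norm_mul_card_le_of_spans hJ hg _ T hT)).trans (le_of_eq ?_)
    ring
  · rw [e2]
    exact hh.sum_norm_mul_card_le_of_spans hJ hg _ _ fun Z hZ =>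
      spans_of_mem_boundarySets hl ha hs (hsub hZ)
  · exact disjoint_of_mem_nearSets hr hX (Finset.mem_filter.1 hZ).2
  · obtain ⟨hZc, hZd⟩ := Finset.mem_filter.1 hZ
    refine hw _ (fun Y => ?_) (fun Y hY => ?_) Z
      (mem_halfSets_iff.1 (Finset.mem_filter.1 hZc).1).1 hZd
    · rw [localCoeff, abs_mul, hε, one_mul]
      by_cases hY : Y ∈ nearSets n a l₀ q s r
      · rw [if_neg (not_mem_insideSets_of_mem_nearSets hl ha hs hY), if_pos hY, zero_add, mul_one,
          abs_of_nonneg hτ.1]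
        exact hτ.2
      · rw [if_neg hY, mul_zero, add_zero]
        split_ifs <;> simp
    · by_cases h1 : Y ∈ insideSets n a l₀ q (lastSite a l₀ s) r
      · obtain ⟨h2, h3⟩ := Finset.mem_filter.1 h1
        exact ⟨h3, (mem_halfSets_iff.1 h2).2.1⟩
      · by_cases h2 : Y ∈ nearSets n a l₀ q s r
        · refine ⟨mem_window_of_mem_nearSets h2, (inAdjacentBlocks_iff hl Y).2 ⟨s, hs, ?_⟩⟩
          exact ((mem_boundarySets_iff hl hs Y).1 (hsub h2)).1
        · exact absurd (by simp [localCoeff, h1, h2]) hY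

/-- The common generator is `K + τN`; the perturbations are `V + G + τF` and `τF` up to scalars.
Each of `G`, `τF`, `τF` costs `TU/2` per unit time (times `τ` for the last two), whence `1 + 2τ`,
and `V` costs the interpolated Lieb–Robinson bound. -/
theorem norm_heis_hamTau_sub_le (hh : HasDecay h g J) (hJ : IsDecay γ J) (hg : 0 ≤ g)
    (hl : 0 < l₀) (ha : 0 < a) (hs : s ≤ q) (hr : 0 < r) {κ M α A₀ T : ℝ} (hκ : 0 ≤ κ)
    (hM : 0 ≤ M) (hw : HasWeights h a l₀ q s r κ M) (hα : 0 < α)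
    (hA : ∀ s : ℝ, 0 ≤ s → min 1 (4 * M * (Real.exp (κ * s) - 1)) ≤ A₀ * Real.exp (α * s))
    (hF : ‖∑ Z ∈ farSets n a l₀ q s r, h.term Z‖ ≤ T)
    (hG : ‖∑ Z ∈ crossingSets n a l₀ q (lastSite a l₀ s) r with ¬Distant (lastSite a l₀ s) r Z,
      h.term Z‖ ≤ T) {τ : ℝ} (hτ : τ ∈ Set.Icc (0 : ℝ) 1) (t : ℝ) :
    ‖heis (hamTau h a l₀ q s τ) (boundaryHam h a l₀ q s) t
      - heis (hamTauLocal h a l₀ q s r τ) (boundaryHam h a l₀ q s) t‖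
      ≤ T + (1 + 2 * τ) * (T * (g * γ * J 1) / 2) * |t|
        + (g * γ * J 1) ^ 2 * A₀ * ((Real.exp (α * |t|) - 1) / α) := by
  obtain ⟨c, hc⟩ := exists_hamLE_add_hamGT h hl ha hs
  obtain ⟨c', hc'⟩ := exists_subsetHam_add_subsetHam (a := a) (l₀ := l₀) (q := q) h
    (lastSite a l₀ s) r
  have hsc := isSelfAdjoint_algebraMap_of_eq (isSelfAdjoint_hamLE_add_hamGT h s)
    (h.isSelfAdjoint_sum _) hc
  have hsc' := isSelfAdjoint_algebraMap_of_eq ((isSelfAdjoint_subsetHam h _).add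
    (isSelfAdjoint_subsetHam h _)) (h.isSelfAdjoint_sum _) hc'
  have hcross := fun (ε : ℝ) (hε : |ε| = 1) (t : ℝ) (ht : 0 ≤ t) =>
    norm_comm_crossing_le hh hJ hg hl ha hs hr hκ hM hw hε hτ ht
  simp only [weightedHam_localCoeff] at hcross
  rw [hamTau, hamTauLocal, hc, hc', boundaryHam_eq, sum_boundarySets_eq (r := r),
    sum_halfSets_eq (r := r)]
  change ‖heis (_ + (_ + _ + _) + _) _ _ -
    heis (algebraMap ℂ (Op n d) c' + ∑ Z ∈ insideSets n a l₀ q (lastSite a l₀ s) r, h.term Z + _)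
      _ _‖ ≤ _
  have hNU : ‖∑ Z ∈ nearSets n a l₀ q s r, h.term Z‖ ≤ g * γ * J 1 :=
    (norm_sum_le _ _).trans ((Finset.sum_le_sum_of_subset_of_nonneg (Finset.filter_subset _ _)
      fun _ _ _ => norm_nonneg _).trans (hh.sum_norm_boundarySets_le hJ hg hl ha hs))
  have hsF := h.isSelfAdjoint_sum (farSets n a l₀ q s r)
  have hsN := h.isSelfAdjoint_sum (nearSets n a l₀ q s r)
  have hsK := h.isSelfAdjoint_sum (insideSets n a l₀ q (lastSite a l₀ s) r)
  have hsO := h.isSelfAdjoint_sum (outsideSets n a l₀ q (lastSite a l₀ s) r)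
  have hsV := h.isSelfAdjoint_sum ((crossingSets n a l₀ q (lastSite a l₀ s) r).filter
    fun Z => Distant (lastSite a l₀ s) r Z)
  have hsG := h.isSelfAdjoint_sum ((crossingSets n a l₀ q (lastSite a l₀ s) r).filter
    fun Z => ¬Distant (lastSite a l₀ s) r Z)
  have hbF := h.halfBounded_sum (farSets n a l₀ q s r)
  have hbN := h.halfBounded_sum (nearSets n a l₀ q s r)
  have hbG := h.halfBounded_sum ((crossingSets n a l₀ q (lastSite a l₀ s) r).filter
    fun Z => ¬Distant (lastSite a l₀ s) r Z)
  have hON : ∀ {S : Finset (Finset (Fin n))},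
      (∀ X ∈ S, X ⊆ window n (lastSite a l₀ s) r) →
      Commute (∑ Z ∈ outsideSets n a l₀ q (lastSite a l₀ s) r, h.term Z)
        (∑ Z ∈ S, h.term Z) := fun {S} hS =>
    Commute.sum_left _ _ _ fun Z hZ => Commute.sum_right _ _ _ fun X hX =>
      h.commute ((Finset.mem_filter.1 hZ).2.2.mono_right (hS X hX))
  have hcON := hON (S := nearSets n a l₀ q s r) fun X hX => mem_window_of_mem_nearSets hX
  have hcOK := hON (S := insideSets n a l₀ q (lastSite a l₀ s) r)
    fun X hX => (Finset.mem_filter.1 hX).2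
  -- From here on only norms, self-adjointness and commutation of the pieces matter.
  generalize ∑ Z ∈ farSets n a l₀ q s r, h.term Z = F at *
  generalize ∑ Z ∈ nearSets n a l₀ q s r, h.term Z = N at *
  generalize ∑ Z ∈ insideSets n a l₀ q (lastSite a l₀ s) r, h.term Z = K at *
  generalize ∑ Z ∈ outsideSets n a l₀ q (lastSite a l₀ s) r, h.term Z = O at *
  generalize ∑ Z ∈ crossingSets n a l₀ q (lastSite a l₀ s) r with
    Distant (lastSite a l₀ s) r Z, h.term Z = V at *
  generalize ∑ Z ∈ crossingSets n a l₀ q (lastSite a l₀ s) r with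
    ¬Distant (lastSite a l₀ s) r Z, h.term Z = G at *
  set U := g * γ * J 1 with hU
  have hU0 : 0 ≤ U := (norm_nonneg _).trans hNU
  have hT0 : 0 ≤ T := (norm_nonneg _).trans hF
  have eH : algebraMap ℂ (Op n d) c + (K + O + (V + G)) + (τ : ℂ) • (N + F)
      = (K + (τ : ℂ) • N) + O + (V + (G + ((τ : ℂ) • F + algebraMap ℂ (Op n d) c))) := by
    rw [smul_add]; abel
  have eH' : algebraMap ℂ (Op n d) c' + K + (τ : ℂ) • (N + F)
      = (K + (τ : ℂ) • N) + ((τ : ℂ) • F + algebraMap ℂ (Op n d) c') := by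
    rw [smul_add]; abel
  have hsK' : IsSelfAdjoint (K + (τ : ℂ) • N) := hsK.add (isSelfAdjoint_ofReal_smul hsN τ)
  have hsP : ∀ P, P = K + (τ : ℂ) • N ∨ P = -(K + (τ : ℂ) • N) → IsSelfAdjoint P := by
    rintro P (rfl | rfl)
    exacts [hsK', hsK'.neg]
  have hhalf : ∀ B : Op n d, HalfBounded B → ‖B‖ ≤ T → ∀ P, IsSelfAdjoint P → ∀ s : ℝ,
      ‖comm B (heis P N s)‖ ≤ T * U / 2 := fun B hB hBT P hP s => by
    refine (hB.norm_comm_le_half (hbN.heis hP s)).trans ?_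
    rw [norm_heis hP]
    gcongr
  have hτF : ∀ (z : ℂ) P, IsSelfAdjoint P → ∀ s : ℝ,
      ‖comm ((τ : ℂ) • F + algebraMap ℂ (Op n d) z) (heis P N s)‖ ≤ τ * (T * U / 2) :=
      fun z P hP s => by
    rw [comm_add_left, comm_algebraMap_left, add_zero, comm_smul_left, norm_smul,
      Complex.norm_real, Real.norm_eq_abs, abs_of_nonneg hτ.1]
    exact mul_le_mul_of_nonneg_left (hhalf F hbF hF P hP s) hτ.1
  have hmain := norm_heis_add_sub_le (C₁ := (1 + τ) * (T * U / 2)) (C₂ := τ * (T * U / 2))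
    (A₀ := U ^ 2 * A₀) (α := α) hsK' hsO
    (hsV.add (hsG.add ((isSelfAdjoint_ofReal_smul hsF τ).add hsc)))
    ((isSelfAdjoint_ofReal_smul hsF τ).add hsc') hbF
    (hcOK.symm.add_left (hcON.symm.smul_left _)) hcON hα.ne' (fun P hP s hs => ?_)
    (fun P hP s _ => hτF c' P (hsP P hP) s) t
  · rw [eH, eH']
    refine hmain.trans ?_
    have : (1 + τ) * (T * U / 2) + τ * (T * U / 2) = (1 + 2 * τ) * (T * U / 2) := by ring
    rw [this]
    gcongr
  · rw [comm_add_left, comm_add_left]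
    have h1 := hhalf G hbG hG P (hsP P hP) s
    have h2 := hτF c P (hsP P hP) s
    have h3 : ‖comm V (heis P N s)‖ ≤ U ^ 2 * (A₀ * Real.exp (α * s)) := by
      refine le_trans ?_ (mul_le_mul_of_nonneg_left (hA s hs) (sq_nonneg U))
      rcases hP with rfl | rfl
      · have := hcross 1 (by simp) s hs
        rwa [Complex.ofReal_one, one_smul] at this
      · have := hcross (-1) (by simp) s hs
        rwa [Complex.ofReal_neg, Complex.ofReal_one, neg_smul, one_smul] at this
    refine (norm_add_le _ _).trans ((add_le_add h3 ((norm_add_le _ _).trans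
      (add_le_add h1 h2))).trans (le_of_eq ?_))
    ring

/-- Integrates the previous bound against `f_β` and over `τ`, where `1 + 2τ` averages to `2`. The
constant `14` exceeds `8.65 / (1 - 0.34)`. -/
theorem norm_Phi_sub_PhiLocal_le (hh : HasDecay h g J) (hJ : IsDecay γ J) (hg : 0 ≤ g)
    (hl : 0 < l₀) (ha : 0 < a) (hs : s ≤ q) (hr : 0 < r) {β κ M v T : ℝ} (hβ : 0 < β)
    (hκ : 0 < κ) (hv : 0 < v) (hκv : κ ≤ Real.exp 1 / 2 * v)
    (hM : 0 ≤ M) (hw : HasWeights h a l₀ q s r κ M)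
    (hF : ‖∑ Z ∈ farSets n a l₀ q s r, h.term Z‖ ≤ T)
    (hG : ‖∑ Z ∈ crossingSets n a l₀ q (lastSite a l₀ s) r with ¬Distant (lastSite a l₀ s) r Z,
      h.term Z‖ ≤ T) :
    ‖Phi h a l₀ q β s - PhiLocal h a l₀ q β s r‖ ≤ Real.exp (β * (g * γ * J 1) / 2) *
      (β / 2 * T + β ^ 2 / (2 * Real.pi ^ 3) * (9 * T * (g * γ * J 1)
        + (g * γ * J 1) ^ 2 * (14 * (√M + 4 * M ^ (Real.pi / (4 * v * β)))))) := by
  have hπ := Real.pi_pos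
  obtain ⟨α, A₀, hα, hαβ, hA0, hA1, hA⟩ := exists_exp_bound hβ hv hκ hκv hM
  have hT0 : 0 ≤ T := (norm_nonneg _).trans hF
  have hUb := hh.norm_boundaryHam_le (a := a) (q := q) (s := s) hJ hg hl ha hs
  set U := g * γ * J 1 with hU
  have hU0 : 0 ≤ U := (norm_nonneg _).trans hUb
  have hα1 : α * β / Real.pi < 1 := hαβ.trans_lt (by norm_num)
  have hcH : Continuous fun τ : ℝ => hamTau h a l₀ q s τ :=
    continuous_const.add (Complex.continuous_ofReal.smul continuous_const)
  have hcL : Continuous fun τ : ℝ => hamTauLocal h a l₀ q s r τ :=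
    continuous_const.add (Complex.continuous_ofReal.smul continuous_const)
  have hI1 := integrable_fBeta hβ
  have hI2 := integrable_fBeta_mul_abs hβ
  have hI3 := integrable_fBeta_mul_exp_sub_one hβ hα hα1
  have hint2 := integral_fBeta_mul_abs_le hβ
  have hint3 : ∫ t, fBeta β t * ((Real.exp (α * |t|) - 1) / α) ≤ 14 * β / Real.pi ^ 3 := by
    refine (integral_fBeta_mul_exp_sub_one_le hβ hα hα1).trans ?_
    calc 8.65 * β / Real.pi ^ 3 / (1 - α * β / Real.pi)
        ≤ 8.65 * β / Real.pi ^ 3 / (1 - 0.34) := by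
          gcongr
      _ = 8.65 / (1 - 0.34) * (β / Real.pi ^ 3) := by ring
      _ ≤ 14 * (β / Real.pi ^ 3) := by gcongr; norm_num
      _ = _ := by ring
  have key : ∀ τ ∈ Set.Icc (0 : ℝ) 1,
      ‖phi β (boundaryHam h a l₀ q s) (hamTau h a l₀ q s τ)
        - phi β (boundaryHam h a l₀ q s) (hamTauLocal h a l₀ q s r τ)‖
      ≤ (β / 2 * (T + T * U / 2 * (9 * β / Real.pi ^ 3) + U ^ 2 * A₀ * (14 * β / Real.pi ^ 3)))
        + (β / 2 * (T * U * (9 * β / Real.pi ^ 3))) * τ := fun τ hτ => by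
    have hD := norm_heis_hamTau_sub_le hh hJ hg hl ha hs hr hκ.le hM hw hα hA hF hG hτ
    have e : (fun t => fBeta β t * (T + (1 + 2 * τ) * (T * U / 2) * |t|
        + U ^ 2 * A₀ * ((Real.exp (α * |t|) - 1) / α)))
        = fun t => T * fBeta β t + (1 + 2 * τ) * (T * U / 2) * (fBeta β t * |t|)
          + U ^ 2 * A₀ * (fBeta β t * ((Real.exp (α * |t|) - 1) / α)) := by
      ext t; ring
    have hi12 : Integrable fun t =>
        T * fBeta β t + (1 + 2 * τ) * (T * U / 2) * (fBeta β t * |t|) :=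
      (hI1.const_mul T).add (hI2.const_mul _)
    have hi := hi12.add (hI3.const_mul (U ^ 2 * A₀))
    refine (norm_phi_sub_phi_le hβ (isSelfAdjoint_hamTau h s τ) (isSelfAdjoint_hamTauLocal h s r τ)
      (by rw [e]; exact hi) hD).trans ?_
    have hint : ∫ t, fBeta β t * (T + (1 + 2 * τ) * (T * U / 2) * |t|
        + U ^ 2 * A₀ * ((Real.exp (α * |t|) - 1) / α))
        = T + (1 + 2 * τ) * (T * U / 2) * (∫ t, fBeta β t * |t|)
          + U ^ 2 * A₀ * ∫ t, fBeta β t * ((Real.exp (α * |t|) - 1) / α) := by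
      rw [e, integral_add hi12 (hI3.const_mul _),
        integral_add (hI1.const_mul T) (hI2.const_mul _), integral_const_mul, integral_const_mul,
        integral_const_mul, integral_fBeta hβ, mul_one]
    rw [hint]
    have hτ0 := hτ.1
    calc _ ≤ β / 2 * (T + (1 + 2 * τ) * (T * U / 2) * (9 * β / Real.pi ^ 3)
          + U ^ 2 * A₀ * (14 * β / Real.pi ^ 3)) := by gcongr
      _ = _ := by ring
  have hb : ∀ H : Op n d, IsSelfAdjoint H → ‖phi β (boundaryHam h a l₀ q s) H‖ ≤ β * U / 2 :=
      fun H hH => (norm_phi_le hβ _ hH).trans (by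
    calc β / 2 * ‖boundaryHam h a l₀ q s‖ ≤ β / 2 * U := by gcongr
      _ = _ := by ring)
  refine (norm_timeOrderedExp_sub_le (continuous_phi hβ _ hcH fun τ => isSelfAdjoint_hamTau h s τ)
    (continuous_phi hβ _ hcL fun τ => isSelfAdjoint_hamTauLocal h s r τ)
    (a := β * U / 2) (by positivity) (fun τ _ => hb _ (isSelfAdjoint_hamTau h s τ))
    (fun τ _ => hb _ (isSelfAdjoint_hamTauLocal h s r τ)) key).trans ?_
  refine mul_le_mul_of_nonneg_left ?_ (Real.exp_pos _).le
  calc _ = β / 2 * T + β ^ 2 / (2 * Real.pi ^ 3) * (9 * T * U + U ^ 2 * (14 * A₀)) := by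
        field_simp; ring
    _ ≤ _ := by gcongr

/-- The bound that only uses the norm of `h_s`. -/
theorem norm_Phi_sub_PhiLocal_le_of_norm_le {β U : ℝ} (hβ : 0 < β)
    (hU : ‖boundaryHam h a l₀ q s‖ ≤ U) :
    ‖Phi h a l₀ q β s - PhiLocal h a l₀ q β s r‖ ≤ Real.exp (β * U / 2) * (β / 2 * U) := by
  have hU0 : 0 ≤ U := (norm_nonneg _).trans hU
  have hcH : Continuous fun τ : ℝ => hamTau h a l₀ q s τ :=
    continuous_const.add (Complex.continuous_ofReal.smul continuous_const)
  have hcL : Continuous fun τ : ℝ => hamTauLocal h a l₀ q s r τ :=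
    continuous_const.add (Complex.continuous_ofReal.smul continuous_const)
  have hb : ∀ H : Op n d, IsSelfAdjoint H → ‖phi β (boundaryHam h a l₀ q s) H‖ ≤ β * U / 2 :=
      fun H hH => (norm_phi_le hβ _ hH).trans (by
    calc β / 2 * ‖boundaryHam h a l₀ q s‖ ≤ β / 2 * U := by gcongr
      _ = _ := by ring)
  have key : ∀ τ ∈ Set.Icc (0 : ℝ) 1,
      ‖phi β (boundaryHam h a l₀ q s) (hamTau h a l₀ q s τ)
        - phi β (boundaryHam h a l₀ q s) (hamTauLocal h a l₀ q s r τ)‖ ≤ β / 2 * U + 0 * τ :=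
      fun τ _ => by
    refine (norm_phi_sub_phi_le hβ (isSelfAdjoint_hamTau h s τ) (isSelfAdjoint_hamTauLocal h s r τ)
      ((integrable_fBeta hβ).mul_const U) fun t =>
        ((halfBounded_boundaryHam h s).norm_heis_sub_heis_le (isSelfAdjoint_hamTau h s τ)
          (isSelfAdjoint_hamTauLocal h s r τ) t).trans hU).trans (le_of_eq ?_)
    rw [integral_mul_const, integral_fBeta hβ]; ring
  refine (norm_timeOrderedExp_sub_le (continuous_phi hβ _ hcH fun τ => isSelfAdjoint_hamTau h s τ)
    (continuous_phi hβ _ hcL fun τ => isSelfAdjoint_hamTauLocal h s r τ)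
    (a := β * U / 2) (by positivity) (fun τ _ => hb _ (isSelfAdjoint_hamTau h s τ))
    (fun τ _ => hb _ (isSelfAdjoint_hamTauLocal h s r τ)) key).trans (le_of_eq ?_)
  ring

end LocalEvolution

/-! ### Windows inside the regular blocks with `r > 6l₀`. -/

section Truncated

open Classical

variable {n d k : ℕ} {a l₀ q s b r : ℕ}

theorem mem_middle_iff_lt (hl : 0 < l₀) (i : Fin n) :
    i ∈ middle n a l₀ q ↔ a ≤ (i : ℕ) ∧ (i : ℕ) < a + q * l₀ := by
  rw [mem_middle_iff hl]
  have h1 : ((i : ℕ) - a) / l₀ < q ↔ (i : ℕ) - a < q * l₀ := Nat.div_lt_iff_lt_mul hl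
  unfold blockIndex
  generalize ((i : ℕ) - a) / l₀ = m at *
  split_ifs <;> omega

theorem blockIndex_eq_zero {i : ℕ} (h : i < a) : blockIndex a l₀ q i = 0 := by
  simp [blockIndex, h]

theorem blockIndex_eq_add_one (hl : 0 < l₀) {i : ℕ} (h : a + q * l₀ ≤ i) :
    blockIndex a l₀ q i = q + 1 := by
  have h1 : q ≤ (i - a) / l₀ ↔ q * l₀ ≤ i - a := Nat.le_div_iff_mul_le hl
  unfold blockIndex
  split_ifs <;> omega

/-- In a window inside `B_1 ∪ ⋯ ∪ B_q` with `r > 6 l₀`, all crossing terms are distant. -/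
theorem distant_of_mem_crossingSets (hl : 0 < l₀)
    (hmid : window n b r ⊆ middle n a l₀ q) (ha : 0 < a) (hr : 6 * l₀ < r) {Z : Finset (Fin n)}
    (hZ : Z ∈ crossingSets n a l₀ q b r) : Distant b r Z := by
  have hadj : InAdjacentBlocks a l₀ q Z := by
    have := (Finset.mem_filter.1 hZ).1
    exact (mem_halfSets_iff.1 this).2.1
  have hwin : ∀ i : Fin n, b ≤ (i : ℕ) + r → (i : ℕ) ≤ b + r →
      a ≤ (i : ℕ) ∧ (i : ℕ) < a + q * l₀ := fun i h1 h2 =>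
    (mem_middle_iff_lt hl i).1 (hmid ((mem_window_iff i).2 ⟨h1, h2⟩))
  obtain ⟨t, ht, hadj'⟩ := (inAdjacentBlocks_iff hl Z).1 hadj
  rcases exists_of_mem_crossingSets hZ with ⟨hside, ⟨i, hi, hi'⟩, j, hj, hj'⟩ |
    ⟨hside, ⟨i, hi, hi'⟩, j, hj, hj'⟩
  · refine .inl fun z hz => ?_
    have hjw := hwin j hj' (by have := hside j hj; omega)
    rcases lt_or_ge ((z : ℕ) + r) b with hzb | hzb
    · omega
    have hzw := hwin z hzb (by have := hside z hz; omega)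
    -- If the term starts in the possibly long block `B_0`, then it ends in `B_1`, less than `l₀`
    -- beyond `a ≤ b - r`. Otherwise its diameter is below `2l₀`.
    rcases lt_or_ge (i : ℕ) a with hia | hia
    · have h0 := hwin ⟨b - r, by omega⟩ (by simp only; omega) (by simp only; omega)
      simp only at h0
      have hi0 := hadj' i hi
      have hzt := hadj' z hz
      rw [blockIndex_eq_zero hia] at hi0
      have hz1 := (mem_middle_iff hl z).1 ((mem_middle_iff_lt hl z).2 hzw)
      have hb := blockIndex_bounds hl (show blockIndex a l₀ q z = 1 by omega) le_rfl (by omega)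
      omega
    · have := lt_add_of_inAdjacentBlocks hl hadj hi hz
        ((mem_middle_iff_lt hl i).2 ⟨hia, by omega⟩) ((mem_middle_iff_lt hl z).2 hzw)
      omega
  · refine .inr fun z hz => ?_
    have hjw := hwin j (by have := hside j hj; omega) hj'
    rcases lt_or_ge (b + r) (z : ℕ) with hzb | hzb
    · omega
    have hzw := hwin z (by have := hside z hz; omega) hzb
    rcases lt_or_ge (i : ℕ) (a + q * l₀) with hia | hia
    · have := lt_add_of_inAdjacentBlocks hl hadj hz hi
        ((mem_middle_iff_lt hl z).2 hzw) ((mem_middle_iff_lt hl i).2 ⟨by omega, hia⟩)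
      omega
    · have h0 := hwin ⟨b + r, by omega⟩ (by simp only; omega) (by simp only; omega)
      simp only at h0
      have hi0 := hadj' i hi
      have hzt := hadj' z hz
      rw [blockIndex_eq_add_one hl hia] at hi0
      have hz1 := (mem_middle_iff hl z).1 ((mem_middle_iff_lt hl z).2 hzw)
      have hb := blockIndex_bounds hl (show blockIndex a l₀ q z = q by omega) (by omega) le_rfl
      have hq : q * l₀ = (q - 1) * l₀ + l₀ := by
        rw [Nat.sub_one_mul, Nat.sub_add_cancel]
        exact Nat.le_mul_of_pos_left _ (by omega)
      omega

/-- A window inside the regular blocks keeps `B_s` and a nonempty `B_{s+1}` among them, so boundary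
terms stay within `l₀` of the cut. -/
theorem farSets_eq_empty (hl : 0 < l₀) (ha : 0 < a) (hs : s ≤ q) (hn : a + q * l₀ ≤ n)
    (hmid : window n (lastSite a l₀ s) r ⊆ middle n a l₀ q) (hr : 6 * l₀ < r) :
    farSets n a l₀ q s r = ∅ := by
  have hsq : s * l₀ ≤ q * l₀ := Nat.mul_le_mul_right _ hs
  have hwin : ∀ i : Fin n, lastSite a l₀ s ≤ (i : ℕ) + r → (i : ℕ) ≤ lastSite a l₀ s + r →
      a ≤ (i : ℕ) ∧ (i : ℕ) < a + q * l₀ := fun i h1 h2 =>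
    (mem_middle_iff_lt hl i).1 (hmid ((mem_window_iff i).2 ⟨h1, h2⟩))
  have hb := hwin ⟨lastSite a l₀ s, by unfold lastSite; omega⟩ (by simp only; omega)
    (by simp only; omega)
  simp only [lastSite] at hb hwin
  have hs1 : 1 ≤ s := by
    by_contra h0
    obtain rfl : s = 0 := by omega
    omega
  refine Finset.filter_eq_empty_iff.2 fun X hX => ?_
  rw [not_not]
  intro i hi
  simp only [lastSite]
  have hsl : s * l₀ = (s - 1) * l₀ + l₀ := by
    rw [Nat.sub_one_mul, Nat.sub_add_cancel]
    exact Nat.le_mul_of_pos_left _ (by omega)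
  rcases ((mem_boundarySets_iff hl hs X).1 hX).1 i hi with h | h
  · have := blockIndex_bounds hl h hs1 hs
    omega
  · rcases Nat.lt_or_ge s q with hsq' | hsq'
    · have := blockIndex_bounds hl h (by omega) (by omega)
      rw [Nat.add_sub_cancel, Nat.succ_mul] at this
      omega
    -- For `s = q` the block `B_{q+1}` contains `i`, hence its first site exists and lies in the
    -- window but not in the middle.
    · exfalso
      obtain rfl : s = q := by omega
      have hlt : ¬(i : ℕ) ≤ lastSite a l₀ s := by
        rw [le_lastSite_iff hl ha hs]; omega
      simp only [lastSite] at hlt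
      have := hwin ⟨a + s * l₀, by omega⟩ (by simp only; omega) (by simp only; omega)
      simp only at this
      omega

end Truncated

/-! ### Vanishing boundary terms and the reduced bound. -/

section Bounds

open Classical

variable {n d k : ℕ} {a l₀ q s r : ℕ} {γ g : ℝ} {J : ℕ → ℝ} {h : Interaction n d k}

theorem boundaryHam_eq_zero (hl : 0 < l₀) (ha : 0 < a) (hs : s ≤ q) (hk : k < 2) :
    boundaryHam h a l₀ q s = 0 := by
  rw [boundaryHam_eq]
  refine Finset.sum_eq_zero fun Z hZ => h.isLocal Z (hk.trans_le ?_)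
  obtain ⟨⟨i, hi, hi'⟩, j, hj, hj'⟩ := exists_sides_of_mem_boundarySets hl ha hs hZ
  exact Finset.one_lt_card.2 ⟨i, hi, j, hj, by rintro rfl; omega⟩

/-- If `k < 2` or `J 1 = 0`, then the boundary terms vanish. -/
theorem norm_Phi_sub_PhiLocal_le_zero (hh : HasDecay h g J) (hJ : IsDecay γ J) (hg : 0 ≤ g)
    (hl : 0 < l₀) (ha : 0 < a) (hs : s ≤ q) {β : ℝ} (hβ : 0 < β) (hkJ : k < 2 ∨ J 1 = 0) :
    ‖Phi h a l₀ q β s - PhiLocal h a l₀ q β s r‖ ≤ 0 := by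
  have h0 : ‖boundaryHam h a l₀ q s‖ ≤ 0 := by
    rcases hkJ with hk | hJ1
    · rw [boundaryHam_eq_zero hl ha hs hk, norm_zero]
    · simpa [hJ1] using hh.norm_boundaryHam_le (q := q) (s := s) hJ hg hl ha hs
  simpa using norm_Phi_sub_PhiLocal_le_of_norm_le (r := r) hβ h0

/-- The bound for windows inside `B_1 ∪ ⋯ ∪ B_q` with `r > 6 l₀`. -/
theorem norm_Phi_sub_PhiLocal_le_of_subset_middle (hh : HasDecay h g J) (hJ : IsDecay γ J)
    (hg : 0 ≤ g) (hl : 0 < l₀) (ha : 0 < a) (hs : s ≤ q) (hn : a + q * l₀ ≤ n)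
    (hmid : window n (lastSite a l₀ s) r ⊆ middle n a l₀ q) (hr : 6 * l₀ < r)
    {β κ M v : ℝ} (hβ : 0 < β) (hκ : 0 < κ) (hv : 0 < v) (hκv : κ ≤ Real.exp 1 / 2 * v)
    (hM : 0 ≤ M) (hw : HasWeights h a l₀ q s r κ M) :
    ‖Phi h a l₀ q β s - PhiLocal h a l₀ q β s r‖ ≤ Real.exp (β * (g * γ * J 1) / 2) *
      (β ^ 2 / (2 * Real.pi ^ 3) *
        ((g * γ * J 1) ^ 2 * (14 * (√M + 4 * M ^ (Real.pi / (4 * v * β)))))) := by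
  have h1 : ‖∑ Z ∈ farSets n a l₀ q s r, h.term Z‖ ≤ 0 := by
    rw [farSets_eq_empty hl ha hs hn hmid hr, Finset.sum_empty, norm_zero]
  have h2 : ‖∑ Z ∈ crossingSets n a l₀ q (lastSite a l₀ s) r with
      ¬Distant (lastSite a l₀ s) r Z, h.term Z‖ ≤ 0 := by
    rw [Finset.filter_eq_empty_iff.2 fun Z hZ => not_not.2
      (distant_of_mem_crossingSets hl hmid ha hr hZ), Finset.sum_empty, norm_zero]
  refine (norm_Phi_sub_PhiLocal_le hh hJ hg hl ha hs (by omega) hβ hκ hv hκv hM hw h1 h2).trans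
    (le_of_eq ?_)
  ring

end Bounds

/-! ### Numerical estimates for the stated bounds. -/

section ScalarBounds

variable {g γ β 𝔤 : ℝ} {k r : ℕ} {J : ℕ → ℝ}

theorem floor_div_three (r : ℕ) : ⌊(r : ℝ) / 3⌋₊ = r / 3 := by
  have := Nat.floor_div_eq_div (K := ℝ) r 3
  simpa using this

theorem lrV_pos (hg : 0 < g) (hk : 1 ≤ k) : 0 < lrV g k 𝔤 := by
  have : (1 : ℝ) ≤ k := by exact_mod_cast hk
  exact lt_of_lt_of_le (by positivity) (le_max_left _ _)

theorem two_le_mul_lrC (hk : 1 ≤ k) (h𝔤 : 1 ≤ 𝔤) : 2 ≤ k * lrC k 𝔤 := by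
  have hk' : (1 : ℝ) ≤ k := by exact_mod_cast hk
  have : (k : ℝ) * lrC k 𝔤 = 2 + 2 * (k / 𝔤) := by
    unfold lrC; field_simp
  rw [this]
  have : 0 ≤ (k : ℝ) / 𝔤 := by positivity
  linarith

theorem lrC_le_four (hk : 1 ≤ k) (h𝔤 : 1 ≤ 𝔤) : lrC k 𝔤 ≤ 4 := by
  have hk' : (1 : ℝ) ≤ k := by exact_mod_cast hk
  have h1 : 1 / (k : ℝ) ≤ 1 := by rw [div_le_one (by linarith)]; exact hk'
  have h2 : 1 / 𝔤 ≤ 1 := by rw [div_le_one (by linarith)]; exact h𝔤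
  unfold lrC; linarith

theorem lrC_pos (hk : 1 ≤ k) (h𝔤 : 1 ≤ 𝔤) : 0 < lrC k 𝔤 := by
  have hk' : (1 : ℝ) ≤ k := by exact_mod_cast hk
  unfold lrC; positivity

theorem sqrt_mul_mul {C : ℝ} (hC : 0 ≤ C) (M : ℝ) : √(C * (C * M)) = C * √M := by
  rw [← mul_assoc, Real.sqrt_mul (mul_self_nonneg _), Real.sqrt_mul_self hC]

/-- Since `k ≥ 2` and `kC ≥ 2`, one has `14 ≤ 9kC` and `14 · 4 ≤ 72k`; `γ ≥ 1` gives `U ≤ g̃`. -/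
theorem le_boundGeneral_scalar (hg : 0 < g) (hγ : 1 ≤ γ) (hβ : 0 < β) (hk : 2 ≤ k) (h𝔤 : 1 ≤ 𝔤)
    (hJ : ∀ x, 0 ≤ J x) {M T p : ℝ} (hM : 0 ≤ M) (hp : p = Real.pi / (4 * lrV g k 𝔤 * β))
    (hT : 9 * T ≤ 2 * (g * γ * (r : ℝ) ^ 2 * J ⌊(r : ℝ) / 3⌋₊)) :
    Real.exp (β * (g * γ * J 1) / 2) * (β / 2 * T + β ^ 2 / (2 * Real.pi ^ 3) *
      (9 * T * (g * γ * J 1) + (g * γ * J 1) ^ 2 * (14 * (√M + 4 * M ^ p))))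
      ≤ boundGeneral g γ β k 𝔤 J r (lrC k 𝔤 * M) := by
  have hC := lrC_pos (k := k) (by omega) h𝔤
  have hkC := two_le_mul_lrC (k := k) (by omega) h𝔤
  have hk' : (2 : ℝ) ≤ k := by exact_mod_cast hk
  have hπ := Real.pi_pos
  unfold boundGeneral
  rw [← hp, mul_div_cancel_left₀ _ hC.ne', sqrt_mul_mul hC.le]
  set U := g * γ * J 1 with hU
  have hU0 : 0 ≤ U := mul_nonneg (by positivity) (hJ 1)
  have hG : gTilde g γ J = γ * U := by rw [hU]; unfold gTilde; ring
  rw [hG]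
  have hUG : U ≤ γ * U := le_mul_of_one_le_left hU0 hγ
  set G := γ * U
  set C := lrC k 𝔤
  set X := (r : ℝ) ^ 2 * J ⌊(r : ℝ) / 3⌋₊ with hX
  have hX0 : 0 ≤ X := mul_nonneg (by positivity) (hJ _)
  set c := β ^ 2 / (2 * Real.pi ^ 3) with hc
  have hc0 : 0 ≤ c := by positivity
  have hMp : 0 ≤ M ^ p := Real.rpow_nonneg hM p
  have hs := Real.sqrt_nonneg M
  have hT' : 9 * T ≤ 2 * (g * γ * X) := by
    refine hT.trans (le_of_eq ?_); rw [hX]; ring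
  have hgX : 0 ≤ g * γ * X := by positivity
  have hexp : Real.exp (β * U / 2) ≤ Real.exp (β * G / 2) := by gcongr
  have h1 : β / 2 * (g * γ * X) ≤ β * (g * γ ^ 2 * X) := by
    have h : g * γ * X ≤ g * γ ^ 2 * X := by
      have e : g * γ ^ 2 * X = γ * (g * γ * X) := by ring
      rw [e]
      exact le_mul_of_one_le_left hgX hγ
    nlinarith
  have h2 : 2 * (g * γ * X) * U ≤ k * G * (g * γ ^ 2 * X) := by
    calc 2 * (g * γ * X) * U = 2 * U * (g * γ * X) := by ring
      _ ≤ k * G * (γ * (g * γ * X)) := by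
        gcongr ?_ * ?_ * ?_
        exact le_mul_of_one_le_left hgX hγ
      _ = _ := by ring
  have h3 : U ^ 2 * (14 * √M) ≤ k * G * (9 * G * (C * √M)) := by
    calc U ^ 2 * (14 * √M) ≤ G ^ 2 * (9 * (2 * √M)) := by
          gcongr ?_ ^ 2 * ?_
          linarith
      _ ≤ G ^ 2 * (9 * (k * C * √M)) := by gcongr
      _ = _ := by ring
  have h4 : U ^ 2 * (56 * M ^ p) ≤ k * G * (72 * G * M ^ p) := by
    calc U ^ 2 * (56 * M ^ p) ≤ G ^ 2 * (2 * (72 * M ^ p)) := by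
          gcongr ?_ ^ 2 * ?_
          linarith
      _ ≤ G ^ 2 * (k * (72 * M ^ p)) := by gcongr
      _ = _ := by ring
  have h5 := mul_le_mul_of_nonneg_left (add_le_add (add_le_add h2 h3) h4) hc0
  calc _ ≤ Real.exp (β * U / 2) * (β / 2 * (g * γ * X) + c * (2 * (g * γ * X) * U
        + U ^ 2 * (14 * √M) + U ^ 2 * (56 * M ^ p))) := by
        have e : U ^ 2 * (14 * (√M + 4 * M ^ p)) = U ^ 2 * (14 * √M) + U ^ 2 * (56 * M ^ p) := by
          ring
        rw [e, ← add_assoc]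
        gcongr
        linarith
    _ ≤ Real.exp (β * G / 2) * (β * (g * γ ^ 2 * X) + c * (k * G * (g * γ ^ 2 * X)
        + k * G * (9 * G * (C * √M)) + k * G * (72 * G * M ^ p))) :=
        mul_le_mul hexp (add_le_add h1 h5) (by positivity) (Real.exp_pos _).le
    _ = _ := by rw [hX, hc]; ring

/-- Here `√F` carries `√C` instead of `C`. From `kC ≥ 2` and `k ≥ 2` follows `C ≥ 4/k²`, so `k√C ≥
2`. -/
theorem le_boundReduced_scalar (hg : 0 < g) (hγ : 1 ≤ γ) (hk : 2 ≤ k) (hβ : 0 < β) (h𝔤 : 1 ≤ 𝔤)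
    (hJ : ∀ x, 0 ≤ J x) {M p : ℝ} (hM : 0 ≤ M) (hp : p = Real.pi / (4 * lrV g k 𝔤 * β)) :
    Real.exp (β * (g * γ * J 1) / 2) * (β ^ 2 / (2 * Real.pi ^ 3) *
      ((g * γ * J 1) ^ 2 * (14 * (√M + 4 * M ^ p))))
      ≤ boundReduced g γ β k 𝔤 J (lrC k 𝔤 * M) := by
  have hC := lrC_pos (k := k) (by omega) h𝔤
  have hkC := two_le_mul_lrC (k := k) (by omega) h𝔤
  have hk' : (2 : ℝ) ≤ k := by exact_mod_cast hk
  have hπ := Real.pi_pos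
  unfold boundReduced
  rw [← hp, mul_div_cancel_left₀ _ hC.ne', Real.sqrt_mul hC.le]
  set U := g * γ * J 1 with hU
  have hU0 : 0 ≤ U := mul_nonneg (by positivity) (hJ 1)
  have hG : gTilde g γ J = γ * U := by rw [hU]; unfold gTilde; ring
  rw [hG]
  have hUG : U ≤ γ * U := le_mul_of_one_le_left hU0 hγ
  set G := γ * U
  set C := lrC k 𝔤
  have hkC2 : 2 ≤ k * √C := by
    have : (2 : ℝ) / k ≤ √C := by
      refine Real.le_sqrt_of_sq_le ?_
      rw [div_pow, div_le_iff₀ (by positivity)]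
      nlinarith
    rwa [div_le_iff₀ (by positivity), mul_comm] at this
  have hMp : 0 ≤ M ^ p := Real.rpow_nonneg hM p
  have hs := Real.sqrt_nonneg M
  have h2 : U ^ 2 ≤ G ^ 2 := by gcongr
  have hG2 : 0 ≤ G ^ 2 := sq_nonneg G
  calc _ ≤ Real.exp (β * G / 2) * (β ^ 2 / (2 * Real.pi ^ 3) *
        (G ^ 2 * (9 * (2 * √M) + 2 * (72 * M ^ p)))) := by gcongr; linarith
    _ ≤ Real.exp (β * G / 2) * (β ^ 2 / (2 * Real.pi ^ 3) *
        (G ^ 2 * (9 * (k * √C * √M) + k * (72 * M ^ p)))) := by gcongr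
    _ = _ := by ring

/-- The slope of `Θ`. -/
def thetaSlope (g γ : ℝ) (k : ℕ) : ℝ := g * γ ^ 2 / 2 + k * (g * γ ^ 2) + 48 * g * k / Real.pi

/-- Absorbs polynomial prefactors through `1 + x + x²/2 ≤ exp x`. The largest prefactor below is `y
+ 109y²`, and `218 = 2 · 109`. -/
theorem exp_mul_le_exp_theta (hg : 0 < g) (hβ : 0 < β) {P : ℝ}
    (hP : P ≤ 218 * (1 + k * (g * γ ^ 2) * β + (k * (g * γ ^ 2) * β) ^ 2 / 2)) :
    Real.exp (β * (g * γ ^ 2) / 2) * P ≤ Real.exp (230 + thetaSlope g γ k * β) := by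
  have h1 := Real.quadratic_le_exp_of_nonneg (x := k * (g * γ ^ 2) * β) (by positivity)
  have h2 : (218 : ℝ) ≤ Real.exp 230 := by
    have := Real.add_one_le_exp (230 : ℝ); linarith
  have hπ := Real.pi_pos
  calc _ ≤ Real.exp (β * (g * γ ^ 2) / 2) *
        (Real.exp 230 * Real.exp (k * (g * γ ^ 2) * β)) := by
        gcongr
        refine hP.trans ?_
        gcongr
    _ = Real.exp (230 + (g * γ ^ 2 / 2 + k * (g * γ ^ 2)) * β) := by
        rw [← Real.exp_add, ← Real.exp_add]; congr 1; ring
    _ ≤ _ := by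
        refine Real.exp_le_exp.2 (add_le_add_right (mul_le_mul_of_nonneg_right ?_ hβ.le) _)
        unfold thetaSlope
        have : 0 ≤ 48 * g * k / Real.pi := by positivity
        linarith

theorem gTilde_le (hg : 0 < g) (hJ : IsDecay γ J) : gTilde g γ J ≤ g * γ ^ 2 :=
  mul_le_of_le_one_right (by positivity) (hJ.le_one 1)

theorem gTilde_nonneg (hg : 0 < g) (hJ : IsDecay γ J) : 0 ≤ gTilde g γ J :=
  mul_nonneg (by positivity) (hJ.nonneg 1)

theorem one_le_two_mul_pi_pow : 1 ≤ 2 * Real.pi ^ 3 := by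
  have := one_le_pow₀ (n := 3) (show (1 : ℝ) ≤ Real.pi by linarith [Real.pi_gt_three])
  linarith

/-- The factor `k` allowed in front of `N` is harmless: together with the prefactor it only produces
`y² = (k g γ² β)²`. -/
theorem boundGeneral_le (hg : 0 < g) (hβ : 0 < β) (hk : 1 ≤ k) (h𝔤 : 1 ≤ 𝔤) (hJ : IsDecay γ J)
    {M N p : ℝ} (hM : 0 ≤ M) (hp : p = Real.pi / (4 * lrV g k 𝔤 * β)) (hN : 0 ≤ N)
    (h1 : √M ≤ k * N) (h2 : M ^ p ≤ k * N) :
    boundGeneral g γ β k 𝔤 J r (lrC k 𝔤 * M) ≤ Real.exp (230 + thetaSlope g γ k * β) *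
      ((r : ℝ) ^ 2 * J ⌊(r : ℝ) / 3⌋₊ + N) := by
  have hC := lrC_pos (k := k) hk h𝔤
  have hC4 := lrC_le_four (k := k) hk h𝔤
  have hk' : (1 : ℝ) ≤ k := by exact_mod_cast hk
  have hπ3 := one_le_two_mul_pi_pow
  have hπ := Real.pi_pos
  unfold boundGeneral
  rw [← hp, mul_div_cancel_left₀ _ hC.ne', sqrt_mul_mul hC.le]
  have hG := gTilde_le hg hJ
  have hG0 := gTilde_nonneg hg hJ
  set G := gTilde g γ J
  set G₀ := g * γ ^ 2 with hG₀
  set C := lrC k 𝔤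
  set X := (r : ℝ) ^ 2 * J ⌊(r : ℝ) / 3⌋₊ with hX
  have hX0 : 0 ≤ X := mul_nonneg (by positivity) (hJ.nonneg _)
  have hG₀0 : 0 ≤ G₀ := hG0.trans hG
  set y := k * G₀ * β with hy
  have hy0 : 0 ≤ y := by positivity
  have hGk : G₀ * β ≤ y := by
    rw [hy]; gcongr; exact le_mul_of_one_le_left hG₀0 hk'
  have hdiv : ∀ z : ℝ, 0 ≤ z → z / (2 * Real.pi ^ 3) ≤ z := fun z hz => div_le_self hz hπ3
  have hA : β * G₀ * (1 + k * G * β / (2 * Real.pi ^ 3)) ≤ y * (1 + y) := by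
    gcongr
    · rw [mul_comm]; exact hGk
    · refine (hdiv _ (by positivity)).trans ?_
      rw [hy]; gcongr
  have hB : k * G * β ^ 2 / (2 * Real.pi ^ 3) * (9 * G * (C * √M) + 72 * G * M ^ p)
      ≤ 108 * y ^ 2 * N := by
    calc _ ≤ k * G₀ * β ^ 2 * (9 * G₀ * (4 * (k * N)) + 72 * G₀ * (k * N)) := by
          gcongr
          refine (hdiv _ (by positivity)).trans ?_
          gcongr
      _ = _ := by rw [hy]; ring
  have hAB : β * g * γ ^ 2 * (r : ℝ) ^ 2 * (1 + k * G * β / (2 * Real.pi ^ 3)) *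
      J ⌊(r : ℝ) / 3⌋₊ + k * G * β ^ 2 / (2 * Real.pi ^ 3) * (9 * G * (C * √M) + 72 * G * M ^ p)
      ≤ y * (1 + y) * X + 108 * y ^ 2 * N := by
    refine add_le_add (le_trans (le_of_eq ?_) (mul_le_mul_of_nonneg_right hA hX0)) hB
    rw [hX, hG₀]; ring
  calc _ ≤ Real.exp (β * G₀ / 2) * (y * (1 + y) * X + 108 * y ^ 2 * N) := by
        refine mul_le_mul (by gcongr) hAB ?_ (Real.exp_pos _).le
        have := hJ.nonneg ⌊(r : ℝ) / 3⌋₊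
        positivity
    _ ≤ Real.exp (β * G₀ / 2) * ((y * (1 + y) + 108 * y ^ 2) * (X + N)) := by
        gcongr
        nlinarith [mul_nonneg (sq_nonneg y) hX0, mul_nonneg (sq_nonneg y) hN, mul_nonneg hy0 hN]
    _ = Real.exp (β * G₀ / 2) * (y * (1 + y) + 108 * y ^ 2) * (X + N) := by ring
    _ ≤ _ := by
        gcongr
        refine exp_mul_le_exp_theta hg hβ ?_
        rw [← hG₀, ← hy]
        nlinarith [sq_nonneg y]

theorem boundReduced_le (hg : 0 < g) (hβ : 0 < β) (hk : 1 ≤ k) (h𝔤 : 1 ≤ 𝔤) (hJ : IsDecay γ J)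
    {M N p : ℝ} (hM : 0 ≤ M) (hp : p = Real.pi / (4 * lrV g k 𝔤 * β)) (hN : 0 ≤ N)
    (h1 : √M ≤ k * N) (h2 : M ^ p ≤ k * N) :
    boundReduced g γ β k 𝔤 J (lrC k 𝔤 * M) ≤ Real.exp (230 + thetaSlope g γ k * β) * N := by
  have hC := lrC_pos (k := k) hk h𝔤
  have hC4 := lrC_le_four (k := k) hk h𝔤
  have hk' : (1 : ℝ) ≤ k := by exact_mod_cast hk
  have hπ3 := one_le_two_mul_pi_pow
  have hπ := Real.pi_pos
  unfold boundReduced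
  rw [← hp, mul_div_cancel_left₀ _ hC.ne', Real.sqrt_mul hC.le]
  have hG := gTilde_le hg hJ
  have hG0 := gTilde_nonneg hg hJ
  set G := gTilde g γ J
  set G₀ := g * γ ^ 2 with hG₀
  set C := lrC k 𝔤
  have hG₀0 : 0 ≤ G₀ := hG0.trans hG
  have hsC : √C ≤ 2 := by
    rw [Real.sqrt_le_left (by norm_num)]; linarith
  set y := k * G₀ * β with hy
  have hy0 : 0 ≤ y := by positivity
  calc _ ≤ Real.exp (β * G₀ / 2) * (k * G₀ * β ^ 2) *
        (9 * G₀ * (2 * (k * N)) + 72 * G₀ * (k * N)) := by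
        gcongr
        refine (div_le_self (by positivity) hπ3).trans ?_
        gcongr
    _ = Real.exp (β * G₀ / 2) * (90 * y ^ 2) * N := by rw [hy]; ring
    _ ≤ _ := by
        gcongr
        refine exp_mul_le_exp_theta hg hβ ?_
        rw [← hG₀, ← hy]
        nlinarith [sq_nonneg y]

/-- For the exponential estimate of part (2), whose constants may not involve `𝔤` and which
therefore bypasses `boundReduced`. -/
theorem exp_mul_sq_le (hg : 0 < g) (hγ : 1 ≤ γ) (hβ : 0 < β) (hk : 1 ≤ k) (hJ : IsDecay γ J)
    {A B N : ℝ} (hN : 0 ≤ N) (h1 : A ≤ N) (h2 : B ≤ N) :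
    Real.exp (β * (g * γ * J 1) / 2) * (β ^ 2 / (2 * Real.pi ^ 3) *
      ((g * γ * J 1) ^ 2 * (14 * (A + 4 * B))))
      ≤ Real.exp (230 + thetaSlope g γ k * β) * N := by
  have hk' : (1 : ℝ) ≤ k := by exact_mod_cast hk
  have hπ3 := one_le_two_mul_pi_pow
  have hπ := Real.pi_pos
  have hJ1 := hJ.nonneg 1
  have hU : g * γ * J 1 ≤ g * γ ^ 2 := by
    calc g * γ * J 1 ≤ g * γ * γ := by
          gcongr; exact (hJ.le_one 1).trans hγ
      _ = _ := by ring
  set U := g * γ * J 1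
  have hU0 : 0 ≤ U := mul_nonneg (by positivity) hJ1
  set G₀ := g * γ ^ 2 with hG₀
  have hG₀0 : 0 ≤ G₀ := hU0.trans hU
  set y := k * G₀ * β with hy
  have hGk : G₀ * β ≤ y := by
    rw [hy]; gcongr; exact le_mul_of_one_le_left hG₀0 hk'
  have hy2 : (G₀ * β) ^ 2 ≤ y ^ 2 := by gcongr
  have hy0 : 0 ≤ y := by positivity
  calc _ ≤ Real.exp (β * U / 2) *
        (β ^ 2 / (2 * Real.pi ^ 3) * (U ^ 2 * (14 * (N + 4 * N)))) := by gcongr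
    _ ≤ Real.exp (β * G₀ / 2) * (β ^ 2 * (G₀ ^ 2 * (14 * (N + 4 * N)))) := by
        gcongr
        exact div_le_self (by positivity) hπ3
    _ = Real.exp (β * G₀ / 2) * (70 * (G₀ * β) ^ 2) * N := by ring
    _ ≤ _ := by
        gcongr
        refine exp_mul_le_exp_theta hg hβ ?_
        rw [← hG₀, ← hy]
        nlinarith [sq_nonneg y]

/-- With `η = 2 + (4 v / π) β`, the exponents `1 / 2` and `π / (4 v β)` are at least `1 / η`. -/
theorem rpow_le_rpow_inv_eta {v M : ℝ} (hv : 0 < v) (hβ : 0 < β) (hM : 0 ≤ M) (hM1 : M ≤ 1) :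
    √M ≤ M ^ (1 / (2 + 4 * v / Real.pi * β)) ∧
      M ^ (Real.pi / (4 * v * β)) ≤ M ^ (1 / (2 + 4 * v / Real.pi * β)) := by
  have hπ := Real.pi_pos
  have h0 : 0 < 4 * v / Real.pi * β := by positivity
  have he : 0 < 1 / (2 + 4 * v / Real.pi * β) := by positivity
  rcases hM.eq_or_lt with rfl | hM0
  · have : 0 < Real.pi / (4 * v * β) := by positivity
    rw [Real.zero_rpow he.ne', Real.zero_rpow this.ne', Real.sqrt_zero]
    exact ⟨le_rfl, le_rfl⟩
  · rw [Real.sqrt_eq_rpow]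
    refine ⟨Real.rpow_le_rpow_of_exponent_ge hM0 hM1 ?_,
      Real.rpow_le_rpow_of_exponent_ge hM0 hM1 ?_⟩
    · exact one_div_le_one_div_of_le (by norm_num) (by linarith)
    · have : Real.pi / (4 * v * β) = 1 / (4 * v / Real.pi * β) := by field_simp
      rw [this]
      exact one_div_le_one_div_of_le h0 (by linarith)

/-- `C` may be less than `1`, but `kC ≥ 1`; the loss is a power of `k` rather than a constant
depending on `𝔤`. -/
theorem rpow_le_mul_rpow {M C e : ℝ} (hk : 1 ≤ k) (hC : 1 ≤ k * C) (hM : 0 ≤ M) (he : 0 ≤ e)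
    (he1 : e ≤ 1) : M ^ e ≤ k * (C * M) ^ e := by
  have hk' : (1 : ℝ) ≤ k := by exact_mod_cast hk
  have hC0 : 0 ≤ C := by
    by_contra h
    nlinarith
  calc M ^ e ≤ (k * C * M) ^ e :=
        Real.rpow_le_rpow hM (le_mul_of_one_le_left hM hC) he
    _ = (k : ℝ) ^ e * (C * M) ^ e := by
        rw [mul_assoc, Real.mul_rpow (by positivity) (by positivity)]
    _ ≤ _ := by
        gcongr
        exact Real.rpow_le_self_of_one_le hk' he1

theorem boundGeneral_nonneg (hg : 0 < g) (hβ : 0 < β) (hJ : IsDecay γ J) {F : ℝ}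
    (hF : 0 ≤ F / lrC k 𝔤) : 0 ≤ boundGeneral g γ β k 𝔤 J r F := by
  have h1 := gTilde_nonneg hg hJ
  have h2 := hJ.nonneg ⌊(r : ℝ) / 3⌋₊
  have hπ := Real.pi_pos
  unfold boundGeneral
  positivity

theorem boundReduced_nonneg (hg : 0 < g) (hJ : IsDecay γ J) {F : ℝ}
    (hF : 0 ≤ F / lrC k 𝔤) : 0 ≤ boundReduced g γ β k 𝔤 J F := by
  have h1 := gTilde_nonneg hg hJ
  have hπ := Real.pi_pos
  unfold boundReduced
  positivity

end ScalarBounds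

/-! ### Assembly of the estimates. -/

section Proposition

open Classical

variable {n d k : ℕ} {a l₀ q s r : ℕ} {γ g β 𝔤 : ℝ} {J : ℕ → ℝ} {h : Interaction n d k}

theorem two_le_exp_one : 2 ≤ Real.exp 1 := by
  have := Real.add_one_le_exp (1 : ℝ); linarith

theorem mul_le_exp_mul_lrV (hg : 0 < g) (hk : 1 ≤ k) : g * 𝔤 ≤ Real.exp 1 / 2 * lrV g k 𝔤 := by
  have h1 : 2 * g * 𝔤 ≤ lrV g k 𝔤 := le_max_right _ _
  have h2 := lrV_pos (𝔤 := 𝔤) hg hk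
  nlinarith [two_le_exp_one]

theorem exp_mul_le_exp_mul_lrV : Real.exp 1 * g * k ≤ Real.exp 1 / 2 * lrV g k 𝔤 := by
  have h1 : 2 * g * k ≤ lrV g k 𝔤 := le_max_left _ _
  have := mul_le_mul_of_nonneg_left h1 (Real.exp_pos 1).le
  linarith

/-- The errors from the terms that cross the distance `r / 3` near the cut and near the ends of
the window. -/
theorem le_boundGeneral (hh : HasDecay h g J) (hJ : IsDecay γ J) (hg : 0 < g) (hk : 1 ≤ k)
    (hl : 0 < l₀) (ha : 0 < a) (hs : s ≤ q) (hr : 0 < r) (hβ : 0 < β) (h𝔤 : 1 ≤ 𝔤) {κ M : ℝ}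
    (hκ : 0 < κ) (hκv : κ ≤ Real.exp 1 / 2 * lrV g k 𝔤) (hM : 0 ≤ M)
    (hw : HasWeights h a l₀ q s r κ M) :
    ‖Phi h a l₀ q β s - PhiLocal h a l₀ q β s r‖
      ≤ boundGeneral g γ β k 𝔤 J r (lrC k 𝔤 * M) := by
  have hC := lrC_pos (k := k) hk h𝔤
  -- The numerical comparison needs `k ≥ 2` and `γ ≥ 1`; the latter follows from `J 1 > 0`. In the
  -- remaining cases `h_s = 0`.
  by_cases hkJ : k < 2 ∨ J 1 = 0
  · refine (norm_Phi_sub_PhiLocal_le_zero hh hJ hg.le hl ha hs hβ hkJ).trans (boundGeneral_nonneg hg hβ hJ ?_)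
    rwa [mul_div_cancel_left₀ _ hC.ne']
  rw [not_or, not_lt] at hkJ
  have hγ := hJ.one_le (lt_of_le_of_ne (hJ.nonneg 1) (Ne.symm hkJ.2))
  -- For `r < 3` there is no gap to exploit, but `J(⌊r/3⌋) = 1` and the bound by `‖h_s‖` suffices.
  rcases Nat.eq_zero_or_pos (r / 3) with hr3 | hr3
  · have hk' : (0 : ℝ) ≤ k := Nat.cast_nonneg k
    have hG := gTilde_nonneg hg hJ
    have hπ := Real.pi_pos
    have hr1 : (1 : ℝ) ≤ r := by exact_mod_cast hr
    have hU : g * γ * J 1 ≤ gTilde g γ J := by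
      have := hJ.nonneg 1
      have e : gTilde g γ J = γ * (g * γ * J 1) := by unfold gTilde; ring
      rw [e]
      exact le_mul_of_one_le_left (by positivity) hγ
    refine (norm_Phi_sub_PhiLocal_le_of_norm_le hβ
      ((hh.norm_boundaryHam_le hJ hg.le hl ha hs).trans hU)).trans ?_
    unfold boundGeneral
    rw [mul_div_cancel_left₀ _ hC.ne', floor_div_three, hr3, hJ.zero]
    refine mul_le_mul_of_nonneg_left ?_ (Real.exp_pos _).le
    have h1 : β / 2 * gTilde g γ J ≤ β * g * γ ^ 2 := by
      have := mul_le_mul_of_nonneg_left (gTilde_le hg hJ) hβ.le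
      nlinarith [mul_nonneg hβ.le hG]
    have h2 : (1 : ℝ) ≤ (r : ℝ) ^ 2 := one_le_pow₀ hr1
    have h3 : 1 ≤ 1 + k * gTilde g γ J * β / (2 * Real.pi ^ 3) := by
      have : 0 ≤ k * gTilde g γ J * β / (2 * Real.pi ^ 3) := by positivity
      linarith
    have h4 : β * g * γ ^ 2 ≤ β * g * γ ^ 2 * (r : ℝ) ^ 2 *
        (1 + k * gTilde g γ J * β / (2 * Real.pi ^ 3)) * 1 := by
      rw [mul_one, mul_assoc (β * g * γ ^ 2)]
      exact le_mul_of_one_le_right (by positivity) (one_le_mul_of_one_le_of_one_le h2 h3)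
    refine (h1.trans h4).trans (le_add_of_nonneg_right ?_)
    positivity
  · have hT : ∀ {p p' : ℕ} (S : Finset (Finset (Fin n))),
        (∀ Z ∈ S, Spans p (r / 3) Z ∨ Spans p' (r / 3) Z) →
        ‖∑ Z ∈ S, h.term Z‖ ≤ 2 * (g * (γ * ((r / 3 : ℕ) : ℝ) ^ 2 * J (r / 3))) := fun S hS =>
      (norm_sum_le _ _).trans (hh.sum_norm_le_of_spans_or hJ hg.le hr3 S hS)
    have h1 := hT _ fun Z hZ => spans_of_mem_farSets (r := r) hl ha hs hZ
    have h2 := hT {Z ∈ crossingSets n a l₀ q (lastSite a l₀ s) r |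
      ¬Distant (lastSite a l₀ s) r Z} fun Z hZ =>
        spans_of_not_distant (Finset.mem_filter.1 hZ).1 (Finset.mem_filter.1 hZ).2
    refine (norm_Phi_sub_PhiLocal_le hh hJ hg.le hl ha hs hr hβ hκ (lrV_pos hg hk) hκv hM hw
      h1 h2).trans (le_boundGeneral_scalar hg hγ hβ hkJ.1 h𝔤 hJ.nonneg hM rfl ?_)
    rw [floor_div_three]
    have h3 : 3 * ((r / 3 : ℕ) : ℝ) ≤ r := by
      exact_mod_cast Nat.mul_div_le r 3
    have h4 : 9 * ((r / 3 : ℕ) : ℝ) ^ 2 ≤ (r : ℝ) ^ 2 := by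
      calc 9 * ((r / 3 : ℕ) : ℝ) ^ 2 = (3 * ((r / 3 : ℕ) : ℝ)) ^ 2 := by ring
        _ ≤ _ := by gcongr
    have h5 := hJ.nonneg (r / 3)
    calc _ = 2 * (g * γ * (9 * ((r / 3 : ℕ) : ℝ) ^ 2) * J (r / 3)) := by ring
      _ ≤ _ := by gcongr

theorem le_boundReduced (hh : HasDecay h g J) (hJ : IsDecay γ J) (hg : 0 < g) (hk : 1 ≤ k)
    (hl : 0 < l₀) (ha : 0 < a) (hs : s ≤ q) (hn : a + q * l₀ ≤ n)
    (hmid : window n (lastSite a l₀ s) r ⊆ middle n a l₀ q) (hr : 6 * l₀ < r)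
    (hβ : 0 < β) (h𝔤 : 1 ≤ 𝔤) {κ M : ℝ}
    (hκ : 0 < κ) (hκv : κ ≤ Real.exp 1 / 2 * lrV g k 𝔤) (hM : 0 ≤ M)
    (hw : HasWeights h a l₀ q s r κ M) :
    ‖Phi h a l₀ q β s - PhiLocal h a l₀ q β s r‖ ≤ boundReduced g γ β k 𝔤 J (lrC k 𝔤 * M) := by
  have hC := lrC_pos (k := k) hk h𝔤
  by_cases hkJ : k < 2 ∨ J 1 = 0
  · refine (norm_Phi_sub_PhiLocal_le_zero hh hJ hg.le hl ha hs hβ hkJ).trans (boundReduced_nonneg hg hJ ?_)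
    rwa [mul_div_cancel_left₀ _ hC.ne']
  rw [not_or, not_lt] at hkJ
  have hγ := hJ.one_le (lt_of_le_of_ne (hJ.nonneg 1) (Ne.symm hkJ.2))
  exact (norm_Phi_sub_PhiLocal_le_of_subset_middle hh hJ hg.le hl ha hs hn hmid hr hβ hκ
    (lrV_pos hg hk) hκv hM hw).trans (le_boundReduced_scalar hg hγ hkJ.1 hβ h𝔤 hJ.nonneg hM rfl)

/-- The minimum is one of its two entries, and the corresponding weight is used. -/
theorem exists_hasWeights_min (hh : HasDecay h g J) (hJ : IsDecay γ J) (hg : 0 < g) (hk : 1 ≤ k)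
    (hl : 0 < l₀) (hmid : window n (lastSite a l₀ s) r ⊆ middle n a l₀ q)
    (h𝔤 : 𝔤 ∈ convConsts n J) (h𝔤1 : 1 ≤ 𝔤) :
    ∃ κ, 0 < κ ∧ κ ≤ Real.exp 1 / 2 * lrV g k 𝔤 ∧ HasWeights h a l₀ q s r κ
      (min (Real.exp (-((r : ℝ) / 3) / (2 * l₀))) (J (r / 3))) := by
  have hk' : (1 : ℝ) ≤ k := by exact_mod_cast hk
  rcases le_total (Real.exp (-((r : ℝ) / 3) / (2 * l₀))) (J (r / 3)) with h1 | h1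
  · rw [min_eq_left h1]
    exact ⟨Real.exp 1 * g * k, by positivity, exp_mul_le_exp_mul_lrV,
      hasWeights_exp hh hJ hl hmid⟩
  · rw [min_eq_right h1]
    exact ⟨g * 𝔤, by positivity, mul_le_exp_mul_lrV hg hk, hasWeights_decay hh hJ hg.le h𝔤⟩

/-- The exponential weight alone permits `v = 2gk`, free of `𝔤`. With `M = exp(-r/(6l₀))`, the two
powers decay at the rates `1/(12l₀)` and `π/(48gkβl₀)`, both at least `1/(l₀Θ)`. -/
theorem norm_Phi_sub_PhiLocal_le_exp (hh : HasDecay h g J) (hJ : IsDecay γ J) (hg : 0 < g)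
    (hk : 1 ≤ k) (hl : 0 < l₀) (ha : 0 < a) (hs : s ≤ q) (hn : a + q * l₀ ≤ n)
    (hmid : window n (lastSite a l₀ s) r ⊆ middle n a l₀ q) (hr : 6 * l₀ < r) (hβ : 0 < β) :
    ‖Phi h a l₀ q β s - PhiLocal h a l₀ q β s r‖ ≤ Real.exp (230 + thetaSlope g γ k * β) *
      Real.exp (-(r : ℝ) / (l₀ * (230 + thetaSlope g γ k * β))) := by
  by_cases hkJ : k < 2 ∨ J 1 = 0
  · exact (norm_Phi_sub_PhiLocal_le_zero hh hJ hg.le hl ha hs hβ hkJ).trans (by positivity)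
  rw [not_or, not_lt] at hkJ
  have hγ := hJ.one_le (lt_of_le_of_ne (hJ.nonneg 1) (Ne.symm hkJ.2))
  have hk' : (1 : ℝ) ≤ k := by exact_mod_cast hk
  have hl' : (0 : ℝ) < l₀ := by exact_mod_cast hl
  have hπ := Real.pi_pos
  have hslope : 48 * g * k / Real.pi ≤ thetaSlope g γ k := by
    unfold thetaSlope
    have : 0 ≤ g * γ ^ 2 / 2 + k * (g * γ ^ 2) := by positivity
    linarith
  have hpos : 0 < 48 * g * k / Real.pi := by positivity
  have hslopeβ : 48 * g * k / Real.pi * β ≤ thetaSlope g γ k * β := by gcongr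
  have hposβ : 0 < 48 * g * k / Real.pi * β := by positivity
  refine (norm_Phi_sub_PhiLocal_le_of_subset_middle hh hJ hg.le hl ha hs hn hmid hr hβ
    (by positivity) (v := 2 * g * k) (by positivity) (le_of_eq (by ring)) (Real.exp_pos _).le
    (hasWeights_exp hh hJ hl hmid)).trans
    (exp_mul_sq_le hg hγ hβ hk hJ (Real.exp_pos _).le ?_ ?_)
  · rw [Real.sqrt_eq_rpow, ← Real.exp_mul]
    refine Real.exp_le_exp.2 ?_
    have e : -((r : ℝ) / 3) / (2 * l₀) * (1 / 2) = -(r : ℝ) / (l₀ * 12) := by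
      field_simp; ring
    rw [e, neg_div, neg_div, neg_le_neg_iff]
    gcongr
    linarith
  · rw [← Real.exp_mul]
    refine Real.exp_le_exp.2 ?_
    have e : -((r : ℝ) / 3) / (2 * l₀) * (Real.pi / (4 * (2 * g * k) * β))
        = -(r : ℝ) / (l₀ * (48 * g * k / Real.pi * β)) := by
      field_simp; ring
    rw [e, neg_div, neg_div, neg_le_neg_iff]
    gcongr
    linarith

end Proposition

end QBP

end

theorem mainTheorem2 (g γ : ℝ) (k : ℕ) (hg : 0 < g) (hγ : 0 < γ) (hk : 1 ≤ k) :
    -- `Θ(β) = θ₀ + θ₁ β` depends only on `g, γ, k`; `Θ'(β) = η₀ + η₁ β` also on `𝔤`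
    ∃ θ₀ θ₁ : ℝ, 0 < θ₀ ∧ 0 < θ₁ ∧ ∀ 𝔤 : ℝ, ∃ η₀ η₁ : ℝ, 0 < η₀ ∧ 0 < η₁ ∧
    ∀ (n d : ℕ) (J : ℕ → ℝ) (h : QBP.Interaction n d k) (a l₀ q : ℕ),
      QBP.IsDecay γ J → QBP.HasDecay h g J →
      (QBP.convConsts n J).Nonempty → QBP.convConst n J = 𝔤 →
      0 < a → 0 < l₀ → a + q * l₀ ≤ n →
    ∀ (s : ℕ) (r : ℕ) (β : ℝ), s ≤ q → 0 < r → 0 < β →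
      -- the general bound, for every boundary `s` and every `r`
      (QBP.lrInfinite k 𝔤 J (r / 3) ≤ 1 →
        ‖QBP.Phi h a l₀ q β s - QBP.PhiLocal h a l₀ q β s r‖
            ≤ QBP.boundGeneral g γ β k 𝔤 J r (QBP.lrInfinite k 𝔤 J (r / 3)) ∧
        QBP.boundGeneral g γ β k 𝔤 J r (QBP.lrInfinite k 𝔤 J (r / 3))
            ≤ Real.exp (θ₀ + θ₁ * β) *
              ((r : ℝ) ^ 2 * J ⌊(r : ℝ) / 3⌋₊ +
                QBP.lrInfinite k 𝔤 J (r / 3) ^ (1 / (η₀ + η₁ * β)))) ∧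
      -- windows `[i_s - r, i_s + r]` inside `B_1 ∪ ⋯ ∪ B_q`
      (QBP.window n (QBP.lastSite a l₀ s) r ⊆ QBP.middle n a l₀ q →
        (QBP.lrTruncated k 𝔤 J l₀ (r / 3) ≤ 1 →
          ‖QBP.Phi h a l₀ q β s - QBP.PhiLocal h a l₀ q β s r‖
              ≤ QBP.boundGeneral g γ β k 𝔤 J r (QBP.lrTruncated k 𝔤 J l₀ (r / 3)) ∧
          QBP.boundGeneral g γ β k 𝔤 J r (QBP.lrTruncated k 𝔤 J l₀ (r / 3))
              ≤ Real.exp (θ₀ + θ₁ * β) *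
                ((r : ℝ) ^ 2 * J ⌊(r : ℝ) / 3⌋₊ +
                  QBP.lrTruncated k 𝔤 J l₀ (r / 3) ^ (1 / (η₀ + η₁ * β)))) ∧
        (6 * l₀ < r →
          ‖QBP.Phi h a l₀ q β s - QBP.PhiLocal h a l₀ q β s r‖
              ≤ QBP.boundReduced g γ β k 𝔤 J (QBP.lrTruncated k 𝔤 J l₀ (r / 3)) ∧
          QBP.boundReduced g γ β k 𝔤 J (QBP.lrTruncated k 𝔤 J l₀ (r / 3))
              ≤ Real.exp (θ₀ + θ₁ * β) *
                QBP.lrTruncated k 𝔤 J l₀ (r / 3) ^ (1 / (η₀ + η₁ * β)) ∧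
          ‖QBP.Phi h a l₀ q β s - QBP.PhiLocal h a l₀ q β s r‖
              ≤ Real.exp (θ₀ + θ₁ * β) *
                min (Real.exp (-(r : ℝ) / (l₀ * (θ₀ + θ₁ * β))))
                  (J ⌊(r : ℝ) / 3⌋₊ ^ (1 / (η₀ + η₁ * β))))) := by
  have hπ := Real.pi_pos
  have hk' : (1 : ℝ) ≤ k := by exact_mod_cast hk
  -- `230` is generous: it has to dominate `log 218` and `12`. `Θ' = 2 + (4v/π)β` makes `1/Θ'` at
  -- most both exponents `1/2` and `π/(4vβ)`.
  refine ⟨230, QBP.thetaSlope g γ k, by norm_num, ?_, fun 𝔤 => ⟨2, 4 * QBP.lrV g k 𝔤 / Real.pi,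
    by norm_num, ?_, ?_⟩⟩
  · unfold QBP.thetaSlope; positivity
  · have := QBP.lrV_pos (𝔤 := 𝔤) hg hk
    positivity
  intro n d J h a l₀ q hJ hh hne h𝔤 ha hl hn s r β hs hr hβ
  have hv := QBP.lrV_pos (𝔤 := 𝔤) hg hk
  have hmem : 𝔤 ∈ QBP.convConsts n J := h𝔤 ▸ QBP.convConst_mem hJ (by omega) hne
  have h1 : 1 ≤ 𝔤 := QBP.one_le_of_mem_convConsts hJ (by omega) hmem
  have hC := QBP.lrC_pos hk h1
  have hkC : 1 ≤ k * QBP.lrC k 𝔤 := le_trans (by norm_num) (QBP.two_le_mul_lrC hk h1)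
  have hη : 0 < 4 * QBP.lrV g k 𝔤 / Real.pi * β := by positivity
  set e := 1 / (2 + 4 * QBP.lrV g k 𝔤 / Real.pi * β) with he
  have he0 : 0 ≤ e := by positivity
  have he1 : e ≤ 1 := by
    rw [he, div_le_one (by positivity)]; linarith
  -- Both powers of `M = F₀/C` are expressed through `F₀`, without a constant depending on `𝔤`.
  have hup : ∀ M : ℝ, 0 ≤ M → M ≤ 1 → √M ≤ k * (QBP.lrC k 𝔤 * M) ^ e ∧
      M ^ (Real.pi / (4 * QBP.lrV g k 𝔤 * β)) ≤ k * (QBP.lrC k 𝔤 * M) ^ e := fun M h0 hM => by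
    have h2 := QBP.rpow_le_rpow_inv_eta hv hβ h0 hM
    have h3 := QBP.rpow_le_mul_rpow hk hkC h0 he0 he1
    exact ⟨h2.1.trans h3, h2.2.trans h3⟩
  simp only [QBP.lrInfinite, QBP.lrTruncated, QBP.floor_div_three]
  have hJ0 := hJ.nonneg (r / 3)
  have hJ1 := hJ.le_one (r / 3)
  have hgen : ∀ M : ℝ, 0 ≤ M → M ≤ 1 → QBP.boundGeneral g γ β k 𝔤 J r (QBP.lrC k 𝔤 * M)
      ≤ Real.exp (230 + QBP.thetaSlope g γ k * β) *
        ((r : ℝ) ^ 2 * J (r / 3) + (QBP.lrC k 𝔤 * M) ^ e) := fun M h0 hM => by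
    rw [← QBP.floor_div_three]
    exact QBP.boundGeneral_le hg hβ hk h1 hJ h0 rfl (Real.rpow_nonneg (by positivity) _)
      (hup M h0 hM).1 (hup M h0 hM).2
  refine ⟨fun _ => ⟨QBP.le_boundGeneral hh hJ hg hk hl ha hs hr hβ h1 (by positivity)
    (QBP.mul_le_exp_mul_lrV hg hk) hJ0 (QBP.hasWeights_decay hh hJ hg.le hmem),
    hgen _ hJ0 hJ1⟩, fun hmid => ?_⟩
  obtain ⟨κ, hκ, hκv, hw⟩ := QBP.exists_hasWeights_min hh hJ hg hk hl hmid hmem h1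
  set M := min (Real.exp (-((r : ℝ) / 3) / (2 * l₀))) (J (r / 3)) with hM
  have hM0 : 0 ≤ M := le_min (Real.exp_pos _).le hJ0
  have hMJ : M ≤ J (r / 3) := min_le_right _ _
  have hM1 : M ≤ 1 := hMJ.trans hJ1
  refine ⟨fun _ => ⟨QBP.le_boundGeneral hh hJ hg hk hl ha hs hr hβ h1 hκ hκv hM0 hw,
    hgen _ hM0 hM1⟩, fun hr6 => ?_⟩
  have hred := QBP.le_boundReduced hh hJ hg hk hl ha hs hn hmid hr6 hβ h1 hκ hκv hM0 hw
  refine ⟨hred, QBP.boundReduced_le hg hβ hk h1 hJ hM0 rfl (Real.rpow_nonneg (by positivity) _)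
    (hup M hM0 hM1).1 (hup M hM0 hM1).2, ?_⟩
  -- For the `J̄` entry of the final minimum, `M ≤ J(⌊r/3⌋)` is used directly, without the factor
  -- `C`.
  have hJe : M ^ e ≤ k * J (r / 3) ^ e := by
    have := Real.rpow_le_rpow hM0 hMJ he0
    have h3 := Real.rpow_nonneg hJ0 e
    nlinarith
  have hexp := QBP.rpow_le_rpow_inv_eta hv hβ hM0 hM1
  rw [mul_min_of_nonneg _ _ (Real.exp_pos _).le]
  exact le_min (QBP.norm_Phi_sub_PhiLocal_le_exp hh hJ hg hk hl ha hs hn hmid hr6 hβ)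
    (hred.trans (QBP.boundReduced_le hg hβ hk h1 hJ hM0 rfl (Real.rpow_nonneg hJ0 _)
      (hexp.1.trans hJe) (hexp.2.trans hJe)))
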